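/- **Conventions.** A *partial group* is a nonempty simplicial set $M$ with a single vertex $v$, whose spine maps $M_n\to (M_1)^n$, $x\mapsto(x_1,\dots,x_n)$ (the edges $\{i-1,i\}$), are injective for $n\ge 1$ (so we write $x=[x_1|\dots|x_n]$), and which has an inversion: a simplicial map $\nu\colon M\to M^{\mathrm{op}}$ with $\nu^{-1}=\nu^{\mathrm{op}}$ such that for every $u\in M_n$, $n\ge1$, there is a simplex $[\nu(u)|u]\in M_{2n}$ whose edge $\{0,2n\}$ is $1:=s_0(v)$. The product $\Pi[x_1|\dots|x_n]=x_1\cdots x_n\in M_1$ is the edge $\{0,n\}$. Homomorphisms are simplicial maps; $BG$ is the bar construction of a group $G$. For simplicial maps $f,g\colon K\to X$ with $K$ having one vertex, and $\eta\in X_1$, write $f\xleftarrow{\ \eta\ }g$ if there is $F\colon K\times\Delta[1]\to X$ with $F|_{K\times v_0}=f$, $F|_{K\times v_1}=g$ and $F(1,\iota)=\eta$, where $\iota$ is the edge of $\Delta[1]$ from $v_0$ to $v_1$. Let $N(M)=\{\eta\in M_1 : c_\eta\xleftarrow{\eta}\mathrm{Id}_M \text{ for some } c_\eta\in\operatorname{Aut}(M)\}$,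 a group under the product of $M$; let $Z(M)\le N(M)$ be the abelian subgroup of those $\eta$ with $\mathrm{Id}_M\xleftarrow{\eta}\mathrm{Id}_M$; and let $\operatorname{Out}(M)=\operatorname{Aut}(M)/\{c_\eta:\eta\in N(M)\}$, which acts on $Z(M)$ by evaluation. An *extension* of $H$ by $M$ is a sequence $M\xrightarrow{\iota}E\xrightarrow{\tau}H$ of simplicial maps where $\tau$ is a fibre bundle with fibre $M$ ($\tau$ is surjective and its pullback along every $\Delta[n]\to H$ is isomorphic to $M\times\Delta[n]$ over $\Delta[n]$) and $\iota$ is an isomorphism onto the fibre over the vertex of $H$. Two extensions are *equivalent* if there is an isomorphism of total spaces commuting with the maps from $M$ and to $H$. The extension *has outer action* $\alpha\colon H\to B\operatorname{Out}(M)$ if for every $g\in H_1$ there are $z\in E_1$ with $\tau(z)=g$ and $f\in\operatorname{Aut}(M)$ of class $\alpha(g)$ with $\iota\circ f\xleftarrow{z}\iota$. Functions $t\colon H_1\to\operatorname{Aut}(M)$, $\eta\colon H_2\to N(M)$ form a *twisting pair of* $E$ if there are lifts $s(g)\in E_1$ of all $g\in H_1$ with $s(1)=1$, $\iota\circ t(g)\xleftarrow{s(g)}\iota$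 for all $g$, and $s(g)\cdot s(h)=\iota(\eta(g,h))\cdot s(gh)$ for all $[g|h]\in H_2$. Given $\alpha$, $H^n(H;Z(M))$ is the cohomology of the complex of functions $c\colon H_n\to Z(M)$ with twisted coboundary (written additively) $(dc)[g_1|\dots|g_{n+1}]=\alpha(g_1)\,c(d_0[g_1|\dots|g_{n+1}])+\sum_{i=1}^{n+1}(-1)^i c(d_i[g_1|\dots|g_{n+1}])$. **Theorem.** Let $M$ and $H$ be partial groups and let $\alpha\colon H\to B\operatorname{Out}(M)$ be an outer action. (a) There exist functions $t\colon H_1\to\operatorname{Aut}(M)$ and $\eta\colon H_2\to N(M)$ with $t(g)$ of class $\alpha(g)$, $t(1)=\mathrm{Id}$, $t(g)\circ t(h)\xleftarrow{\eta(g,h)}t(gh)$ for all $[g|h]\in H_2$, and $\eta(g,1)=1=\eta(1,g)$. For every such choice, $$\kappa[g|h|k]=\eta(g,h)\cdot\eta(gh,k)\cdot\eta(g,hk)^{-1}\cdot t(g)(\eta(h,k))^{-1}$$ is a $3$-cocycle of $H$ with values in $Z(M)$, and its class $[\kappa]\in H^3(H;Z(M))$ does not depend on the choice. There is an extension of $H$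 by $M$ with outer action $\alpha$ if and only if $[\kappa]=0$. (b) Suppose that such extensions exist, and let $\mathcal E(M,H,\alpha)$ be the set of their equivalence classes. Then $H^2(H;Z(M))$ acts freely and transitively on $\mathcal E(M,H,\alpha)$. In this action, every extension $E$ with outer action $\alpha$ has a twisting pair, and if $(t,\eta)$ is a twisting pair of $E$ and $w$ is a $2$-cocycle with $w(g,1)=0=w(1,g)$ for all $g$, then $[w]\cdot[E]$ is the class of exactly those extensions with outer action $\alpha$ for which $(t,w\eta)$ is a twisting pair. -/

import Mathlib

open CategoryTheory Simplicial MonoidalCategory CartesianMonoidalCategory Opposite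

universe u

namespace PartialGroups

/-! ## Partial groups as simplicial sets -/

/-- A simplicial set with exactly one vertex. -/
class IsReducedSSet (X : SSet.{u}) : Prop where
  nonempty_vertex : Nonempty (X _⦋0⦌)
  subsingleton_vertex : Subsingleton (X _⦋0⦌)

/-- The unique vertex of a reduced simplicial set. -/
noncomputable def vertex (X : SSet.{u}) [h : IsReducedSSet X] : X _⦋0⦌ :=
  h.nonempty_vertex.some

/-- The unit `1 = s₀(v)`, a `1`-simplex. -/
noncomputable def one (X : SSet.{u}) [IsReducedSSet X] : X _⦋1⦌ :=
  X.σ 0 (vertex X)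

/-- The spine of an `n`-simplex: the tuple of its edges `{i-1, i}`, `1 ≤ i ≤ n`. -/
def spine (X : SSet.{u}) {n : ℕ} (x : X _⦋n⦌) : Fin n → X _⦋1⦌ :=
  fun i => X.map (SimplexCategory.mkOfSucc i).op x

/-- The product of an `n`-simplex: its edge `{0, n}`. -/
def prod (X : SSet.{u}) {n : ℕ} (x : X _⦋n⦌) : X _⦋1⦌ :=
  X.map (SimplexCategory.diag n).op x

/-- A partial monoid: reduced, and simplices are determined by their spines. -/
class IsPartialMonoid (X : SSet.{u}) : Prop extends IsReducedSSet X where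
  spine_injective : ∀ n : ℕ, 1 ≤ n → Function.Injective (spine X (n := n))

/-- The action on `n`-simplices of a simplicial map `ν : X → Xᵒᵖ`, the `n`-simplices of
`Xᵒᵖ` being those of `X`. -/
def revApp {X : SSet.{u}} (ν : X ⟶ X.op) {n : ℕ} (x : X _⦋n⦌) : X _⦋n⦌ :=
  SSet.opObjEquiv (ν.app _ x)

/-- An inversion: an anti-involution `ν` such that every simplex `x` of dimension `n ≥ 1` has a
`2n`-simplex `[ν(x) | x]` (first `n` edges those of `ν(x)`, last `n` edges those of `x`), whose
product is `1`. -/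
structure IsInversion (X : SSet.{u}) [IsReducedSSet X] (ν : X ⟶ X.op) : Prop where
  involutive : ∀ (n : ℕ) (x : X _⦋n⦌), revApp ν (revApp ν x) = x
  exists_simplex : ∀ (n : ℕ), 1 ≤ n → ∀ x : X _⦋n⦌, ∃ w : X _⦋n + n⦌,
    X.map (SimplexCategory.subinterval 0 n (by omega)).op w = revApp ν x ∧
    X.map (SimplexCategory.subinterval n n (by omega)).op w = x ∧
    prod X w = one X

/-- A partial group: a partial monoid that has an inversion (which is then unique).
Homomorphisms of partial groups are arbitrary simplicial maps. -/
class IsPartialGroup (X : SSet.{u}) : Prop extends IsPartialMonoid X where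
  exists_inversion : ∃ ν : X ⟶ X.op, IsInversion X ν

/-- The bar construction `BG`. An `n`-simplex `[g₁|…|gₙ]` is recorded by the family
`c i j` which for `i ≤ j` is the product `gᵢ₊₁ ⋯ gⱼ` (and `c j i = (c i j)⁻¹`); such families
correspond bijectively to `n`-tuples through `gᵢ = c (i-1) i`. -/
def bar (G : Type u) [Group G] : SSet.{u} where
  obj n := {c : Fin (n.unop.len + 1) → Fin (n.unop.len + 1) → G //
    ∀ i j k, c i j * c j k = c i k}
  map f := ↾fun c => ⟨fun i j => c.1 (f.unop.toOrderHom i) (f.unop.toOrderHom j),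
    fun _ _ _ => c.2 _ _ _⟩

/-- The effect of a simplicial map `X → BG` on `1`-simplices, as a `G`-valued function. -/
def onEdges {X : SSet.{u}} {G : Type u} [Group G] (ρ : X ⟶ bar G) (x : X _⦋1⦌) : G :=
  (ρ.app _ x).1 0 1

/-- `a · b = c` in `X`: there is a `2`-simplex `[a | b]` whose product is `c`. -/
def IsProd (X : SSet.{u}) (a b c : X _⦋1⦌) : Prop :=
  ∃ w : X _⦋2⦌, X.δ 2 w = a ∧ X.δ 0 w = b ∧ X.δ 1 w = c

/-! ## Homotopies -/

/-- The fundamental `1`-simplex of `Δ[1]`. -/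
def iota : (Δ[1] : SSet.{u}) _⦋1⦌ := SSet.stdSimplex.objEquiv.symm (𝟙 ⦋1⦌)

/-- `η` determines a homotopy `f ⟵ g` (written `f ⟵[η] g`): there is `F : H × Δ[1] → X` that is
`f` at the vertex `v₀`, is `g` at the vertex `v₁`, and satisfies `F(1, ι) = η`. -/
def HomotopyBy {H X : SSet.{u}} [IsReducedSSet H] (η : X _⦋1⦌) (f g : H ⟶ X) : Prop :=
  ∃ F : H ⊗ (Δ[1] : SSet.{u}) ⟶ X,
    SSet.ι₀ ≫ F = f ∧ SSet.ι₁ ≫ F = g ∧ F.app (op ⦋1⦌) (one H, iota) = η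

section Lemmas

/-- The edge from vertex `i` to vertex `j` of a simplex. -/
def edge (X : SSet.{u}) {n : ℕ} (w : X _⦋n⦌) (i j : Fin (n + 1)) (h : i ≤ j) : X _⦋1⦌ :=
  X.map (SimplexCategory.mkOfLe i j h).op w

lemma map_map (X : SSet.{u}) {a b c : SimplexCategory} (f : a ⟶ b) (g : b ⟶ c)
    (x : X.obj (op c)) : X.map f.op (X.map g.op x) = X.map (f ≫ g).op x := by
  simp

lemma map_congr (X : SSet.{u}) {a b : SimplexCategory} {f g : a ⟶ b} (h : f = g)
    (x : X.obj (op b)) : X.map f.op x = X.map g.op x := by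
  rw [h]

lemma isProd_edge (X : SSet.{u}) {n : ℕ} (w : X _⦋n⦌) (i j k : Fin (n + 1)) (h : i ≤ j)
    (h' : j ≤ k) : IsProd X (edge X w i j h) (edge X w j k h') (edge X w i k (h.trans h')) := by
  refine ⟨X.map (SimplexCategory.mkOfLeComp i j k h h').op w, ?_, ?_, ?_⟩
  all_goals
    refine (map_map X _ _ w).trans (map_congr X ?_ w)
    ext x
    fin_cases x <;> rfl

lemma IsProd.unique {X : SSet.{u}} [IsPartialMonoid X] {a b c c' : X _⦋1⦌}
    (h : IsProd X a b c) (h' : IsProd X a b c') : c = c' := by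
  obtain ⟨w, h1, h2, h3⟩ := h
  obtain ⟨w', h1', h2', h3'⟩ := h'
  have : w = w' := by
    apply IsPartialMonoid.spine_injective 2 (by norm_num)
    have e0 : SimplexCategory.mkOfSucc (0 : Fin 2) = SimplexCategory.δ 2 := by
      ext x; fin_cases x <;> rfl
    have e1 : SimplexCategory.mkOfSucc (1 : Fin 2) = SimplexCategory.δ 0 := by
      ext x; fin_cases x <;> rfl
    funext i
    fin_cases i
    · change X.map (SimplexCategory.mkOfSucc (0 : Fin 2)).op w =
        X.map (SimplexCategory.mkOfSucc (0 : Fin 2)).op w'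
      rw [e0]; exact h1.trans h1'.symm
    · change X.map (SimplexCategory.mkOfSucc (1 : Fin 2)).op w =
        X.map (SimplexCategory.mkOfSucc (1 : Fin 2)).op w'
      rw [e1]; exact h2.trans h2'.symm
  rw [← h3, ← h3', this]

lemma IsProd.map {X Y : SSet.{u}} {a b c : X _⦋1⦌} (h : IsProd X a b c) (f : X ⟶ Y) :
    IsProd Y (f.app _ a) (f.app _ b) (f.app _ c) := by
  obtain ⟨w, rfl, rfl, rfl⟩ := h
  exact ⟨f.app _ w, (SSet.δ_naturality_apply f 2 w).symm, (SSet.δ_naturality_apply f 0 w).symm,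
    (SSet.δ_naturality_apply f 1 w).symm⟩

lemma vertex_eq (X : SSet.{u}) [h : IsReducedSSet X] (v w : X _⦋0⦌) : v = w :=
  h.subsingleton_vertex.elim _ _

lemma one_map {X Y : SSet.{u}} [IsReducedSSet X] [IsReducedSSet Y] (f : X ⟶ Y) :
    f.app _ (one X) = one Y := by
  unfold one
  rw [SSet.σ_naturality_apply, vertex_eq Y (f.app _ (vertex X)) (vertex Y)]

lemma isProd_one_left {X : SSet.{u}} [IsReducedSSet X] (a : X _⦋1⦌) : IsProd X (one X) a a := by
  refine ⟨X.σ 0 a, ?_, ?_, ?_⟩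
  · have := vertex_eq X (X.δ 1 a) (vertex X)
    rw [one, ← this]
    exact X.δ_comp_σ_of_gt_apply (i := 1) (j := 0) (by decide) a
  · exact X.δ_comp_σ_self_apply 0 a
  · exact X.δ_comp_σ_succ_apply 0 a

lemma isProd_one_right {X : SSet.{u}} [IsReducedSSet X] (a : X _⦋1⦌) :
    IsProd X a (one X) a := by
  refine ⟨X.σ 1 a, ?_, ?_, ?_⟩
  · exact X.δ_comp_σ_succ_apply 1 a
  · have := vertex_eq X (X.δ 0 a) (vertex X)
    rw [one, ← this]
    exact X.δ_comp_σ_of_le_apply (i := 0) (j := 0) (by decide) a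
  · exact X.δ_comp_σ_self_apply 1 a

/-- The value of `F : H × Δ[1] → X` at `(x, s)`, with `s` a simplex of `Δ[1]`. -/
def ev {H X : SSet.{u}} (F : H ⊗ (Δ[1] : SSet.{u}) ⟶ X) {n : SimplexCategory} (x : H.obj (op n))
    (s : n ⟶ ⦋1⦌) : X.obj (op n) :=
  F.app (op n) (x, SSet.stdSimplex.objEquiv.symm s)

lemma map_ev {H X : SSet.{u}} (F : H ⊗ (Δ[1] : SSet.{u}) ⟶ X) {m n : SimplexCategory}
    (x : H.obj (op n)) (s : n ⟶ ⦋1⦌) (f : m ⟶ n) :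
    X.map f.op (ev F x s) = ev F (H.map f.op x) (f ≫ s) :=
  (NatTrans.naturality_apply F f.op
    ((x, SSet.stdSimplex.objEquiv.symm s) : (H ⊗ (Δ[1] : SSet.{u})).obj (op n))).symm

lemma map_ev_map {H X : SSet.{u}} (F : H ⊗ (Δ[1] : SSet.{u}) ⟶ X) {l m n : SimplexCategory}
    (x : H.obj (op n)) (s : m ⟶ ⦋1⦌) (a : m ⟶ n) (f : l ⟶ m) {b : l ⟶ n} {t : l ⟶ ⦋1⦌}
    (hb : f ≫ a = b) (ht : f ≫ s = t) :
    X.map f.op (ev F (H.map a.op x) s) = ev F (H.map b.op x) t := by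
  rw [map_ev, map_map, hb, ht]

lemma map_id_op (X : SSet.{u}) {n : SimplexCategory} (x : X.obj (op n)) :
    X.map (𝟙 n : n ⟶ n).op x = x := by simp

lemma ev_zero {H X : SSet.{u}} (F : H ⊗ (Δ[1] : SSet.{u}) ⟶ X) {n : SimplexCategory}
    (x : H.obj (op n)) : ev F x (SimplexCategory.const n ⦋1⦌ 0) = (SSet.ι₀ ≫ F).app _ x := rfl

lemma ev_one {H X : SSet.{u}} (F : H ⊗ (Δ[1] : SSet.{u}) ⟶ X) {n : SimplexCategory}
    (x : H.obj (op n)) : ev F x (SimplexCategory.const n ⦋1⦌ 1) = (SSet.ι₁ ≫ F).app _ x := rfl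

lemma map_to_one {X : SSet.{u}} [IsReducedSSet X] {n : SimplexCategory} (f : ⦋1⦌ ⟶ n)
    (h : f.toOrderHom 0 = f.toOrderHom 1) (x : X.obj (op n)) : X.map f.op x = one X := by
  have : f = SimplexCategory.σ 0 ≫ SimplexCategory.const ⦋0⦌ n (f.toOrderHom 0) := by
    ext i
    fin_cases i
    · rfl
    · exact congrArg _ h.symm
  rw [this]
  have h2 := map_map X (SimplexCategory.σ 0) (SimplexCategory.const ⦋0⦌ n (f.toOrderHom 0)) x
  rw [← h2, vertex_eq X (X.map (SimplexCategory.const ⦋0⦌ n (f.toOrderHom 0)).op x) (vertex X)]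
  rfl

lemma isProd_ev {H X : SSet.{u}} [IsReducedSSet H] (F : H ⊗ (Δ[1] : SSet.{u}) ⟶ X)
    (x : H _⦋1⦌) :
    IsProd X (F.app (op ⦋1⦌) (one H, iota)) ((SSet.ι₁ ≫ F).app _ x) (ev F x (𝟙 _)) ∧
    IsProd X ((SSet.ι₀ ≫ F).app _ x) (F.app (op ⦋1⦌) (one H, iota)) (ev F x (𝟙 _)) := by
  have key : ∀ (a : ⦋1⦌ ⟶ ⦋1⦌), a.toOrderHom 0 = a.toOrderHom 1 →
      ev F (H.map a.op x) (𝟙 ⦋1⦌) = F.app (op ⦋1⦌) (one H, iota) := fun a ha => by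
    rw [map_to_one a ha]; rfl
  refine ⟨⟨ev F (H.map (SimplexCategory.σ 0).op x) (SimplexCategory.σ 1), ?_, ?_, ?_⟩,
    ⟨ev F (H.map (SimplexCategory.σ 1).op x) (SimplexCategory.σ 0), ?_, ?_, ?_⟩⟩
  · refine (map_ev_map F x _ _ (SimplexCategory.δ 2) rfl ?_).trans (key _ rfl)
    ext i; fin_cases i <;> rfl
  · refine (map_ev_map F x _ _ (SimplexCategory.δ 0) (b := 𝟙 _)
      (t := SimplexCategory.const _ _ 1) ?_ ?_).trans ?_
    · ext i; fin_cases i <;> rfl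
    · ext i; fin_cases i <;> rfl
    · rw [map_id_op, ev_one]
  · refine (map_ev_map F x _ _ (SimplexCategory.δ 1) (b := 𝟙 _) (t := 𝟙 _) ?_ ?_).trans ?_
    · ext i; fin_cases i <;> rfl
    · ext i; fin_cases i <;> rfl
    · rw [map_id_op]
  · refine (map_ev_map F x _ _ (SimplexCategory.δ 2) (b := 𝟙 _)
      (t := SimplexCategory.const _ _ 0) ?_ ?_).trans ?_
    · ext i; fin_cases i <;> rfl
    · ext i; fin_cases i <;> rfl
    · rw [map_id_op, ev_zero]
  · refine (map_ev_map F x _ _ (SimplexCategory.δ 0) rfl ?_).trans (key _ rfl)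
    ext i; fin_cases i <;> rfl
  · refine (map_ev_map F x _ _ (SimplexCategory.δ 1) (b := 𝟙 _) (t := 𝟙 _) ?_ ?_).trans ?_
    · ext i; fin_cases i <;> rfl
    · ext i; fin_cases i <;> rfl
    · rw [map_id_op]

/-- A homotopy given by `η` from `g` to `f` yields `η · g(x) = f(x) · η` for all edges `x`. -/
lemma HomotopyBy.isProd {H X : SSet.{u}} [IsReducedSSet H] {η : X _⦋1⦌} {f g : H ⟶ X}
    (h : HomotopyBy η f g) (x : H _⦋1⦌) :
    ∃ c, IsProd X η (g.app _ x) c ∧ IsProd X (f.app _ x) η c := by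
  obtain ⟨F, rfl, rfl, rfl⟩ := h
  exact ⟨_, isProd_ev F x⟩

/-- Every `2`-simplex `τ` and homotopy `η` to `g` give a simplex `[η | g τ]`. -/
lemma HomotopyBy.exists_cons {H X : SSet.{u}} [IsReducedSSet H] {η : X _⦋1⦌} {f g : H ⟶ X}
    (h : HomotopyBy η f g) (τ : H _⦋2⦌) :
    ∃ w : X _⦋3⦌, edge X w 0 1 (by decide) = η ∧ X.δ 0 w = g.app _ τ := by
  obtain ⟨F, rfl, rfl, rfl⟩ := h
  refine ⟨ev F (H.map (SimplexCategory.σ 0).op τ)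
    (SimplexCategory.σ 1 ≫ SimplexCategory.σ 1), ?_, ?_⟩
  · refine (map_ev_map F τ _ _ _ rfl (t := 𝟙 _) ?_).trans ?_
    · ext i; fin_cases i <;> rfl
    · rw [map_to_one _ rfl]; rfl
  · refine (map_ev_map F τ _ _ (SimplexCategory.δ 0) (b := 𝟙 _)
      (t := SimplexCategory.const _ _ 1) ?_ ?_).trans ?_
    · ext i; fin_cases i <;> rfl
    · ext i; fin_cases i <;> rfl
    · rw [map_id_op, ev_one]

lemma homotopyBy_one {H X : SSet.{u}} [IsReducedSSet H] [IsReducedSSet X] (f : H ⟶ X) :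
    HomotopyBy (one X) f f :=
  ⟨fst _ _ ≫ f, rfl, rfl, one_map f⟩

lemma HomotopyBy.precomp {K H X : SSet.{u}} [IsReducedSSet K] [IsReducedSSet H] {η : X _⦋1⦌}
    {f g : H ⟶ X} (h : HomotopyBy η f g) (j : K ⟶ H) : HomotopyBy η (j ≫ f) (j ≫ g) := by
  obtain ⟨F, rfl, rfl, rfl⟩ := h
  refine ⟨j ▷ _ ≫ F, rfl, rfl, ?_⟩
  change F.app (op ⦋1⦌) (j.app _ (one K), iota) = _
  rw [one_map]

lemma HomotopyBy.postcomp {H X Y : SSet.{u}} [IsReducedSSet H] {η : X _⦋1⦌}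
    {f g : H ⟶ X} (h : HomotopyBy η f g) (k : X ⟶ Y) :
    HomotopyBy (k.app _ η) (f ≫ k) (g ≫ k) := by
  obtain ⟨F, rfl, rfl, rfl⟩ := h
  exact ⟨F ≫ k, rfl, rfl, rfl⟩

lemma HomotopyBy.comp {K H X : SSet.{u}} [IsReducedSSet K] [IsReducedSSet H] {η : X _⦋1⦌}
    {ζ : H _⦋1⦌} {f g : H ⟶ X} {i j : K ⟶ H} (h : HomotopyBy η f g) (h' : HomotopyBy ζ i j) :
    ∃ c, IsProd X η (g.app _ ζ) c ∧ HomotopyBy c (i ≫ f) (j ≫ g) := by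
  obtain ⟨F, rfl, rfl, rfl⟩ := h
  obtain ⟨G, rfl, rfl, rfl⟩ := h'
  exact ⟨_, (isProd_ev F _).1, lift G (snd _ _) ≫ F, rfl, rfl, rfl⟩

/-- The homotopy `(x, s) ↦ ν (F (ν x, sᵒᵖ))`. -/
def revHomotopy {H X : SSet.{u}} (μ : H ⟶ H.op) (ν : X ⟶ X.op)
    (F : H ⊗ (Δ[1] : SSet.{u}) ⟶ X) : H ⊗ (Δ[1] : SSet.{u}) ⟶ X where
  app n := ↾fun p => (SSet.opObjEquiv (ν.app n (F.app n (SSet.opObjEquiv (μ.app n p.1),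
    SSet.stdSimplex.objEquiv.symm (SimplexCategory.rev.map (SSet.stdSimplex.objEquiv p.2))))) :
      X.obj n)
  naturality m n f := by
    ext p
    obtain ⟨x, s⟩ := p
    have h1 : μ.app n (H.map f x) = H.op.map f (μ.app m x) := NatTrans.naturality_apply μ f x
    change SSet.opObjEquiv (ν.app n (F.app n (SSet.opObjEquiv (μ.app n (H.map f x)),
      SSet.stdSimplex.objEquiv.symm (SimplexCategory.rev.map (f.unop ≫
        SSet.stdSimplex.objEquiv s))))) = X.map f (SSet.opObjEquiv (ν.app m (F.app m
          (SSet.opObjEquiv (μ.app m x), SSet.stdSimplex.objEquiv.symm (SimplexCategory.rev.map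
            (SSet.stdSimplex.objEquiv s))))))
    rw [h1, SimplexCategory.rev.map_comp]
    let f' : m ⟶ n := (SimplexCategory.rev.map f.unop).op
    let p : (H ⊗ (Δ[1] : SSet.{u})).obj m := (SSet.opObjEquiv (μ.app m x),
      SSet.stdSimplex.objEquiv.symm (SimplexCategory.rev.map (SSet.stdSimplex.objEquiv s)))
    have h2 : F.app n ((H ⊗ (Δ[1] : SSet.{u})).map f' p) = X.map f' (F.app m p) :=
      NatTrans.naturality_apply F f' p
    have h3 : ν.app n (X.map f' (F.app m p)) = X.op.map f' (ν.app m (F.app m p)) :=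
      NatTrans.naturality_apply ν f' _
    refine Eq.trans (congrArg (fun z => SSet.opObjEquiv (ν.app n z)) h2) ?_
    refine Eq.trans (congrArg SSet.opObjEquiv h3) ?_
    change X.map (SimplexCategory.rev.map (SimplexCategory.rev.map f.unop)).op _ = _
    rw [SimplexCategory.rev_map_rev_map]
    rfl

/-- The inversion, as an isomorphism. -/
def revIso {X : SSet.{u}} [IsReducedSSet X] {ν : X ⟶ X.op} (hν : IsInversion X ν) : X ≅ X.op where
  hom := ν
  inv := SSet.opFunctor.map ν ≫ (SSet.opFunctorCompOpFunctorIso.app X).hom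
  hom_inv_id := by
    ext n x
    exact hν.involutive n.unop.len x
  inv_hom_id := by
    ext n x
    exact hν.involutive n.unop.len x

lemma IsInversion.isProd {X : SSet.{u}} [IsReducedSSet X] {ν : X ⟶ X.op} (hν : IsInversion X ν)
    (x : X _⦋1⦌) : IsProd X (revApp ν x) x (one X) := by
  obtain ⟨w, h1, h2, h3⟩ := hν.exists_simplex 1 le_rfl x
  have := isProd_edge X w 0 1 2 (by decide) (by decide)
  have e1 : edge X w 0 1 (by decide) = revApp ν x := by
    rw [← h1]; refine map_congr X ?_ w
    ext i; fin_cases i <;> rfl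
  have e2 : edge X w 1 2 (by decide) = x := by
    rw [← h2]; refine map_congr X ?_ w
    ext i; fin_cases i <;> rfl
  have e3 : edge X w 0 2 (by decide) = one X := by
    rw [← h3]; refine map_congr X ?_ w
    ext i; fin_cases i <;> rfl
  rwa [e1, e2, e3] at this

lemma HomotopyBy.exists_inv {X : SSet.{u}} [h : IsPartialGroup X] {η : X _⦋1⦌} {f : Aut X}
    (h : HomotopyBy η f.hom (𝟙 X)) :
    ∃ (η' : X _⦋1⦌) (f' : Aut X), HomotopyBy η' f'.hom (𝟙 X) ∧ IsProd X η' η (one X) := by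
  obtain ⟨ν, hν⟩ := IsPartialGroup.exists_inversion (X := X)
  let f' : Aut X := revIso hν ≪≫ SSet.opFunctor.mapIso f ≪≫ (revIso hν).symm
  have h' : HomotopyBy (revApp ν η) (𝟙 X) f'.hom := by
    obtain ⟨F, h0, h1, rfl⟩ := h
    refine ⟨revHomotopy ν ν F, ?_, ?_, ?_⟩
    · ext n x
      have : (SSet.ι₁ ≫ F).app n (revApp (n := n.unop.len) ν x) =
        revApp (n := n.unop.len) ν x := by rw [h1]; rfl
      refine Eq.trans ?_ (hν.involutive n.unop.len x)
      exact congrArg (revApp (n := n.unop.len) ν) this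
    · ext n x
      have : (SSet.ι₀ ≫ F).app n (revApp (n := n.unop.len) ν x) =
        f.hom.app n (revApp (n := n.unop.len) ν x) := by rw [h0]
      exact congrArg (revApp (n := n.unop.len) ν) this
    · have e : revApp ν (one X) = one X :=
        (isProd_one_right _).unique (hν.isProd (one X))
      change revApp ν (F.app (op ⦋1⦌) (revApp ν (one X), SSet.stdSimplex.objEquiv.symm
        (SimplexCategory.rev.map (𝟙 ⦋1⦌)))) = _
      rw [e, SimplexCategory.rev.map_id]
      rfl
  refine ⟨revApp ν η, f'⁻¹, ?_, hν.isProd η⟩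
  have := h'.precomp (f'⁻¹).hom
  rwa [Category.comp_id, show (f'⁻¹).hom ≫ f'.hom = 𝟙 X from f'.inv_hom_id] at this

lemma hom_ext {H X : SSet.{u}} [IsPartialMonoid X] {f g : H ⟶ X}
    (h : ∀ x : H _⦋1⦌, f.app _ x = g.app _ x) : f = g := by
  ext ⟨⟨n⟩⟩ x
  rcases n with _ | n
  · exact vertex_eq X _ _
  · refine IsPartialMonoid.spine_injective (n + 1) (by omega) (funext fun i => ?_)
    exact (NatTrans.naturality_apply f _ x).symm.trans
      ((h _).trans (NatTrans.naturality_apply g _ x))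

lemma HomotopyBy.eq_of_one {H X : SSet.{u}} [IsReducedSSet H] [IsPartialMonoid X] {f g : H ⟶ X}
    (h : HomotopyBy (one X) f g) : f = g := by
  refine hom_ext fun x => ?_
  obtain ⟨c, h1, h2⟩ := h.isProd x
  rw [(isProd_one_right _).unique h2, (isProd_one_left _).unique h1]

end Lemmas

/-! ## The normalizer, the center and the outer automorphism group -/

/-- The normalizer `N(M)`: the elements `η` of `M` for which there is an automorphism `c_η` of `M`
with `c_η ⟵[η] 1_M`. -/
def Normalizer (M : SSet.{u}) [IsPartialGroup M] : Type u :=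
  {η : M _⦋1⦌ // ∃ f : Aut M, HomotopyBy η f.hom (𝟙 M)}

namespace Normalizer

variable {M : SSet.{u}} [IsPartialGroup M]

lemma exists_mul (a b : Normalizer M) : ∃ c : Normalizer M, IsProd M a.1 b.1 c.1 := by
  obtain ⟨a, f, hf⟩ := a
  obtain ⟨b, g, hg⟩ := b
  obtain ⟨c, hc, h⟩ := hf.comp hg
  exact ⟨⟨c, f * g, h⟩, hc⟩

lemma exists_inv (a : Normalizer M) : ∃ c : Normalizer M, IsProd M c.1 a.1 (one M) := by
  obtain ⟨a, f, hf⟩ := a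
  obtain ⟨c, f', h, hc⟩ := hf.exists_inv
  exact ⟨⟨c, f', h⟩, hc⟩

/-- The product of `M`. -/
noncomputable instance : Mul (Normalizer M) := ⟨fun a b => (exists_mul a b).choose⟩

noncomputable instance : One (Normalizer M) := ⟨⟨one M, 1, homotopyBy_one _⟩⟩

noncomputable instance : Inv (Normalizer M) := ⟨fun a => (exists_inv a).choose⟩

lemma isProd_mul (a b : Normalizer M) : IsProd M a.1 b.1 (a * b).1 := (exists_mul a b).choose_spec

lemma mul_eq {a b c : Normalizer M} (h : IsProd M a.1 b.1 c.1) : a * b = c :=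
  Subtype.ext ((isProd_mul a b).unique h)

/-- `N(M)` is a group under the product of `M`. -/
noncomputable instance : Group (Normalizer M) :=
  Group.ofLeftAxioms
    (fun a b c => by
      obtain ⟨f, hf⟩ := a.2
      obtain ⟨τ, h1, h2, h3⟩ := isProd_mul b c
      obtain ⟨w, hw, hw'⟩ := hf.exists_cons τ
      have e12 : edge M w 1 2 (by decide) = b.1 := by
        rw [← h1, ← show M.δ 0 w = τ from hw']
        refine (Eq.trans (map_map M (SimplexCategory.δ 2) (SimplexCategory.δ 0) w)
          (map_congr M ?_ w)).symm
        ext i; fin_cases i <;> rfl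
      have e23 : edge M w 2 3 (by decide) = c.1 := by
        rw [← h2, ← show M.δ 0 w = τ from hw']
        refine (Eq.trans (map_map M (SimplexCategory.δ 0) (SimplexCategory.δ 0) w)
          (map_congr M ?_ w)).symm
        ext i; fin_cases i <;> rfl
      have e13 : edge M w 1 3 (by decide) = (b * c).1 := by
        rw [← h3, ← show M.δ 0 w = τ from hw']
        refine (Eq.trans (map_map M (SimplexCategory.δ 1) (SimplexCategory.δ 0) w)
          (map_congr M ?_ w)).symm
        ext i; fin_cases i <;> rfl
      have p1 := isProd_edge M w 0 1 2 (by decide) (by decide)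
      have p2 := isProd_edge M w 0 2 3 (by decide) (by decide)
      have p3 := isProd_edge M w 0 1 3 (by decide) (by decide)
      rw [hw, e12] at p1
      rw [hw, e13] at p3
      rw [e23, (isProd_mul a b).unique p1 |>.symm] at p2
      exact Subtype.ext (((isProd_mul _ _).unique p2).trans ((isProd_mul _ _).unique p3).symm))
    (fun a => mul_eq (isProd_one_left _))
    (fun a => mul_eq (exists_inv a).choose_spec)

lemma ext_iff' {a b : Normalizer M} : a = b ↔ a.1 = b.1 := Subtype.ext_iff

/-- Automorphisms of `M` act on `N(M)`. -/
noncomputable instance : MulDistribMulAction (Aut M) (Normalizer M) where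
  smul f a := ⟨f.hom.app _ a.1, by
    obtain ⟨g, hg⟩ := a.2
    refine ⟨f * g * f⁻¹, ?_⟩
    have := (hg.postcomp f.hom).precomp f.inv
    rwa [Category.id_comp, f.inv_hom_id] at this⟩
  one_smul a := rfl
  mul_smul f g a := rfl
  smul_one f := Subtype.ext (one_map f.hom)
  smul_mul f a b := (mul_eq ((isProd_mul a b).map f.hom)).symm

end Normalizer

/-- The center `Z(M)`: the elements of `N(M)` that define a self-homotopy of the identity. -/
noncomputable def Center (M : SSet.{u}) [IsPartialGroup M] : Subgroup (Normalizer M) where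
  carrier := {a | HomotopyBy a.1 (𝟙 M) (𝟙 M)}
  one_mem' := homotopyBy_one _
  mul_mem' {a b} ha hb := by
    obtain ⟨c, hc, h⟩ := ha.comp hb
    change HomotopyBy (a * b).1 _ _
    rwa [(Normalizer.isProd_mul a b).unique hc]
  inv_mem' {a} ha := by
    obtain ⟨f, hf⟩ := (a⁻¹).2
    obtain ⟨c, hc, h⟩ := hf.comp ha
    have h1 : c = one M := by
      have : (a⁻¹ * a).1 = c := (Normalizer.isProd_mul _ _).unique hc
      rw [← this, inv_mul_cancel]; rfl
    rw [h1] at h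
    have h2 := h.eq_of_one
    have h3 : f.hom = 𝟙 M := by simpa using h2
    rwa [h3] at hf

/-- `Z(M)` is abelian. -/
noncomputable instance (M : SSet.{u}) [IsPartialGroup M] : CommGroup (Center M) where
  __ := (inferInstance : Group (Center M))
  mul_comm a b := by
    obtain ⟨c, h1, h2⟩ := HomotopyBy.isProd a.2 b.1.1
    refine Subtype.ext (Subtype.ext ?_)
    exact ((Normalizer.isProd_mul _ _).unique h1).trans
      ((Normalizer.isProd_mul _ _).unique h2).symm

/-- The subgroup of inner automorphisms `c_η`, `η ∈ N(M)`. -/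
def Inn (M : SSet.{u}) [IsPartialGroup M] : Subgroup (Aut M) where
  carrier := {f | ∃ η : M _⦋1⦌, HomotopyBy η f.hom (𝟙 M)}
  one_mem' := ⟨one M, homotopyBy_one _⟩
  mul_mem' := by
    rintro f g ⟨a, ha⟩ ⟨b, hb⟩
    obtain ⟨c, -, h⟩ := ha.comp hb
    exact ⟨c, h⟩
  inv_mem' := by
    rintro f ⟨a, ha⟩
    obtain ⟨b, g, hb, hab⟩ := ha.exists_inv
    obtain ⟨c, hc, h⟩ := hb.comp ha
    have h1 : c = one M := hc.unique hab
    rw [h1] at h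
    have h2 : f.hom ≫ g.hom = 𝟙 M := by simpa using h.eq_of_one
    have h3 : f⁻¹ = g := by
      have : g * f = 1 := Iso.ext h2
      exact (eq_inv_of_mul_eq_one_left this).symm
    rw [h3]
    exact ⟨b, hb⟩

instance (M : SSet.{u}) [IsPartialGroup M] : (Inn M).Normal where
  conj_mem := by
    rintro f ⟨a, ha⟩ g
    refine ⟨g.hom.app _ a, ?_⟩
    have := (ha.postcomp g.hom).precomp g.inv
    rwa [Category.id_comp, g.inv_hom_id] at this

/-- The group of outer automorphisms `Out(M) = Aut(M) / {c_η}`. -/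
abbrev Out (M : SSet.{u}) [IsPartialGroup M] : Type u := Aut M ⧸ Inn M

/-- Automorphisms of `M` act on `Z(M)` by evaluation. -/
noncomputable def autCenter (M : SSet.{u}) [IsPartialGroup M] :
    Aut M →* Monoid.End (Center M) where
  toFun f :=
    { toFun := fun z => ⟨f • z.1, by
        have := (HomotopyBy.postcomp (show HomotopyBy z.1.1 (𝟙 M) (𝟙 M) from z.2) f.hom).precomp
          f.inv
        rwa [Category.id_comp, f.inv_hom_id] at this⟩
      map_one' := Subtype.ext (smul_one f)
      map_mul' := fun a b => Subtype.ext (smul_mul' f a.1 b.1) }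
  map_one' := rfl
  map_mul' _ _ := rfl

/-- Inner automorphisms act trivially on `Z(M)`, so that `Out(M)` acts on `Z(M)`: the class of
an automorphism `f` sends `z` to `f(z)`. -/
noncomputable def outCenter (M : SSet.{u}) [IsPartialGroup M] :
    Out M →* Monoid.End (Center M) :=
  QuotientGroup.lift (Inn M) (autCenter M) (by
    rintro f ⟨a, ha⟩
    refine MonoidHom.ext fun z => Subtype.ext ?_
    let a' : Normalizer M := ⟨a, f, ha⟩
    obtain ⟨c, h1, h2⟩ := HomotopyBy.isProd (show HomotopyBy z.1.1 (𝟙 M) (𝟙 M) from z.2) a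
    obtain ⟨d, h3, h4⟩ := ha.isProd z.1.1
    have e1 : z.1 * a' = a' * z.1 := Subtype.ext
      (((Normalizer.isProd_mul z.1 a').unique h1).trans
        ((Normalizer.isProd_mul a' z.1).unique h2).symm)
    have e2 : (f • z.1) * a' = a' * z.1 := Subtype.ext
      (((Normalizer.isProd_mul (f • z.1) a').unique h4).trans
        ((Normalizer.isProd_mul a' z.1).unique h3).symm)
    exact mul_right_cancel (e2.trans e1.symm))

/-- `Z(M)`, written additively, as a module over `Out(M)`. -/
noncomputable instance (M : SSet.{u}) [IsPartialGroup M] :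
    DistribMulAction (Out M) (Additive (Center M)) where
  smul x a := Additive.ofMul (outCenter M x a.toMul)
  one_smul a := by
    change Additive.ofMul (outCenter M 1 a.toMul) = a
    rw [_root_.map_one]; rfl
  mul_smul x y a := by
    change Additive.ofMul (outCenter M (x * y) a.toMul) = _
    rw [_root_.map_mul]; rfl
  smul_zero x := congrArg Additive.ofMul (_root_.map_one (outCenter M x))
  smul_add x a b := congrArg Additive.ofMul (_root_.map_mul (outCenter M x) a.toMul b.toMul)

/-! ## Cohomology with twisted coefficients -/

section Cohomology

variable {X : SSet.{u}} {G : Type u} [Group G] (ρ : X ⟶ bar G)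
  (A : Type u) [AddCommGroup A] [DistribMulAction G A]

/-- The coboundary
`(d c)[g₁|…|gₙ₊₁] = ρ(g₁) • c[g₂|…|gₙ₊₁] + ∑ (-1)ⁱ c(dᵢ[g₁|…|gₙ₊₁])`, `1 ≤ i ≤ n + 1`. -/
def coboundary (n : ℕ) : (X _⦋n⦌ → A) →+ (X _⦋n + 1⦌ → A) where
  toFun c σ := onEdges ρ (spine X σ 0) • c (X.δ 0 σ) +
    ∑ i : Fin (n + 1), (-1 : ℤ) ^ (i.val + 1) • c (X.δ i.succ σ)
  map_zero' := by ext; simp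
  map_add' c c' := by
    ext σ
    simp only [Pi.add_apply, smul_add, Finset.sum_add_distrib]
    abel

/-- The `n`-cocycles. -/
def cocycles (n : ℕ) : AddSubgroup (X _⦋n⦌ → A) := (coboundary ρ A n).ker

/-- The `n`-coboundaries. -/
def coboundaries (n : ℕ) : AddSubgroup (X _⦋n⦌ → A) :=
  match n with
  | 0 => ⊥
  | n + 1 => (coboundary ρ A n).range

/-- The cohomology `Hⁿ(X; A)` of `X`, with coefficients in the `G`-module `A` twisted by
`ρ : X → BG`. -/
abbrev Cohomology (n : ℕ) : Type u :=
  cocycles ρ A n ⧸ (coboundaries ρ A n).addSubgroupOf (cocycles ρ A n)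

/-- The class of a cocycle. -/
def cohomologyClass {n : ℕ} (c : cocycles ρ A n) : Cohomology ρ A n := QuotientAddGroup.mk c

end Cohomology

/-! ## Extensions -/

/-- A fibre bundle `p : E → B` with fibre `F`: a surjective map whose pullback along any
`b : Δ[n] → B` is isomorphic, over `Δ[n]`, to `F × Δ[n]`. -/
structure IsFibreBundle (F : SSet.{u}) {E B : SSet.{u}} (p : E ⟶ B) : Prop where
  surjective : ∀ n : ℕ, Function.Surjective (fun x : E _⦋n⦌ => p.app _ x)
  exists_trivialization : ∀ (n : ℕ) (b : (Δ[n] : SSet.{u}) ⟶ B),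
    ∃ φ : F ⊗ (Δ[n] : SSet.{u}) ⟶ E, IsPullback φ (snd F (Δ[n] : SSet.{u})) p b

/-- An extension `M → E → H` of `H` by `M`: a fibre bundle `E → H` with fibre `M`, together with
an isomorphism of `M` with the fibre over the vertex of `H`. -/
structure Extension (M H : SSet.{u}) [IsPartialGroup M] [IsPartialGroup H] where
  total : SSet.{u}
  incl : M ⟶ total
  proj : total ⟶ H
  isFibreBundle : IsFibreBundle M proj
  incl_injective : ∀ n : ℕ, Function.Injective (fun x : M _⦋n⦌ => incl.app _ x)
  mem_range_incl : ∀ (n : ℕ) (e : total _⦋n⦌), (∃ x : M _⦋n⦌, incl.app _ x = e) ↔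
    proj.app _ e = H.map (SimplexCategory.const ⦋n⦌ ⦋0⦌ 0).op (vertex H)

namespace Extension

variable {M H : SSet.{u}} [IsPartialGroup M] [IsPartialGroup H]

/-- Two extensions are equivalent if there is an isomorphism of the total spaces compatible with
the maps from `M` and the maps to `H`. -/
def Equivalent (E E' : Extension M H) : Prop :=
  ∃ f : E.total ≅ E'.total, E.incl ≫ f.hom = E'.incl ∧ f.hom ≫ E'.proj = E.proj

lemma equivalent_equivalence : Equivalence (Equivalent (M := M) (H := H)) where
  refl E := ⟨Iso.refl _, by simp, by simp⟩
  symm := by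
    rintro E E' ⟨f, h1, h2⟩
    exact ⟨f.symm, by simp [← h1], by simp [← h2]⟩
  trans := by
    rintro E E' E'' ⟨f, h1, h2⟩ ⟨g, h3, h4⟩
    exact ⟨f ≪≫ g, by simp [← Category.assoc, h1, h3], by simp [h2, h4]⟩

/-- Conjugation by the edge `z` of `E` realizes the automorphism `f` of `M`:
there is a homotopy `ι ∘ f ⟵[z] ι`, where `ι : M → E`. -/
def Realizes (E : Extension M H) (z : E.total _⦋1⦌) (f : Aut M) : Prop :=
  HomotopyBy z (f.hom ≫ E.incl) E.incl

/-- The outer action induced by `E` is `α`: for every `g`, some (equivalently, every) automorphism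
realized as conjugation by an edge of `E` over `g` has class `α(g)`. -/
def HasOuterAction (E : Extension M H) (α : H ⟶ bar (Out M)) : Prop :=
  ∀ g : H _⦋1⦌, ∃ (z : E.total _⦋1⦌) (f : Aut M), E.proj.app _ z = g ∧ E.Realizes z f ∧
    (QuotientGroup.mk f : Out M) = onEdges α g

/-- `(t, η)` is a twisting pair of `E`: the edges `g` of `H` have lifts `s(g)` in `E` with
`s(1) = 1`, such that conjugation by `s(g)` realizes `t(g)`, and such that
`s(g) · s(h) = η(g, h) · s(gh)` for every simplex `[g | h]` of `H`. -/
def HasTwistingPair (E : Extension M H) (t : H _⦋1⦌ → Aut M) (η : H _⦋2⦌ → Normalizer M) : Prop :=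
  ∃ s : H _⦋1⦌ → E.total _⦋1⦌,
    (∀ g, E.proj.app _ (s g) = g) ∧
    s (one H) = E.incl.app _ (one M) ∧
    (∀ g, E.Realizes (s g) (t g)) ∧
    ∀ σ : H _⦋2⦌, ∃ e : E.total _⦋1⦌,
      IsProd E.total (s (H.δ 2 σ)) (s (H.δ 0 σ)) e ∧
      IsProd E.total (E.incl.app _ (η σ).1) (s (H.δ 1 σ)) e

end Extension

section Classification

variable {M H : SSet.{u}} [IsPartialGroup M] [IsPartialGroup H]

/-- Equivalence of extensions with outer action `α`. -/
def extensionSetoid (α : H ⟶ bar (Out M)) : Setoid {E : Extension M H // E.HasOuterAction α} where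
  r E E' := E.1.Equivalent E'.1
  iseqv := Extension.equivalent_equivalence.comap Subtype.val

/-- The set of equivalence classes of extensions of `H` by `M` with outer action `α`. -/
def ExtensionClass (α : H ⟶ bar (Out M)) : Type (u + 1) := Quotient (extensionSetoid α)

/-- The class of an extension. -/
def extensionClass {α : H ⟶ bar (Out M)} (E : Extension M H) (hE : E.HasOuterAction α) :
    ExtensionClass α :=
  Quotient.mk (extensionSetoid α) ⟨E, hE⟩

/-- Choices of representatives for an outer action `α`: automorphisms `t(g)` in the class `α(g)`,
with `t(1) = 1`, and elements `η(g, h)` that determine homotopies `t(g) ∘ t(h) ⟵ t(gh)`,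
with `η(1, g) = η(g, 1) = 1`. -/
structure IsLift (α : H ⟶ bar (Out M)) (t : H _⦋1⦌ → Aut M) (η : H _⦋2⦌ → Normalizer M) :
    Prop where
  mk_eq : ∀ g, (QuotientGroup.mk (t g) : Out M) = onEdges α g
  map_one : t (one H) = 1
  homotopy : ∀ σ : H _⦋2⦌,
    HomotopyBy (η σ).1 (t (H.δ 2 σ) * t (H.δ 0 σ)).hom (t (H.δ 1 σ)).hom
  one_left : ∀ g : H _⦋1⦌, η (H.σ 0 g) = 1
  one_right : ∀ g : H _⦋1⦌, η (H.σ 1 g) = 1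

/-- `κ[g|h|k] = η(g, h) · η(gh, k) · η(g, hk)⁻¹ · t(g)(η(h, k))⁻¹`. -/
noncomputable def obstruction (t : H _⦋1⦌ → Aut M) (η : H _⦋2⦌ → Normalizer M) (σ : H _⦋3⦌) :
    Normalizer M :=
  η (H.δ 3 σ) * η (H.δ 1 σ) * (η (H.δ 2 σ))⁻¹ * (t (spine H σ 0) • η (H.δ 0 σ))⁻¹

end Classification

end PartialGroups

/-!
The theorem is the analogue for partial groups of the Eilenberg–MacLane classification of group
extensions with nonabelian kernel. Products in `M` are only partially defined, but the elements of
`N(M)` can be multiplied with everything: `N(M)` acts on the edges of `M` from both sides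
(`isProd_smul`, `isProd_op_smul`), conjugation is a homomorphism `conj : N(M) → Aut(M)` with kernel
`Z(M)` (`mem_center_iff`) and image the inner automorphisms, and a homotopy `f ⟵[a] g` between
automorphisms means `f = c_a ∘ g` (`homotopyBy_iff_conj`). More generally, elements `νᵢ ∈ N(M)` at
the vertices of a simplex with edges `xᵢⱼ` give a simplex with edges `νᵢ xᵢⱼ νⱼ⁻¹`
(`exists_gauge`).

*Extensions and twisting pairs.* In a trivialization of an extension over a simplex `σ` of `H`, the
fibres over the vertices are copies of `M` by automorphisms `aᵢ`, and edges which realize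
automorphisms of `M` are given by elements of `N(M)` (`Extension.IsChart.exists_normalizer`). Hence
a system of lifts `s(g)` becomes a family `μ` in `N(M)`, and the conditions on a twisting pair
become the equations of a frame `(a, μ)` of `σ` (`IsFrame`). An edge of the total space is uniquely
`ι(m) · s(g)`, so a simplex is determined by `σ` and by the coordinates `m` of its edges. Which
coordinates occur depends on `(t, η)` only, because any two frames of `σ` differ by elements of
`N(M)` at the vertices (`IsFrame.exists_frameCoord_eq`). Therefore an extension with twisting pair
`(t, η)` is isomorphic to a simplicial set `model t η` built from `(t, η)`, and two extensions with
a common twisting pair are equivalent (`Extension.HasTwistingPair.equivalent`). Conversely, if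
`(t, η)` is a lift of `α` with `κ = 1`, transport to the last vertex defines a frame of every
simplex (`IsLift.isFrame`), and the model is an extension with twisting pair `(t, η)`
(`IsLift.hasTwistingPair_modelExtension`). The twisting pairs of extensions with outer action `α`
are thus exactly the lifts of `α` with `κ = 1`.

*The obstruction.* `κ` takes values in `Z(M)` since `conj κ = 1`, and it is a cocycle by the
computation of `η₀₁₂ η₀₂₃ η₀₃₄` in two ways (`coboundary_obstruction`). Replacing `s(g)` by
`ν(g) s(g)` replaces `(t, η)` by `(c_ν t, changeLift t η ν)` and preserves `κ`
(`obstruction_changeLift`); two lifts with the same `t` differ by a central cochain `z`, which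
changes `κ` by `dz` (`obstruction_cval_mul`). So the class of `κ` depends on `α` only, and it
vanishes if and only if some lift has `κ = 1`, that is, if and only if there is an extension; that
`z` may be taken normalized is `exists_normalized`.

*The action.* The class of a normalized `2`-cocycle `v` takes an extension with twisting pair
`(t, η)` to one with twisting pair `(t, v η)`. Since any two twisting pairs of an extension differ
by a change of lifts (`Extension.HasTwistingPair.exists_changeLift`), and a central change `u`
multiplies `η` by `du` (`changeLift_cval_mul`), this does not depend on choices
(`exists_translate`), and it is free (`Extension.HasTwistingPair.cohomologyClass_eq_zero`). It is
transitive because two lifts with the same `t` and `κ = 1` differ by a cocycle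
(`exists_cocycle_of_hasOuterAction`).
-/

open scoped RightActions

namespace PartialGroups

/-! ### The bi-action of the normalizer on edges -/

/-- Left multiplication by an element that determines a homotopy is associative. -/
lemma HomotopyBy.isProd_assoc_left {H X : SSet.{u}} [IsReducedSSet H] {η : X _⦋1⦌} {f g : H ⟶ X}
    (h : HomotopyBy η f g) {b c bc : H _⦋1⦌} (hbc : IsProd H b c bc) :
    ∃ d e, IsProd X η (g.app _ b) d ∧ IsProd X d (g.app _ c) e ∧ IsProd X η (g.app _ bc) e := by
  obtain ⟨τ, rfl, rfl, rfl⟩ := hbc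
  obtain ⟨w, rfl, hw⟩ := h.exists_cons τ
  have e12 : edge X w 1 2 (by decide) = g.app _ (H.δ 2 τ) := by
    rw [SSet.δ_naturality_apply, ← hw]
    refine (Eq.trans (map_map X (SimplexCategory.δ 2) (SimplexCategory.δ 0) w)
      (map_congr X ?_ w)).symm
    ext i; fin_cases i <;> rfl
  have e23 : edge X w 2 3 (by decide) = g.app _ (H.δ 0 τ) := by
    rw [SSet.δ_naturality_apply, ← hw]
    refine (Eq.trans (map_map X (SimplexCategory.δ 0) (SimplexCategory.δ 0) w)
      (map_congr X ?_ w)).symm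
    ext i; fin_cases i <;> rfl
  have e13 : edge X w 1 3 (by decide) = g.app _ (H.δ 1 τ) := by
    rw [SSet.δ_naturality_apply, ← hw]
    refine (Eq.trans (map_map X (SimplexCategory.δ 1) (SimplexCategory.δ 0) w)
      (map_congr X ?_ w)).symm
    ext i; fin_cases i <;> rfl
  have p1 := isProd_edge X w 0 1 2 (by decide) (by decide)
  have p2 := isProd_edge X w 0 2 3 (by decide) (by decide)
  have p3 := isProd_edge X w 0 1 3 (by decide) (by decide)
  rw [e12] at p1
  rw [e23] at p2
  rw [e13] at p3
  exact ⟨_, _, p1, p2, p3⟩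

/-- Right multiplication by an element that determines a homotopy is associative. -/
lemma HomotopyBy.isProd_assoc_right {H X : SSet.{u}} [IsReducedSSet H] {η : X _⦋1⦌}
    {f g : H ⟶ X} (h : HomotopyBy η f g) {b c bc : H _⦋1⦌} (hbc : IsProd H b c bc) :
    ∃ d e, IsProd X (f.app _ c) η d ∧ IsProd X (f.app _ b) d e ∧ IsProd X (f.app _ bc) η e := by
  obtain ⟨τ, rfl, rfl, rfl⟩ := hbc
  obtain ⟨w, hη, hw⟩ : ∃ w : X _⦋3⦌, edge X w 2 3 (by decide) = η ∧ X.δ 3 w = f.app _ τ := by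
    obtain ⟨F, rfl, rfl, rfl⟩ := h
    refine ⟨ev F (H.map (SimplexCategory.σ 2).op τ)
      (SimplexCategory.σ 0 ≫ SimplexCategory.σ 0), ?_, ?_⟩
    · refine (map_ev_map F τ _ _ _ rfl (t := 𝟙 _) ?_).trans ?_
      · ext i; fin_cases i <;> rfl
      · rw [map_to_one _ rfl]; rfl
    · refine (map_ev_map F τ _ _ (SimplexCategory.δ 3) (b := 𝟙 _)
        (t := SimplexCategory.const _ _ 0) ?_ ?_).trans ?_
      · ext i; fin_cases i <;> rfl
      · ext i; fin_cases i <;> rfl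
      · rw [map_id_op, ev_zero]
  have e01 : edge X w 0 1 (by decide) = f.app _ (H.δ 2 τ) := by
    rw [SSet.δ_naturality_apply, ← hw]
    refine (Eq.trans (map_map X (SimplexCategory.δ 2) (SimplexCategory.δ 3) w)
      (map_congr X ?_ w)).symm
    ext i; fin_cases i <;> rfl
  have e12 : edge X w 1 2 (by decide) = f.app _ (H.δ 0 τ) := by
    rw [SSet.δ_naturality_apply, ← hw]
    refine (Eq.trans (map_map X (SimplexCategory.δ 0) (SimplexCategory.δ 3) w)
      (map_congr X ?_ w)).symm
    ext i; fin_cases i <;> rfl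
  have e02 : edge X w 0 2 (by decide) = f.app _ (H.δ 1 τ) := by
    rw [SSet.δ_naturality_apply, ← hw]
    refine (Eq.trans (map_map X (SimplexCategory.δ 1) (SimplexCategory.δ 3) w)
      (map_congr X ?_ w)).symm
    ext i; fin_cases i <;> rfl
  have p1 := isProd_edge X w 1 2 3 (by decide) (by decide)
  have p2 := isProd_edge X w 0 1 3 (by decide) (by decide)
  have p3 := isProd_edge X w 0 2 3 (by decide) (by decide)
  rw [e12, hη] at p1
  rw [e01] at p2
  rw [e02, hη] at p3
  exact ⟨_, _, p1, p2, p3⟩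

section Actions

variable {M : SSet.{u}} [IsPartialGroup M]

/-- Automorphisms act on simplices by evaluation. -/
instance (n : SimplexCategoryᵒᵖ) : MulAction (Aut M) (M.obj n) where
  smul f x := f.hom.app _ x
  one_smul _ := rfl
  mul_smul _ _ _ := rfl

omit [IsPartialGroup M] in
lemma map_aut_smul {m n : SimplexCategory} (θ : m ⟶ n) (f : Aut M) (x : M.obj (op n)) :
    M.map θ.op (f • x) = f • M.map θ.op x :=
  (NatTrans.naturality_apply f.hom θ.op x).symm

lemma Normalizer.exists_left (a : Normalizer M) (x : M _⦋1⦌) : ∃ c, IsProd M a.1 x c := by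
  obtain ⟨f, hf⟩ := a.2
  obtain ⟨c, h, -⟩ := hf.isProd x
  exact ⟨c, h⟩

lemma Normalizer.exists_right (a : Normalizer M) (x : M _⦋1⦌) : ∃ c, IsProd M x a.1 c := by
  obtain ⟨f, hf⟩ := a.2
  obtain ⟨c, -, h⟩ := hf.isProd (f⁻¹ • x)
  refine ⟨c, ?_⟩
  rwa [show f.hom.app _ (f⁻¹ • x) = x from smul_inv_smul f x] at h

lemma Normalizer.isProd_assoc (a : Normalizer M) {x y xy ax axy : M _⦋1⦌}
    (h : IsProd M x y xy) (h1 : IsProd M a.1 x ax) (h2 : IsProd M a.1 xy axy) :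
    IsProd M ax y axy := by
  obtain ⟨f, hf⟩ := a.2
  obtain ⟨d, e, p1, p2, p3⟩ := hf.isProd_assoc_left h
  rw [h1.unique p1, h2.unique p3]
  exact p2

lemma Normalizer.isProd_assoc' (a : Normalizer M) {x y xy ya xya : M _⦋1⦌}
    (h : IsProd M x y xy) (h1 : IsProd M y a.1 ya) (h2 : IsProd M xy a.1 xya) :
    IsProd M x ya xya := by
  obtain ⟨f, hf⟩ := a.2
  obtain ⟨d, e, p1, p2, p3⟩ := hf.isProd_assoc_right (h.map (f⁻¹).hom)
  have key (z : M _⦋1⦌) : f.hom.app _ ((f⁻¹).hom.app _ z) = z := smul_inv_smul f z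
  rw [key] at p1 p2 p3
  rw [h1.unique p1, h2.unique p3]
  exact p2

/-- `N(M)` acts on the edges of `M` by left multiplication. -/
noncomputable instance : MulAction (Normalizer M) (M _⦋1⦌) where
  smul a x := (a.exists_left x).choose
  one_smul x := ((1 : Normalizer M).exists_left x).choose_spec.unique (isProd_one_left x)
  mul_smul a b x := ((a * b).exists_left x).choose_spec.unique
    (a.isProd_assoc (b.exists_left x).choose_spec (Normalizer.isProd_mul a b)
      (a.exists_left _).choose_spec)

/-- `N(M)` acts on the edges of `M` by right multiplication. -/
noncomputable instance : MulAction (Normalizer M)ᵐᵒᵖ (M _⦋1⦌) where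
  smul a x := (a.unop.exists_right x).choose
  one_smul x := ((1 : Normalizer M).exists_right x).choose_spec.unique (isProd_one_right x)
  mul_smul a b x := ((b.unop * a.unop).exists_right x).choose_spec.unique
    (a.unop.isProd_assoc' (b.unop.exists_right x).choose_spec (Normalizer.isProd_mul _ _)
      (a.unop.exists_right _).choose_spec)

lemma isProd_smul (a : Normalizer M) (x : M _⦋1⦌) : IsProd M a.1 x (a • x) :=
  (a.exists_left x).choose_spec

lemma isProd_op_smul (a : Normalizer M) (x : M _⦋1⦌) : IsProd M x a.1 (x <• a) :=
  (a.exists_right x).choose_spec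

instance : SMulCommClass (Normalizer M) (Normalizer M)ᵐᵒᵖ (M _⦋1⦌) where
  smul_comm a b x := by
    induction b using MulOpposite.rec' with | _ b
    exact (b.isProd_assoc' (isProd_smul a x) (isProd_op_smul b x) (isProd_op_smul b _)).unique
      (isProd_smul a _) |>.symm

lemma aut_smul_smul (f : Aut M) (a : Normalizer M) (x : M _⦋1⦌) :
    f • (a • x) = (f • a) • (f • x) :=
  ((isProd_smul a x).map f.hom).unique (isProd_smul (f • a) (f • x))

lemma aut_smul_op_smul (f : Aut M) (a : Normalizer M) (x : M _⦋1⦌) :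
    f • (x <• a) = (f • x) <• (f • a) :=
  ((isProd_op_smul a x).map f.hom).unique (isProd_op_smul (f • a) (f • x))

lemma smul_val (a b : Normalizer M) : a • b.1 = (a * b).1 :=
  (isProd_smul a b.1).unique (Normalizer.isProd_mul a b)

lemma op_smul_val (a b : Normalizer M) : a.1 <• b = (a * b).1 :=
  (isProd_op_smul b a.1).unique (Normalizer.isProd_mul a b)

lemma aut_smul_val (f : Aut M) (a : Normalizer M) : f • a.1 = (f • a).1 := rfl

lemma aut_smul_one_edge (f : Aut M) : f • one M = one M := one_map f.hom

/-! ### Conjugation -/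

lemma aut_ext {f g : Aut M} (h : ∀ x : M _⦋1⦌, f • x = g • x) : f = g :=
  Iso.ext (hom_ext h)

lemma HomotopyBy.eq_conj {a : Normalizer M} {f : Aut M} (h : HomotopyBy a.1 f.hom (𝟙 M))
    (x : M _⦋1⦌) : f • x = a • x <• a⁻¹ := by
  obtain ⟨c, h1, h2⟩ := h.isProd x
  have e : (f • x) <• a = a • x :=
    ((isProd_op_smul a (f • x)).unique h2).trans (h1.unique (isProd_smul a x))
  rw [smul_comm, ← e, smul_smul, ← MulOpposite.op_mul, mul_inv_cancel, MulOpposite.op_one, one_smul]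

/-- Conjugation `c_a`, the automorphism of `M` with `c_a ⟵[a] 1`, as a homomorphism in
`a ∈ N(M)`. -/
noncomputable def conj : Normalizer M →* Aut M where
  toFun a := a.2.choose
  map_one' := aut_ext fun x => by
    rw [(1 : Normalizer M).2.choose_spec.eq_conj x]; simp
  map_mul' a b := aut_ext fun x => by
    refine ((a * b).2.choose_spec.eq_conj x).trans ?_
    refine Eq.trans ?_ (a.2.choose_spec.eq_conj _).symm
    refine Eq.trans ?_ (congrArg (fun y => a • y <• a⁻¹) (b.2.choose_spec.eq_conj x).symm)
    simp only [mul_inv_rev, MulOpposite.op_mul, mul_smul, smul_comm]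

lemma homotopyBy_conj (a : Normalizer M) : HomotopyBy a.1 (conj a).hom (𝟙 M) := a.2.choose_spec

lemma conj_smul (a : Normalizer M) (x : M _⦋1⦌) : conj a • x = a • x <• a⁻¹ :=
  (homotopyBy_conj a).eq_conj x

lemma conj_eq_of_homotopyBy {a : Normalizer M} {f : Aut M} (h : HomotopyBy a.1 f.hom (𝟙 M)) :
    conj a = f :=
  aut_ext fun x => by rw [conj_smul, h.eq_conj]

/-- `f ⟵[a] g` between automorphisms means `f = c_a ∘ g`. -/
lemma homotopyBy_iff_conj {a : Normalizer M} {f g : Aut M} :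
    HomotopyBy a.1 f.hom g.hom ↔ conj a * g = f := by
  constructor
  · intro h
    rw [conj_eq_of_homotopyBy (f := f * g⁻¹), inv_mul_cancel_right]
    have := h.precomp (g⁻¹).hom
    rwa [show (g⁻¹).hom ≫ g.hom = 𝟙 M from g.inv_hom_id] at this
  · rintro rfl
    exact (homotopyBy_conj a).precomp g.hom

lemma conj_aut_smul (f : Aut M) (a : Normalizer M) : conj (f • a) = f * conj a * f⁻¹ :=
  aut_ext fun x => by
    rw [mul_smul, mul_smul, conj_smul, conj_smul, aut_smul_smul, aut_smul_op_smul,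
      smul_inv_smul, smul_inv']

lemma conj_smul_normalizer (a b : Normalizer M) : conj a • b = a * b * a⁻¹ := by
  refine Subtype.ext ?_
  rw [← aut_smul_val, conj_smul, op_smul_val, smul_val, mul_assoc]

lemma mem_center_iff {a : Normalizer M} : a ∈ Center M ↔ conj a = 1 := by
  rw [← mul_one (conj a), ← homotopyBy_iff_conj]; rfl

lemma center_comm (z : Center M) (a : Normalizer M) : z.1 * a = a * z.1 := by
  have := conj_smul_normalizer z.1 a
  rw [mem_center_iff.1 z.2, one_smul] at this
  rw [eq_mul_inv_iff_mul_eq] at this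
  exact this.symm

lemma mem_inn_iff {f : Aut M} : f ∈ Inn M ↔ ∃ a : Normalizer M, conj a = f := by
  constructor
  · rintro ⟨a, ha⟩
    exact ⟨⟨a, f, ha⟩, conj_eq_of_homotopyBy ha⟩
  · rintro ⟨a, rfl⟩
    exact ⟨a.1, homotopyBy_conj a⟩

end Actions

/-! ### Multiplying the vertices of a simplex by elements of the normalizer -/

section Gauge

variable {M : SSet.{u}} [IsPartialGroup M]

/-- The cut of `[n]` after the first `k` vertices. -/
def cut (n k : ℕ) : ⦋n⦌ ⟶ ⦋1⦌ :=
  SimplexCategory.mkHom ⟨fun i => if i.val < k then 0 else 1, fun i j h => by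
    have : i.val ≤ j.val := h
    dsimp only
    split_ifs
    · rfl
    · exact Fin.zero_le _
    · omega
    · rfl⟩

/-- Multiplying the first `k` vertices of a simplex by `a ∈ N(M)`: the value at the cut of the
homotopy defined by `a`. -/
lemma exists_gauge_cut {n : ℕ} (k : ℕ) (a : Normalizer M) (x : M _⦋n⦌) :
    ∃ y : M _⦋n⦌, ∀ f : ⦋1⦌ ⟶ ⦋n⦌, M.map f.op y =
      (if (f.toOrderHom 0).val < k then a else 1) • (M.map f.op x) <•
        (if (f.toOrderHom 1).val < k then a else 1)⁻¹ := by
  obtain ⟨F, h0, h1, hF⟩ := homotopyBy_conj a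
  refine ⟨ev F x (cut n k), fun f => ?_⟩
  rw [map_ev]
  have hle : (f.toOrderHom 0).val ≤ (f.toOrderHom 1).val := f.toOrderHom.monotone (by decide)
  by_cases hk0 : (f.toOrderHom 0).val < k
  · by_cases hk1 : (f.toOrderHom 1).val < k
    · have e : f ≫ cut n k = SimplexCategory.const _ _ 0 := by
        ext i
        fin_cases i
        · exact congrArg _ (if_pos hk0)
        · exact congrArg _ (if_pos hk1)
      rw [if_pos hk0, if_pos hk1, e, ev_zero, h0]
      exact conj_smul a _
    · have e : f ≫ cut n k = 𝟙 _ := by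
        ext i
        fin_cases i
        · exact congrArg _ (if_pos hk0)
        · exact congrArg _ (if_neg hk1)
      rw [if_pos hk0, if_neg hk1, e]
      have := (isProd_ev F (M.map f.op x)).1
      rw [hF, h1] at this
      rw [inv_one, MulOpposite.op_one, one_smul]
      exact this.unique (isProd_smul a _)
  · have hk1 : ¬ (f.toOrderHom 1).val < k := by omega
    have e : f ≫ cut n k = SimplexCategory.const _ _ 1 := by
      ext i
      fin_cases i
      · exact congrArg _ (if_neg hk0)
      · exact congrArg _ (if_neg hk1)
    rw [if_neg hk0, if_neg hk1, e, ev_one, h1, inv_one, MulOpposite.op_one, one_smul, one_smul]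
    rfl

/-- Given elements `νᵢ ∈ N(M)` at the vertices of a simplex of `M` with edges `xᵢⱼ`, there is a
simplex of `M` with edges `νᵢ xᵢⱼ νⱼ⁻¹`. -/
lemma exists_gauge {n : ℕ} (ν : Fin (n + 1) → Normalizer M) (x : M _⦋n⦌) :
    ∃ y : M _⦋n⦌, ∀ f : ⦋1⦌ ⟶ ⦋n⦌, M.map f.op y =
      ν (f.toOrderHom 0) • (M.map f.op x) <• (ν (f.toOrderHom 1))⁻¹ := by
  suffices h : ∀ (k : ℕ) (ν : Fin (n + 1) → Normalizer M), (∀ i, k ≤ i.val → ν i = 1) →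
      ∃ y : M _⦋n⦌, ∀ f : ⦋1⦌ ⟶ ⦋n⦌, M.map f.op y =
        ν (f.toOrderHom 0) • (M.map f.op x) <• (ν (f.toOrderHom 1))⁻¹ from
    h (n + 1) ν fun i hi => by omega
  intro k
  induction k with
  | zero =>
    intro ν hν
    exact ⟨x, fun f => by simp [hν]⟩
  | succ k ih =>
    intro ν hν
    by_cases hk : k < n + 1
    · -- The last non-trivial multiplier `a = ν_k` is applied to the first `k + 1` vertices.
      let a := ν ⟨k, hk⟩
      let s : Fin (n + 1) → Normalizer M := fun i => if i.val < k + 1 then a else 1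
      obtain ⟨y, hy⟩ := ih (fun i => (s i)⁻¹ * ν i) fun i hi => by
        rcases hi.eq_or_lt with h | h
        · have : i = ⟨k, hk⟩ := Fin.ext h.symm
          subst this
          simp [s, a]
        · simp [s, hν i h, h.not_ge]
      obtain ⟨z, hz⟩ := exists_gauge_cut (k + 1) a y
      refine ⟨z, fun f => ?_⟩
      rw [hz, hy]
      change s (f.toOrderHom 0) • _ <• (s (f.toOrderHom 1))⁻¹ = _
      simp only [smul_comm (_ : Normalizer M) (_ : (Normalizer M)ᵐᵒᵖ), smul_smul,
        ← MulOpposite.op_mul]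
      simp
    · exact ih ν fun i hi => absurd i.isLt (by omega)

end Gauge

/-! ### Frames -/

section Frames

variable {M H : SSet.{u}} [IsPartialGroup M]

/-- The edge of `Δ[n]` from the vertex `i` to the last vertex. -/
def lastEdge {n : ℕ} (i : Fin (n + 1)) : ⦋1⦌ ⟶ ⦋n⦌ :=
  SimplexCategory.mkOfLe i (Fin.last n) (Fin.le_last i)

/-- A simplex of `Δ[n]`, with the last vertex of `Δ[n]` appended. -/
def snocLast {k n : ℕ} (f : ⦋k⦌ ⟶ ⦋n⦌) : ⦋k + 1⦌ ⟶ ⦋n⦌ :=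
  SimplexCategory.mkHom ⟨fun i => if h : i.val < k + 1 then f.toOrderHom ⟨i.val, h⟩ else Fin.last n,
    fun i j h => by
      have : i.val ≤ j.val := h
      dsimp only
      split_ifs
      · exact f.toOrderHom.monotone h
      · exact Fin.le_last _
      · omega
      · rfl⟩

/-- A frame of a simplex `σ` of `H`, relative to `t : H₁ → Aut(M)` and `η : H₂ → N(M)`. In an
extension with twisting pair `(t, η)`, a trivialization of the bundle over `σ` identifies the fibre
over the `i`-th vertex with `M` through an automorphism `aᵢ`, and the chosen lift of the edge
`f` of `σ` with an element `μ f` of `N(M)`; the equations of a frame express that `(t, η)` is a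
twisting pair. -/
structure IsFrame (t : H _⦋1⦌ → Aut M) (η : H _⦋2⦌ → Normalizer M) {n : SimplexCategory}
    (σ : H.obj (op n)) (a : Fin (n.len + 1) → Aut M) (μ : (⦋1⦌ ⟶ n) → Normalizer M) : Prop where
  conj_eq : ∀ f : ⦋1⦌ ⟶ n, conj (μ f) =
    (a (f.toOrderHom 0))⁻¹ * t (H.map f.op σ) * a (f.toOrderHom 1)
  mul_eq : ∀ T : ⦋2⦌ ⟶ n, μ (SimplexCategory.δ 2 ≫ T) * μ (SimplexCategory.δ 0 ≫ T) =
    (a (T.toOrderHom 0))⁻¹ • η (H.map T.op σ) * μ (SimplexCategory.δ 1 ≫ T)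

/-- The coordinates, relative to a frame, of the simplex of the extension that corresponds to the
simplex `x` of `M`: its edge `f` is `ι(m)` times the chosen lift, where `m` is the coordinate. -/
noncomputable def frameCoord {n : SimplexCategory} (a : Fin (n.len + 1) → Aut M)
    (μ : (⦋1⦌ ⟶ n) → Normalizer M) (x : M.obj (op n)) (f : ⦋1⦌ ⟶ n) : M _⦋1⦌ :=
  a (f.toOrderHom 0) • (M.map f.op x <• (μ f)⁻¹)

variable {t : H _⦋1⦌ → Aut M} {η : H _⦋2⦌ → Normalizer M}

lemma IsFrame.comp {m n : SimplexCategory} {σ : H.obj (op n)} {a : Fin (n.len + 1) → Aut M}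
    {μ : (⦋1⦌ ⟶ n) → Normalizer M} (h : IsFrame t η σ a μ) (θ : m ⟶ n) :
    IsFrame t η (H.map θ.op σ) (fun i => a (θ.toOrderHom i)) (fun f => μ (f ≫ θ)) where
  conj_eq f := by
    rw [h.conj_eq, map_map]; rfl
  mul_eq T := by
    rw [map_map]
    exact h.mul_eq (T ≫ θ)

lemma frameCoord_comp {m n : SimplexCategory} (a : Fin (n.len + 1) → Aut M)
    (μ : (⦋1⦌ ⟶ n) → Normalizer M) (x : M.obj (op n)) (θ : m ⟶ n) (f : ⦋1⦌ ⟶ m) :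
    frameCoord (fun i => a (θ.toOrderHom i)) (fun f => μ (f ≫ θ)) (M.map θ.op x) f =
      frameCoord a μ x (f ≫ θ) := by
  unfold frameCoord
  rw [map_map]; rfl

lemma frameCoord_injective {n : ℕ} {a : Fin (n + 1) → Aut M} {μ : (⦋1⦌ ⟶ ⦋n⦌) → Normalizer M}
    {x y : M _⦋n⦌} (h : ∀ f, frameCoord (n := ⦋n⦌) a μ x f = frameCoord (n := ⦋n⦌) a μ y f) :
    x = y := by
  rcases n with _ | n
  · exact vertex_eq M _ _
  · refine IsPartialMonoid.spine_injective (n + 1) (by omega) (funext fun i => ?_)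
    exact MulAction.injective _ (MulAction.injective _ (h (SimplexCategory.mkOfSucc i)))

/-- Transport to the last vertex `n`: the coordinates of `x` are those, relative to the standard
frame `aᵢ = t(σᵢₙ)`, of a simplex `y` that does not involve the frame `(a, μ)`. The hypothesis
says that `x` is `aₙ⁻¹ y` with its vertices multiplied by the elements `μᵢₙ`. -/
lemma IsFrame.frameCoord_eq {n : ℕ} {σ : H _⦋n⦌} {a : Fin (n + 1) → Aut M}
    {μ : (⦋1⦌ ⟶ ⦋n⦌) → Normalizer M} (h : IsFrame (n := ⦋n⦌) t η σ a μ) {x y : M _⦋n⦌}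
    (hxy : ∀ f : ⦋1⦌ ⟶ ⦋n⦌, M.map f.op x = μ (lastEdge (f.toOrderHom 0)) •
      (((a (Fin.last n))⁻¹ • M.map f.op y) <• (μ (lastEdge (f.toOrderHom 1)))⁻¹))
    (f : ⦋1⦌ ⟶ ⦋n⦌) : frameCoord (n := ⦋n⦌) a μ x f =
      (t (H.map (lastEdge (f.toOrderHom 0)).op σ) • M.map f.op y) <•
        (η (H.map (snocLast f).op σ))⁻¹ := by
  obtain ⟨e, he⟩ : ∃ e, e = η (H.map (snocLast f).op σ) := ⟨_, rfl⟩
  have h1 := h.mul_eq (snocLast f)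
  have e0 : SimplexCategory.δ 0 ≫ snocLast f = lastEdge (f.toOrderHom 1) := by
    ext i; fin_cases i <;> rfl
  have e1 : SimplexCategory.δ 1 ≫ snocLast f = lastEdge (f.toOrderHom 0) := by
    ext i; fin_cases i <;> rfl
  have e2 : SimplexCategory.δ 2 ≫ snocLast f = f := by
    ext i; fin_cases i <;> rfl
  have e3 : (snocLast f).toOrderHom 0 = f.toOrderHom 0 := rfl
  rw [e0, e1, e2, e3, ← he] at h1
  have h2 := h.conj_eq (lastEdge (f.toOrderHom 0))
  have e4 : (lastEdge (f.toOrderHom 0)).toOrderHom 0 = f.toOrderHom 0 := rfl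
  have e5 : (lastEdge (f.toOrderHom 0)).toOrderHom 1 = Fin.last n := rfl
  rw [e4, e5] at h2
  have h3 : (μ (lastEdge (f.toOrderHom 1)))⁻¹ * (μ f)⁻¹ =
      (μ (lastEdge (f.toOrderHom 0)))⁻¹ * (a (f.toOrderHom 0))⁻¹ • e⁻¹ := by
    rw [← mul_inv_rev, h1, mul_inv_rev, smul_inv']
  have h4 (u : M _⦋1⦌) : (μ (lastEdge (f.toOrderHom 0)) •
      (u <• (μ (lastEdge (f.toOrderHom 1)))⁻¹)) <• (μ f)⁻¹ =
      (conj (μ (lastEdge (f.toOrderHom 0))) • u) <• ((a (f.toOrderHom 0))⁻¹ • e⁻¹) := by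
    rw [← smul_comm (μ _), ← mul_smul (MulOpposite.op _), ← MulOpposite.op_mul, h3,
      MulOpposite.op_mul, mul_smul (MulOpposite.op _), smul_comm (μ _), conj_smul]
  rw [frameCoord, hxy, h4, ← he, h2, aut_smul_op_smul, smul_inv_smul, smul_smul, smul_smul]
  congr 2
  group

/-- Two frames of the same simplex have the same coordinates. -/
lemma IsFrame.exists_frameCoord_eq {n : ℕ} {σ : H _⦋n⦌} {a a' : Fin (n + 1) → Aut M}
    {μ μ' : (⦋1⦌ ⟶ ⦋n⦌) → Normalizer M} (h : IsFrame (n := ⦋n⦌) t η σ a μ)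
    (h' : IsFrame (n := ⦋n⦌) t η σ a' μ') (x : M _⦋n⦌) :
    ∃ x' : M _⦋n⦌, ∀ f, frameCoord (n := ⦋n⦌) a' μ' x' f = frameCoord (n := ⦋n⦌) a μ x f := by
  obtain ⟨z, hz⟩ := exists_gauge (fun i => (μ (lastEdge i))⁻¹) x
  obtain ⟨x', hx'⟩ := exists_gauge (fun i => μ' (lastEdge i))
    ((a' (Fin.last n))⁻¹ • a (Fin.last n) • z)
  refine ⟨x', fun f => ?_⟩
  rw [h.frameCoord_eq (y := a (Fin.last n) • z), h'.frameCoord_eq (y := a (Fin.last n) • z)]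
  · intro f
    rw [hx', map_aut_smul]
  · intro f
    rw [map_aut_smul, inv_smul_smul, hz, smul_comm (μ (lastEdge (f.toOrderHom 0)))⁻¹,
      smul_smul (MulOpposite.op _), ← MulOpposite.op_mul, inv_inv, mul_inv_cancel,
      MulOpposite.op_one, one_smul, smul_inv_smul]

lemma δ_map_apply (X : SSet.{u}) {n : SimplexCategory} {k : ℕ} (i : Fin (k + 2))
    (f : ⦋k + 1⦌ ⟶ n) (x : X.obj (op n)) :
    X.δ i (X.map f.op x) = X.map (SimplexCategory.δ i ≫ f).op x :=
  map_map X _ _ x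

lemma spine_map_apply (X : SSet.{u}) {n : SimplexCategory} {k : ℕ} (i : Fin k)
    (f : ⦋k⦌ ⟶ n) (x : X.obj (op n)) :
    spine X (X.map f.op x) i = X.map (SimplexCategory.mkOfSucc i ≫ f).op x :=
  map_map X _ _ x

section Lift

variable [IsPartialGroup H] {α : H ⟶ bar (Out M)}

lemma IsLift.conj_mul (h : IsLift α t η) (σ : H _⦋2⦌) :
    conj (η σ) * t (H.δ 1 σ) = t (H.δ 2 σ) * t (H.δ 0 σ) :=
  homotopyBy_iff_conj.1 (h.homotopy σ)

omit [IsPartialGroup H] in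
lemma obstruction_mul (σ : H _⦋3⦌) :
    obstruction t η σ * (t (spine H σ 0) • η (H.δ 0 σ) * η (H.δ 2 σ)) =
      η (H.δ 3 σ) * η (H.δ 1 σ) := by
  rw [obstruction]
  group

/-- The standard frame of a simplex: the fibres are identified with `M` by transport to the last
vertex along the chosen lifts. -/
lemma IsLift.isFrame (h : IsLift α t η)
    (hκ : ∀ σ : H _⦋3⦌, obstruction t η σ = 1) {n : ℕ} (σ : H _⦋n⦌) :
    IsFrame (n := ⦋n⦌) t η σ (fun i => t (H.map (lastEdge i).op σ))
      (fun f => (t (H.map (lastEdge (f.toOrderHom 0)).op σ))⁻¹ •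
        η (H.map (snocLast f).op σ)) := by
  have hconj (f : ⦋1⦌ ⟶ ⦋n⦌) : conj (η (H.map (snocLast f).op σ)) =
      t (H.map f.op σ) * t (H.map (lastEdge (f.toOrderHom 1)).op σ) *
        (t (H.map (lastEdge (f.toOrderHom 0)).op σ))⁻¹ := by
    rw [eq_mul_inv_iff_mul_eq]
    have h1 := h.conj_mul (H.map (snocLast f).op σ)
    have e0 : SimplexCategory.δ 0 ≫ snocLast f = lastEdge (f.toOrderHom 1) := by
      ext i; fin_cases i <;> rfl
    have e1 : SimplexCategory.δ 1 ≫ snocLast f = lastEdge (f.toOrderHom 0) := by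
      ext i; fin_cases i <;> rfl
    have e2 : SimplexCategory.δ 2 ≫ snocLast f = f := by
      ext i; fin_cases i <;> rfl
    rwa [δ_map_apply, δ_map_apply, δ_map_apply, e0, e1, e2] at h1
  refine ⟨fun f => ?_, fun T => ?_⟩
  · rw [conj_aut_smul, hconj]
    group
  · have h1 := obstruction_mul (t := t) (η := η) (H.map (snocLast T).op σ)
    have e0 : SimplexCategory.δ 0 ≫ snocLast T = snocLast (SimplexCategory.δ 0 ≫ T) := by
      ext i; fin_cases i <;> rfl
    have e1 : SimplexCategory.δ 1 ≫ snocLast T = snocLast (SimplexCategory.δ 1 ≫ T) := by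
      ext i; fin_cases i <;> rfl
    have e2 : SimplexCategory.δ 2 ≫ snocLast T = snocLast (SimplexCategory.δ 2 ≫ T) := by
      ext i; fin_cases i <;> rfl
    have e3 : SimplexCategory.δ 3 ≫ snocLast T = T := by
      ext i; fin_cases i <;> rfl
    have e4 : SimplexCategory.mkOfSucc 0 ≫ snocLast T = SimplexCategory.δ 2 ≫ T := by
      ext i; fin_cases i <;> rfl
    rw [hκ, one_mul, spine_map_apply, δ_map_apply, δ_map_apply, δ_map_apply, δ_map_apply,
      e0, e1, e2, e3, e4] at h1
    have h2 := hconj (SimplexCategory.δ 2 ≫ T)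
    have v1 : (SimplexCategory.δ 2 ≫ T).toOrderHom 0 = T.toOrderHom 0 := rfl
    have v2 : (SimplexCategory.δ 2 ≫ T).toOrderHom 1 = T.toOrderHom 1 := rfl
    have v3 : (SimplexCategory.δ 1 ≫ T).toOrderHom 0 = T.toOrderHom 0 := rfl
    have v4 : (SimplexCategory.δ 0 ≫ T).toOrderHom 0 = T.toOrderHom 1 := rfl
    rw [v1, v2] at h2
    rw [v1, v3, v4, ← smul_mul', ← h1]
    -- By `hconj`, moving the frame from vertex `1` to vertex `0` is conjugation followed by `t`.
    have h3 : (t (H.map (lastEdge (T.toOrderHom 1)).op σ))⁻¹ =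
        (t (H.map (lastEdge (T.toOrderHom 0)).op σ))⁻¹ *
          (conj (η (H.map (snocLast (SimplexCategory.δ 2 ≫ T)).op σ)))⁻¹ *
          t (H.map (SimplexCategory.δ 2 ≫ T).op σ) := by
      rw [h2]; group
    rw [h3, ← _root_.map_inv, mul_smul, mul_smul, conj_smul_normalizer, ← smul_mul']
    congr 1
    group

end Lift

end Frames

/-! ### Trivializations over a simplex -/

section Trivializations

/-- The value of `φ : K × Δ[n] → E` at `(x, θ)`, with `θ` a simplex of `Δ[n]`. -/
def evalAt {K E : SSet.{u}} {n : ℕ} (φ : K ⊗ (Δ[n] : SSet.{u}) ⟶ E) {k : SimplexCategory}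
    (θ : k ⟶ ⦋n⦌) (x : K.obj (op k)) : E.obj (op k) :=
  φ.app (op k) (x, SSet.stdSimplex.objEquiv.symm θ)

lemma map_evalAt {K E : SSet.{u}} {n : ℕ} (φ : K ⊗ (Δ[n] : SSet.{u}) ⟶ E) {k l : SimplexCategory}
    (θ : k ⟶ ⦋n⦌) (x : K.obj (op k)) (g : l ⟶ k) :
    E.map g.op (evalAt φ θ x) = evalAt φ (g ≫ θ) (K.map g.op x) :=
  (NatTrans.naturality_apply φ g.op
    ((x, SSet.stdSimplex.objEquiv.symm θ) : (K ⊗ (Δ[n] : SSet.{u})).obj (op k))).symm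

lemma isProd_evalAt {K E : SSet.{u}} {n : ℕ} (φ : K ⊗ (Δ[n] : SSet.{u}) ⟶ E) {x y z : K _⦋1⦌}
    (h : IsProd K x y z) (T : ⦋2⦌ ⟶ ⦋n⦌) :
    IsProd E (evalAt φ (SimplexCategory.δ 2 ≫ T) x) (evalAt φ (SimplexCategory.δ 0 ≫ T) y)
      (evalAt φ (SimplexCategory.δ 1 ≫ T) z) := by
  obtain ⟨w, rfl, rfl, rfl⟩ := h
  exact ⟨evalAt φ T w, map_evalAt _ _ _ _, map_evalAt _ _ _ _, map_evalAt _ _ _ _⟩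

/-- A map `φ : K × Δ[n] → E` exhibits `K × Δ[n]` as the pullback of `p : E → B` along `σ ∈ Bₙ` if
and only if it is, over each simplex `θ` of `Δ[n]`, a bijection from `K` to the fibre over
`θ^* σ`. -/
lemma isPullback_snd_iff {K E B : SSet.{u}} {n : ℕ} (φ : K ⊗ (Δ[n] : SSet.{u}) ⟶ E) (p : E ⟶ B)
    (σ : B _⦋n⦌) :
    IsPullback φ (snd K (Δ[n] : SSet.{u})) p (SSet.yonedaEquiv.symm σ) ↔
      (∀ (k : SimplexCategory) (θ : k ⟶ ⦋n⦌) (x : K.obj (op k)),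
        p.app _ (evalAt φ θ x) = B.map θ.op σ) ∧
      (∀ (k : SimplexCategory) (θ : k ⟶ ⦋n⦌) (x y : K.obj (op k)),
        evalAt φ θ x = evalAt φ θ y → x = y) ∧
      (∀ (k : SimplexCategory) (θ : k ⟶ ⦋n⦌) (e : E.obj (op k)),
        p.app _ e = B.map θ.op σ → ∃ x, evalAt φ θ x = e) := by
  rw [IsPullback.iff_app]
  simp only [Limits.Types.isPullback_iff]
  constructor
  · intro h
    refine ⟨fun k θ x => ?_, fun k θ x y hxy => ?_, fun k θ e he => ?_⟩
    · exact ConcreteCategory.congr_hom (h (op k)).1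
        ((x, SSet.stdSimplex.objEquiv.symm θ) : (K ⊗ (Δ[n] : SSet.{u})).obj (op k))
    · exact congrArg _root_.Prod.fst ((h (op k)).2.1 (x, SSet.stdSimplex.objEquiv.symm θ)
        (y, SSet.stdSimplex.objEquiv.symm θ) ⟨hxy, rfl⟩)
    · obtain ⟨⟨x, s⟩, hx, hs⟩ := (h (op k)).2.2 e (SSet.stdSimplex.objEquiv.symm θ) he
      have hs' : s = SSet.stdSimplex.objEquiv.symm θ := hs
      subst hs'
      exact ⟨x, hx⟩
  · rintro ⟨h1, h2, h3⟩ ⟨k⟩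
    refine ⟨?_, ?_, ?_⟩
    · ext ⟨x, s⟩
      exact h1 k (SSet.stdSimplex.objEquiv s) x
    · rintro ⟨x, s⟩ ⟨y, s'⟩ ⟨h, h'⟩
      have hs : s = s' := h'
      subst hs
      rw [h2 k (SSet.stdSimplex.objEquiv s) x y h]
    · intro e s he
      obtain ⟨x, hx⟩ := h3 k (SSet.stdSimplex.objEquiv s) e he
      exact ⟨(x, s), hx, rfl⟩

end Trivializations

/-! ### The twisted product of a twisting pair -/

section Model

variable {M H : SSet.{u}} [IsPartialGroup M]

/-- The total space of the extension with twisting pair `(t, η)`. A simplex is recorded by its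
projection `σ` to `H` and by its coordinates: its edge over the edge `f` of `σ` is `ι(m_f)` times
the chosen lift. Coordinates are admissible if they come from a simplex of `M` by a frame of `σ`;
in this form the simplicial operators are evident for arbitrary `t` and `η`. -/
noncomputable def model (t : H _⦋1⦌ → Aut M) (η : H _⦋2⦌ → Normalizer M) : SSet.{u} where
  obj n := {p : H.obj n × ((⦋1⦌ ⟶ n.unop) → M _⦋1⦌) //
    ∃ (a : Fin (n.unop.len + 1) → Aut M) (μ : (⦋1⦌ ⟶ n.unop) → Normalizer M),
      IsFrame (n := n.unop) t η p.1 a μ ∧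
      ∃ x : M.obj n, ∀ f, p.2 f = frameCoord (n := n.unop) a μ x f}
  map θ := ↾fun p => ⟨(H.map θ p.1.1, fun f => p.1.2 (f ≫ θ.unop)), by
    obtain ⟨a, μ, h, x, hx⟩ := p.2
    exact ⟨_, _, h.comp θ.unop, M.map θ x, fun f =>
      (hx _).trans (frameCoord_comp a μ x θ.unop f).symm⟩⟩
  map_id n := by
    refine ConcreteCategory.hom_ext _ _ fun p => Subtype.ext (Prod.ext ?_ ?_)
    · change H.map (𝟙 n) p.1.1 = p.1.1
      simp
    · funext f
      exact congrArg p.1.2 (Category.comp_id f)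
  map_comp θ θ' := by
    refine ConcreteCategory.hom_ext _ _ fun p => Subtype.ext (Prod.ext ?_ ?_)
    · change H.map (θ ≫ θ') p.1.1 = H.map θ' (H.map θ p.1.1)
      simp
    · funext f
      exact congrArg p.1.2 (Category.assoc f _ _).symm

variable {t : H _⦋1⦌ → Aut M} {η : H _⦋2⦌ → Normalizer M}

/-- The projection of the twisted product. -/
noncomputable def modelProj (t : H _⦋1⦌ → Aut M) (η : H _⦋2⦌ → Normalizer M) : model t η ⟶ H where
  app _ := ↾fun p => p.1.1
  naturality _ _ _ := rfl

/-- The trivialization of the twisted product over `σ` that is defined by a frame of `σ`. -/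
noncomputable def modelChart {n : ℕ} {σ : H _⦋n⦌} {a : Fin (n + 1) → Aut M}
    {μ : (⦋1⦌ ⟶ ⦋n⦌) → Normalizer M} (h : IsFrame (n := ⦋n⦌) t η σ a μ) :
    M ⊗ (Δ[n] : SSet.{u}) ⟶ model t η where
  app k := ↾fun p => ⟨(H.map (SSet.stdSimplex.objEquiv p.2).op σ,
    frameCoord (n := k.unop) (fun i => a ((SSet.stdSimplex.objEquiv p.2).toOrderHom i))
      (fun f => μ (f ≫ SSet.stdSimplex.objEquiv p.2)) p.1),
    ⟨_, _, h.comp (SSet.stdSimplex.objEquiv p.2), p.1, fun _ => rfl⟩⟩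
  naturality k l θ := by
    refine ConcreteCategory.hom_ext _ _ fun p => Subtype.ext (Prod.ext ?_ ?_)
    · exact (map_map H θ.unop (SSet.stdSimplex.objEquiv p.2) σ).symm
    · funext f
      exact frameCoord_comp (fun i => a ((SSet.stdSimplex.objEquiv p.2).toOrderHom i))
        (fun f => μ (f ≫ SSet.stdSimplex.objEquiv p.2)) p.1 θ.unop f

lemma isPullback_modelChart {n : ℕ} {σ : H _⦋n⦌} {a : Fin (n + 1) → Aut M}
    {μ : (⦋1⦌ ⟶ ⦋n⦌) → Normalizer M} (h : IsFrame (n := ⦋n⦌) t η σ a μ) :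
    IsPullback (modelChart h) (snd M (Δ[n] : SSet.{u})) (modelProj t η)
      (SSet.yonedaEquiv.symm σ) := by
  rw [isPullback_snd_iff]
  refine ⟨fun k θ x => rfl, ?_, ?_⟩
  · rintro ⟨k⟩ θ x y hxy
    refine frameCoord_injective (a := fun i => a (θ.toOrderHom i)) (μ := fun f => μ (f ≫ θ))
      (congrFun ?_)
    exact congrArg (fun e : (model t η).obj (op _) => e.1.2) hxy
  · rintro ⟨k⟩ θ ⟨⟨τ, m⟩, a', μ', h', x', hx'⟩ he
    have he' : τ = H.map θ.op σ := he
    subst he'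
    obtain ⟨x, hx⟩ := IsFrame.exists_frameCoord_eq h' (h.comp θ) x'
    exact ⟨x, Subtype.ext (Prod.ext rfl (funext fun f => (hx f).trans (hx' f).symm))⟩

section Extension

variable [IsPartialGroup H] {α : H ⟶ bar (Out M)}

lemma map_to_vertex {n : SimplexCategory} (f : n ⟶ ⦋0⦌) (g : n ⟶ ⦋0⦌) : f = g := by
  ext i
  exact congrArg Fin.val (Subsingleton.elim (α := Fin 1) _ _)

lemma IsLift.η_const (h : IsLift α t η) (T : ⦋2⦌ ⟶ ⦋0⦌) : η (H.map T.op (vertex H)) = 1 := by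
  rw [← h.one_left (one H), map_congr H (map_to_vertex T
    (SimplexCategory.σ 0 ≫ SimplexCategory.σ 0)), ← map_map]
  rfl

lemma IsLift.isFrame_one (h : IsLift α t η) (n : SimplexCategory) :
    IsFrame t η (H.map (SimplexCategory.const n ⦋0⦌ 0).op (vertex H)) (fun _ => 1)
      (fun _ => 1) where
  conj_eq f := by
    rw [map_map, map_to_one _ rfl, h.map_one]
    simp
  mul_eq T := by
    rw [map_map, h.η_const]
    simp

/-- The inclusion of the fibre of the twisted product. -/
noncomputable def modelIncl (h : IsLift α t η) : M ⟶ model t η where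
  app n := ↾fun x => ⟨(H.map (SimplexCategory.const n.unop ⦋0⦌ 0).op (vertex H),
    fun f => M.map f.op x), _, _, h.isFrame_one n.unop, x, fun f => by simp [frameCoord]⟩
  naturality m n θ := by
    refine ConcreteCategory.hom_ext _ _ fun x => Subtype.ext (Prod.ext ?_ ?_)
    · exact (map_map H θ.unop (SimplexCategory.const _ ⦋0⦌ 0) (vertex H)).symm
    · funext f
      exact map_map M f θ.unop x

/-- The twisted product, as an extension. -/
noncomputable def modelExtension (h : IsLift α t η) (hκ : ∀ σ : H _⦋3⦌, obstruction t η σ = 1) :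
    Extension M H where
  total := model t η
  incl := modelIncl h
  proj := modelProj t η
  isFibreBundle := by
    refine ⟨fun n σ => ?_, fun n b => ?_⟩
    · exact ⟨evalAt (modelChart (h.isFrame hκ σ)) (𝟙 _)
        (M.map (SimplexCategory.const ⦋n⦌ ⦋0⦌ 0).op (vertex M)), map_id_op H σ⟩
    · obtain ⟨σ, rfl⟩ := SSet.yonedaEquiv.symm.surjective b
      exact ⟨_, isPullback_modelChart (h.isFrame hκ σ)⟩
  incl_injective n x y hxy := by
    refine frameCoord_injective (a := fun _ => 1) (μ := fun _ => 1) fun f => ?_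
    have h1 : M.map f.op x = M.map f.op y :=
      congrFun (congrArg (fun e : (model t η).obj (op _) => e.1.2) hxy) f
    simp only [frameCoord, h1]
  mem_range_incl n e := by
    constructor
    · rintro ⟨x, rfl⟩
      rfl
    · intro he
      obtain ⟨⟨σ, m⟩, a, μ, h', x', hx'⟩ := e
      have he' : σ = H.map (SimplexCategory.const ⦋n⦌ ⦋0⦌ 0).op (vertex H) := he
      subst he'
      obtain ⟨x, hx⟩ := IsFrame.exists_frameCoord_eq h' (h.isFrame_one ⦋n⦌) x'
      refine ⟨x, Subtype.ext (Prod.ext rfl (funext fun f => ?_))⟩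
      refine Eq.trans ?_ ((hx f).trans (hx' f).symm)
      simp [frameCoord]
      rfl

end Extension

end Model

/-! ### Charts of extensions -/

section Charts

lemma exists_lift_of_injective {K L X : SSet.{u}} (f : L ⟶ X)
    (hf : ∀ n, Function.Injective (fun x : L.obj n => f.app n x)) (g : K ⟶ X)
    (h : ∀ n (x : K.obj n), ∃ y, f.app n y = g.app n x) : ∃ l : K ⟶ L, l ≫ f = g := by
  choose l hl using h
  refine ⟨⟨fun n => ↾(l n), fun m n θ => ConcreteCategory.hom_ext _ _ fun x => hf n ?_⟩, ?_⟩
  · change f.app n (l n (K.map θ x)) = f.app n (L.map θ (l m x))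
    rw [hl, NatTrans.naturality_apply, NatTrans.naturality_apply, hl]
  · ext n x
    exact hl n x

lemma app_congr {K L : SSet.{u}} {f g : K ⟶ L} (h : f = g) {n : SimplexCategoryᵒᵖ} (x : K.obj n) :
    f.app n x = g.app n x := by rw [h]

lemma hom_cancel_of_injective {K L X : SSet.{u}} {f : L ⟶ X}
    (hf : ∀ n, Function.Injective (fun x : L.obj n => f.app n x)) {g h : K ⟶ L}
    (e : g ≫ f = h ≫ f) : g = h := by
  ext n x
  exact hf n (app_congr e x)

lemma oneSimplex_cases (s : ⦋1⦌ ⟶ ⦋1⦌) :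
    s = SimplexCategory.const _ _ 0 ∨ s = 𝟙 _ ∨ s = SimplexCategory.const _ _ 1 := by
  have hm : s.toOrderHom 0 ≤ s.toOrderHom 1 := s.toOrderHom.monotone (by decide)
  generalize h0 : s.toOrderHom 0 = i at hm
  generalize h1 : s.toOrderHom 1 = j at hm
  have key (r : ⦋1⦌ ⟶ ⦋1⦌) (hr0 : r.toOrderHom 0 = i) (hr1 : r.toOrderHom 1 = j) : s = r := by
    ext k
    fin_cases k
    · exact congrArg Fin.val (h0.trans hr0.symm)
    · exact congrArg Fin.val (h1.trans hr1.symm)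
  fin_cases i <;> fin_cases j
  · exact Or.inl (key _ rfl rfl)
  · exact Or.inr (Or.inl (key _ rfl rfl))
  · exact absurd hm (by decide)
  · exact Or.inr (Or.inr (key _ rfl rfl))

variable {M H : SSet.{u}} [IsPartialGroup M] [IsPartialGroup H]

lemma Extension.proj_incl (E : Extension M H) {n : SimplexCategory} (x : M.obj (op n)) :
    E.proj.app _ (E.incl.app _ x) = H.map (SimplexCategory.const n ⦋0⦌ 0).op (vertex H) :=
  (E.mem_range_incl n.len _).1 ⟨x, rfl⟩

/-- The total space of an extension is a partial monoid. -/
instance (E : Extension M H) : IsPartialMonoid E.total where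
  nonempty_vertex := ⟨E.incl.app _ (vertex M)⟩
  subsingleton_vertex := ⟨fun e e' => by
    obtain ⟨x, rfl⟩ := (E.mem_range_incl 0 e).2 (vertex_eq H _ _)
    obtain ⟨x', rfl⟩ := (E.mem_range_incl 0 e').2 (vertex_eq H _ _)
    rw [vertex_eq M x x']⟩
  spine_injective n hn e e' h := by
    have hp : E.proj.app _ e = E.proj.app _ e' := by
      refine IsPartialMonoid.spine_injective n hn (funext fun i => ?_)
      refine (NatTrans.naturality_apply E.proj _ e).symm.trans
        (Eq.trans ?_ (NatTrans.naturality_apply E.proj _ e'))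
      exact congrArg (E.proj.app _) (congrFun h i)
    obtain ⟨φ, hφ⟩ := E.isFibreBundle.exists_trivialization n
      (SSet.yonedaEquiv.symm (E.proj.app _ e))
    rw [isPullback_snd_iff] at hφ
    obtain ⟨-, h2, h3⟩ := hφ
    obtain ⟨x, rfl⟩ := h3 _ (𝟙 _) e (map_id_op _ _).symm
    obtain ⟨x', rfl⟩ := h3 _ (𝟙 _) e' (hp.symm.trans (map_id_op _ _).symm)
    congr 1
    refine IsPartialMonoid.spine_injective n hn (funext fun i => ?_)
    have := congrFun h i
    simp only [spine] at this
    rw [map_evalAt, map_evalAt] at this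
    exact h2 _ _ _ _ this

/-- A chart of an extension over `σ ∈ Hₙ` is a trivialization `φ` over `σ`; it restricts to
`ι ∘ aᵢ` over the `i`-th vertex, where `aᵢ` is an automorphism of `M`. -/
structure Extension.IsChart (E : Extension M H) {n : ℕ} (σ : H _⦋n⦌)
    (φ : M ⊗ (Δ[n] : SSet.{u}) ⟶ E.total) (a : Fin (n + 1) → Aut M) : Prop where
  isPullback : IsPullback φ (snd M (Δ[n] : SSet.{u})) E.proj (SSet.yonedaEquiv.symm σ)
  evalAt_const : ∀ (k : SimplexCategory) (i : Fin (n + 1)) (x : M.obj (op k)),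
    evalAt φ (SimplexCategory.const k ⦋n⦌ i) x = E.incl.app _ (a i • x)

lemma Extension.exists_isChart (E : Extension M H) {n : ℕ} (σ : H _⦋n⦌) :
    ∃ φ a, E.IsChart σ φ a := by
  obtain ⟨φ, hφ⟩ := E.isFibreBundle.exists_trivialization n (SSet.yonedaEquiv.symm σ)
  obtain ⟨h1, h2, h3⟩ := (isPullback_snd_iff _ _ _).1 hφ
  have hι (n : SimplexCategoryᵒᵖ) : Function.Injective (fun x : M.obj n => E.incl.app n x) :=
    E.incl_injective n.unop.len
  have key (i : Fin (n + 1)) : ∃ a : Aut M, ∀ (k : SimplexCategory) (x : M.obj (op k)),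
      evalAt φ (SimplexCategory.const k ⦋n⦌ i) x = E.incl.app _ (a • x) := by
    -- Both `x ↦ φ (x, i)` and `ι` are isomorphisms onto the fibre over the vertex of `H`.
    let g : M ⟶ E.total :=
      ⟨fun k => ↾(fun x => evalAt φ (SimplexCategory.const k.unop ⦋n⦌ i) x), fun k l θ =>
        ConcreteCategory.hom_ext _ _ fun x =>
          (map_evalAt φ (SimplexCategory.const k.unop ⦋n⦌ i) x θ.unop).symm⟩
    have hg (k : SimplexCategoryᵒᵖ) : Function.Injective (fun x : M.obj k => g.app k x) :=
      fun x y hxy => h2 _ _ x y hxy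
    have hb (k : SimplexCategory) : H.map (SimplexCategory.const k ⦋n⦌ i).op σ =
        H.map (SimplexCategory.const k ⦋0⦌ 0).op (vertex H) := by
      rw [vertex_eq H (vertex H) (H.map (SimplexCategory.const ⦋0⦌ ⦋n⦌ i).op σ), map_map]
      rfl
    obtain ⟨l, hl⟩ := exists_lift_of_injective E.incl hι g fun k x =>
      (E.mem_range_incl k.unop.len _).2 ((h1 _ _ x).trans (hb k.unop))
    obtain ⟨l', hl'⟩ := exists_lift_of_injective g hg E.incl fun k x =>
      h3 _ _ _ ((E.proj_incl x).trans (hb k.unop).symm)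
    refine ⟨⟨l, l', hom_cancel_of_injective hg ?_, hom_cancel_of_injective hι ?_⟩, fun k x => ?_⟩
    · rw [Category.assoc, hl', hl, Category.id_comp]
    · rw [Category.assoc, hl, hl', Category.id_comp]
    · exact (app_congr hl x).symm
  choose a ha using key
  exact ⟨φ, a, hφ, fun k i x => ha i k x⟩

namespace Extension.IsChart

variable {E : Extension M H} {n : ℕ} {σ : H _⦋n⦌} {φ : M ⊗ (Δ[n] : SSet.{u}) ⟶ E.total}
  {a : Fin (n + 1) → Aut M}

lemma proj_evalAt (h : E.IsChart σ φ a) {k : SimplexCategory} (θ : k ⟶ ⦋n⦌) (x : M.obj (op k)) :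
    E.proj.app _ (evalAt φ θ x) = H.map θ.op σ :=
  ((isPullback_snd_iff _ _ _).1 h.isPullback).1 _ _ _

lemma evalAt_injective (h : E.IsChart σ φ a) {k : SimplexCategory} {θ : k ⟶ ⦋n⦌}
    {x y : M.obj (op k)} (e : evalAt φ θ x = evalAt φ θ y) : x = y :=
  ((isPullback_snd_iff _ _ _).1 h.isPullback).2.1 _ _ _ _ e

lemma exists_evalAt_eq (h : E.IsChart σ φ a) {k : SimplexCategory} {θ : k ⟶ ⦋n⦌}
    {e : E.total.obj (op k)} (he : E.proj.app _ e = H.map θ.op σ) : ∃ x, evalAt φ θ x = e :=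
  ((isPullback_snd_iff _ _ _).1 h.isPullback).2.2 _ _ _ he

/-- Left multiplication by elements of the fibre, in a chart. -/
lemma isProd_incl (h : E.IsChart σ φ a) (e : ⦋1⦌ ⟶ ⦋n⦌) {x y z : M _⦋1⦌}
    (hxyz : IsProd M ((a (e.toOrderHom 0))⁻¹ • x) y z) :
    IsProd E.total (E.incl.app _ x) (evalAt φ e y) (evalAt φ e z) := by
  have h1 := isProd_evalAt φ hxyz (SimplexCategory.σ 0 ≫ e)
  have e0 : SimplexCategory.δ 0 ≫ SimplexCategory.σ 0 ≫ e = e := by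
    ext i; fin_cases i <;> rfl
  have e1 : SimplexCategory.δ 1 ≫ SimplexCategory.σ 0 ≫ e = e := by
    ext i; fin_cases i <;> rfl
  have e2 : SimplexCategory.δ 2 ≫ SimplexCategory.σ 0 ≫ e =
      SimplexCategory.const _ _ (e.toOrderHom 0) := by
    ext i; fin_cases i <;> rfl
  rwa [e0, e1, e2, h.evalAt_const, smul_inv_smul] at h1

/-- In a chart, the edges of the total space that realize automorphisms of `M` are given by elements
of `N(M)`. -/
lemma exists_normalizer (h : E.IsChart σ φ a) {e : ⦋1⦌ ⟶ ⦋n⦌} {z : E.total _⦋1⦌} {f : Aut M}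
    (hz : E.Realizes z f) (hp : E.proj.app _ z = H.map e.op σ) :
    ∃ μ : Normalizer M, evalAt φ e μ.1 = z ∧
      conj μ = (a (e.toOrderHom 0))⁻¹ * f * a (e.toOrderHom 1) := by
  obtain ⟨G, h0, h1, hG⟩ := hz
  -- The homotopy lies over the edge `e` of `σ`, hence lifts to the chart.
  have w : G ≫ E.proj = (snd M (Δ[1] : SSet.{u}) ≫ SSet.stdSimplex.map e) ≫
      SSet.yonedaEquiv.symm σ := by
    refine hom_ext fun ⟨x, s⟩ => ?_
    obtain ⟨s, rfl⟩ := SSet.stdSimplex.objEquiv.symm.surjective s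
    change E.proj.app _ (ev G x s) = H.map (s ≫ e).op σ
    rcases oneSimplex_cases s with rfl | rfl | rfl
    · rw [ev_zero, h0, map_to_one _ rfl]
      exact (E.proj_incl _).trans (map_to_one _ rfl _)
    · have := (isProd_ev G x).1.map E.proj
      rw [h1, hG, hp, E.proj_incl,
        map_to_one (SimplexCategory.const ⦋1⦌ ⦋0⦌ 0) rfl] at this
      rw [Category.id_comp]
      exact this.unique (isProd_one_right _)
    · rw [ev_one, h1, map_to_one _ rfl]
      exact (E.proj_incl _).trans (map_to_one _ rfl _)
  let G' : M ⊗ (Δ[1] : SSet.{u}) ⟶ M := h.isPullback.lift G (snd _ _ ≫ SSet.stdSimplex.map e) w ≫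
    fst _ _
  have hG' {k : SimplexCategory} (x : M.obj (op k)) (s : k ⟶ ⦋1⦌) :
      evalAt φ (s ≫ e) (ev G' x s) = ev G x s := by
    have e1 := app_congr (h.isPullback.lift_fst G (snd _ _ ≫ SSet.stdSimplex.map e) w)
      ((x, SSet.stdSimplex.objEquiv.symm s) : (M ⊗ (Δ[1] : SSet.{u})).obj (op k))
    have e2 := app_congr (h.isPullback.lift_snd G (snd _ _ ≫ SSet.stdSimplex.map e) w)
      ((x, SSet.stdSimplex.objEquiv.symm s) : (M ⊗ (Δ[1] : SSet.{u})).obj (op k))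
    have e3 : (h.isPullback.lift G (snd _ _ ≫ SSet.stdSimplex.map e) w).app (op k)
        ((x, SSet.stdSimplex.objEquiv.symm s) : (M ⊗ (Δ[1] : SSet.{u})).obj (op k)) =
        ((ev G' x s, SSet.stdSimplex.objEquiv.symm (s ≫ e)) :
          (M ⊗ (Δ[n] : SSet.{u})).obj (op k)) := Prod.ext rfl e2
    exact (congrArg (φ.app (op k)) e3).symm.trans e1
  have h0' : SSet.ι₀ ≫ G' = ((a (e.toOrderHom 0))⁻¹ * f).hom := by
    ext ⟨k⟩ x
    have e1 := hG' x (SimplexCategory.const _ _ 0)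
    rw [ev_zero, ev_zero, h0] at e1
    have e2 := (h.evalAt_const k (e.toOrderHom 0) _).symm.trans e1
    exact (eq_inv_smul_iff).2 (E.incl_injective k.len e2)
  have h1' : SSet.ι₁ ≫ G' = ((a (e.toOrderHom 1))⁻¹).hom := by
    ext ⟨k⟩ x
    have e1 := hG' x (SimplexCategory.const _ _ 1)
    rw [ev_one, ev_one, h1] at e1
    have e2 := (h.evalAt_const k (e.toOrderHom 1) _).symm.trans e1
    exact (eq_inv_smul_iff).2 (E.incl_injective k.len e2)
  have hh : HomotopyBy (ev G' (one M) (𝟙 _)) ((a (e.toOrderHom 0))⁻¹ * f).hom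
      ((a (e.toOrderHom 1))⁻¹).hom := ⟨G', h0', h1', rfl⟩
  refine ⟨⟨ev G' (one M) (𝟙 _), (a (e.toOrderHom 0))⁻¹ * f * a (e.toOrderHom 1), ?_⟩, ?_, ?_⟩
  · have := hh.precomp (a (e.toOrderHom 1)).hom
    rwa [show (a (e.toOrderHom 1)).hom ≫ ((a (e.toOrderHom 1))⁻¹).hom = 𝟙 M from
      (a (e.toOrderHom 1)).hom_inv_id] at this
  · refine Eq.trans ?_ ((hG' (one M) (𝟙 _)).trans hG)
    rw [Category.id_comp]
  · exact (eq_mul_inv_iff_mul_eq.2 (homotopyBy_iff_conj.1 hh)).trans (by group)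

end Extension.IsChart

end Charts

/-! ### Twisting pairs of extensions -/

namespace Extension

variable {M H : SSet.{u}} [IsPartialGroup M] [IsPartialGroup H]

/-- Lifts `s(g)` of the edges `g` of `H` that realize automorphisms `t(g)` of `M`. -/
structure IsSection (E : Extension M H) (s : H _⦋1⦌ → E.total _⦋1⦌) (t : H _⦋1⦌ → Aut M) :
    Prop where
  proj_eq : ∀ g, E.proj.app _ (s g) = g
  map_one : s (one H) = E.incl.app _ (one M)
  realizes : ∀ g, E.Realizes (s g) (t g)

/-- The equation `s(g) · s(h) = c · s(gh)` over a simplex `σ = [g | h]` of `H`. -/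
def TwistingAt (E : Extension M H) (s : H _⦋1⦌ → E.total _⦋1⦌) (σ : H _⦋2⦌)
    (c : Normalizer M) : Prop :=
  ∃ e : E.total _⦋1⦌, IsProd E.total (s (H.δ 2 σ)) (s (H.δ 0 σ)) e ∧
    IsProd E.total (E.incl.app _ c.1) (s (H.δ 1 σ)) e

lemma hasTwistingPair_iff {E : Extension M H} {t : H _⦋1⦌ → Aut M} {η : H _⦋2⦌ → Normalizer M} :
    E.HasTwistingPair t η ↔ ∃ s, E.IsSection s t ∧ ∀ σ, E.TwistingAt s σ (η σ) :=
  ⟨fun ⟨s, h1, h2, h3, h4⟩ => ⟨s, ⟨h1, h2, h3⟩, h4⟩,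
    fun ⟨s, ⟨h1, h2, h3⟩, h4⟩ => ⟨s, h1, h2, h3, h4⟩⟩

/-- The lifts of the edges of `σ` correspond, in a chart, to the elements `μ f` of `N(M)`. -/
def IsCoord {E : Extension M H} (s : H _⦋1⦌ → E.total _⦋1⦌) {n : ℕ} (σ : H _⦋n⦌)
    (φ : M ⊗ (Δ[n] : SSet.{u}) ⟶ E.total) (μ : (⦋1⦌ ⟶ ⦋n⦌) → Normalizer M) : Prop :=
  ∀ f, evalAt φ f (μ f).1 = s (H.map f.op σ)

section Chart

variable {E : Extension M H} {s : H _⦋1⦌ → E.total _⦋1⦌} {t : H _⦋1⦌ → Aut M} {n : ℕ}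
  {σ : H _⦋n⦌} {φ : M ⊗ (Δ[n] : SSet.{u}) ⟶ E.total} {a : Fin (n + 1) → Aut M}
  {μ : (⦋1⦌ ⟶ ⦋n⦌) → Normalizer M}

lemma IsSection.exists_isCoord (hs : E.IsSection s t) (h : E.IsChart σ φ a) :
    ∃ μ : (⦋1⦌ ⟶ ⦋n⦌) → Normalizer M, IsCoord s σ φ μ ∧ ∀ f, conj (μ f) =
      (a (f.toOrderHom 0))⁻¹ * t (H.map f.op σ) * a (f.toOrderHom 1) := by
  choose μ h1 h2 using fun f : ⦋1⦌ ⟶ ⦋n⦌ =>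
    h.exists_normalizer (e := f) (hs.realizes (H.map f.op σ)) (hs.proj_eq _)
  exact ⟨μ, h1, h2⟩

lemma IsChart.isProd_iff (h : E.IsChart σ φ a) (hμ : IsCoord s σ φ μ) (f : ⦋1⦌ ⟶ ⦋n⦌)
    (m x : M _⦋1⦌) : IsProd E.total (E.incl.app _ m) (s (H.map f.op σ)) (evalAt φ f x) ↔
      m = a (f.toOrderHom 0) • (x <• (μ f)⁻¹) := by
  have key := h.isProd_incl f (isProd_op_smul (μ f) ((a (f.toOrderHom 0))⁻¹ • m))
  rw [hμ f] at key
  have : m = a (f.toOrderHom 0) • (x <• (μ f)⁻¹) ↔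
      ((a (f.toOrderHom 0))⁻¹ • m) <• μ f = x := by
    rw [← inv_smul_eq_iff, MulOpposite.op_inv, eq_inv_smul_iff]
  rw [this]
  exact ⟨fun h1 => h.evalAt_injective (key.unique h1), fun h1 => h1 ▸ key⟩

lemma IsChart.isProd_val_iff (h : E.IsChart σ φ a) (hμ : IsCoord s σ φ μ) (f : ⦋1⦌ ⟶ ⦋n⦌)
    (c x : Normalizer M) :
    IsProd E.total (E.incl.app _ c.1) (s (H.map f.op σ)) (evalAt φ f x.1) ↔
      x = (a (f.toOrderHom 0))⁻¹ • c * μ f := by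
  rw [h.isProd_iff hμ, op_smul_val, aut_smul_val, ← Normalizer.ext_iff', ← inv_smul_eq_iff,
    eq_mul_inv_iff_mul_eq, eq_comm]

lemma IsChart.twistingAt_iff (h : E.IsChart σ φ a) (hμ : IsCoord s σ φ μ) (T : ⦋2⦌ ⟶ ⦋n⦌)
    (c : Normalizer M) : E.TwistingAt s (H.map T.op σ) c ↔
      μ (SimplexCategory.δ 2 ≫ T) * μ (SimplexCategory.δ 0 ≫ T) =
        (a (T.toOrderHom 0))⁻¹ • c * μ (SimplexCategory.δ 1 ≫ T) := by
  have h1 := isProd_evalAt φ (Normalizer.isProd_mul (μ (SimplexCategory.δ 2 ≫ T))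
    (μ (SimplexCategory.δ 0 ≫ T))) T
  rw [hμ, hμ, ← δ_map_apply, ← δ_map_apply] at h1
  have h2 := h.isProd_val_iff hμ (SimplexCategory.δ 1 ≫ T) c
    (μ (SimplexCategory.δ 2 ≫ T) * μ (SimplexCategory.δ 0 ≫ T))
  rw [← δ_map_apply] at h2
  refine Iff.trans ?_ h2
  constructor
  · rintro ⟨e, p1, p2⟩
    rwa [h1.unique p1]
  · intro p
    exact ⟨_, h1, p⟩

/-- In a chart, a twisting pair satisfies the equations of a frame. -/
lemma IsSection.isFrame {η : H _⦋2⦌ → Normalizer M} (h : E.IsChart σ φ a)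
    (hη : ∀ σ, E.TwistingAt s σ (η σ)) (hμ : IsCoord s σ φ μ)
    (hc : ∀ f, conj (μ f) =
      (a (f.toOrderHom 0))⁻¹ * t (H.map f.op σ) * a (f.toOrderHom 1)) :
    IsFrame (n := ⦋n⦌) t η σ a μ :=
  ⟨hc, fun T => (h.twistingAt_iff hμ T _).1 (hη _)⟩

end Chart

variable {E : Extension M H} {s : H _⦋1⦌ → E.total _⦋1⦌} {t : H _⦋1⦌ → Aut M}

lemma IsSection.exists_chart (hs : E.IsSection s t) {n : ℕ} (σ : H _⦋n⦌) :
    ∃ φ a μ, E.IsChart σ φ a ∧ IsCoord s σ φ μ ∧ ∀ f, conj (μ f) =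
      (a (f.toOrderHom 0))⁻¹ * t (H.map f.op σ) * a (f.toOrderHom 1) := by
  obtain ⟨φ, a, h⟩ := E.exists_isChart σ
  obtain ⟨μ, h1, h2⟩ := hs.exists_isCoord h
  exact ⟨φ, a, μ, h, h1, h2⟩

/-- Every edge of the total space over `g` is uniquely of the form `ι(m) · s(g)`. -/
lemma IsSection.existsUnique_isProd (hs : E.IsSection s t) (z : E.total _⦋1⦌) :
    ∃! m : M _⦋1⦌, IsProd E.total (E.incl.app _ m) (s (E.proj.app _ z)) z := by
  obtain ⟨φ, a, μ, h, hμ, -⟩ := hs.exists_chart (E.proj.app _ z)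
  obtain ⟨x, hx⟩ := h.exists_evalAt_eq (θ := 𝟙 _) (e := z) (map_id_op _ _).symm
  have key (m) := h.isProd_iff hμ (𝟙 _) m x
  rw [map_id_op, hx] at key
  exact ⟨_, (key _).2 rfl, fun m hm => (key m).1 hm⟩

/-- A chart over an edge is a homotopy between its restrictions to the two vertices. -/
lemma IsChart.realizes {g : H _⦋1⦌} {φ : M ⊗ (Δ[1] : SSet.{u}) ⟶ E.total} {a : Fin 2 → Aut M}
    (h : E.IsChart g φ a) : E.Realizes (evalAt φ (𝟙 _) (one M)) (a 0 * (a 1)⁻¹) := by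
  have hh : HomotopyBy (evalAt φ (𝟙 _) (one M)) ((a 0).hom ≫ E.incl) ((a 1).hom ≫ E.incl) := by
    refine ⟨φ, ?_, ?_, rfl⟩
    · ext ⟨k⟩ x
      exact h.evalAt_const k 0 x
    · ext ⟨k⟩ x
      exact h.evalAt_const k 1 x
  have := hh.precomp ((a 1)⁻¹).hom
  rwa [← Category.assoc, ← Category.assoc,
    show ((a 1)⁻¹).hom ≫ (a 1).hom = 𝟙 M from (a 1).inv_hom_id, Category.id_comp] at this

lemma exists_isSection (E : Extension M H) : ∃ s t, E.IsSection s t := by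
  have key (g : H _⦋1⦌) : ∃ (z : E.total _⦋1⦌) (f : Aut M), E.proj.app _ z = g ∧
      E.Realizes z f ∧ (g = one H → z = E.incl.app _ (one M)) := by
    by_cases hg : g = one H
    · refine ⟨E.incl.app _ (one M), 1, ?_, ?_, fun _ => rfl⟩
      · rw [hg]; exact one_map (E.incl ≫ E.proj)
      · rw [one_map]; exact homotopyBy_one _
    · obtain ⟨φ, a, h⟩ := E.exists_isChart g
      refine ⟨evalAt φ (𝟙 _) (one M), a 0 * (a 1)⁻¹, ?_, h.realizes, fun h => absurd h hg⟩
      rw [h.proj_evalAt, map_id_op]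
  choose s t h1 h2 h3 using key
  exact ⟨s, t, h1, h3 _ rfl, h2⟩

lemma IsSection.exists_twistingAt (hs : E.IsSection s t) (σ : H _⦋2⦌) :
    ∃ c, E.TwistingAt s σ c := by
  obtain ⟨φ, a, μ, h, hμ, -⟩ := hs.exists_chart σ
  refine ⟨a 0 • (μ (SimplexCategory.δ 2 ≫ 𝟙 _) * μ (SimplexCategory.δ 0 ≫ 𝟙 _) *
    (μ (SimplexCategory.δ 1 ≫ 𝟙 _))⁻¹), ?_⟩
  rw [← map_id_op H σ, h.twistingAt_iff hμ]
  refine Eq.trans ?_ (congrArg (· * _) (inv_smul_smul (a 0) _).symm)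
  group

lemma exists_hasTwistingPair (E : Extension M H) : ∃ t η, E.HasTwistingPair t η := by
  obtain ⟨s, t, hs⟩ := E.exists_isSection
  choose η hη using fun σ => hs.exists_twistingAt σ
  exact ⟨t, η, hasTwistingPair_iff.2 ⟨s, hs, hη⟩⟩

/-! ### Twisting pairs are unobstructed lifts of the outer action -/

variable {η : H _⦋2⦌ → Normalizer M}

lemma IsSection.eq_one_of_isProd (hs : E.IsSection s t) {g : H _⦋1⦌} {c : Normalizer M}
    (h : IsProd E.total (E.incl.app _ c.1) (s g) (s g)) : c = 1 := by
  refine Subtype.ext ((hs.existsUnique_isProd (s g)).unique ?_ ?_)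
  · rwa [hs.proj_eq]
  · rw [hs.proj_eq]
    have := isProd_one_left (s g)
    rwa [← one_map E.incl] at this

/-- A twisting pair of an extension with outer action `α` is a lift of `α`. -/
lemma HasTwistingPair.isLift {α : H ⟶ bar (Out M)} (hE : E.HasOuterAction α)
    (h : E.HasTwistingPair t η) : IsLift α t η := by
  obtain ⟨s, hs, hη⟩ := hasTwistingPair_iff.1 h
  refine ⟨fun g => ?_, ?_, fun σ => ?_, fun g => ?_, fun g => ?_⟩
  · -- Any two edges over `g` that realize automorphisms differ by an element of `N(M)`.
    obtain ⟨z, f, hz, hf, hα⟩ := hE g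
    obtain ⟨φ, a, μ, hc, -, hμ⟩ := hs.exists_chart g
    obtain ⟨ν, -, hν⟩ := hc.exists_normalizer (e := 𝟙 _) hf (hz.trans (map_id_op _ _).symm)
    have h1 := hμ (𝟙 _)
    rw [map_id_op] at h1
    rw [← hα]
    refine QuotientGroup.eq.2 (mem_inn_iff.2 ⟨a 1 • ((μ (𝟙 _))⁻¹ * ν), ?_⟩)
    rw [conj_aut_smul, _root_.map_mul, _root_.map_inv, h1, hν]
    change a 1 * (((a 0)⁻¹ * t g * a 1)⁻¹ * ((a 0)⁻¹ * f * a 1)) * (a 1)⁻¹ = (t g)⁻¹ * f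
    group
  · have h1 := hs.realizes (one H)
    rw [hs.map_one, one_map] at h1
    have h2 := h1.eq_of_one
    refine Iso.ext (hom_cancel_of_injective (f := E.incl) (fun n => E.incl_injective n.unop.len) ?_)
    exact h2.trans (Category.id_comp _).symm
  · obtain ⟨φ, a, μ, hc, hμ, hμ'⟩ := hs.exists_chart σ
    have hf := IsSection.isFrame hc hη hμ hμ'
    rw [homotopyBy_iff_conj]
    have h1 := congrArg conj (hf.mul_eq (𝟙 _))
    rw [_root_.map_mul, _root_.map_mul, conj_aut_smul, hμ', hμ', hμ', map_id_op] at h1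
    change ((a 0)⁻¹ * t (H.δ 2 σ) * a 1) * ((a 1)⁻¹ * t (H.δ 0 σ) * a 2) =
      ((a 0)⁻¹ * conj (η σ) * (a 0)⁻¹⁻¹) * ((a 0)⁻¹ * t (H.δ 1 σ) * a 2) at h1
    have h2 : (a 0)⁻¹ * (t (H.δ 2 σ) * t (H.δ 0 σ)) * a 2 =
        (a 0)⁻¹ * (conj (η σ) * t (H.δ 1 σ)) * a 2 := by
      refine Eq.trans ?_ (h1.trans ?_) <;> group
    exact (mul_left_cancel (mul_right_cancel h2)).symm
  · obtain ⟨e, p1, p2⟩ := hη (H.σ 0 g)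
    have e0 : H.δ 0 (H.σ 0 g) = g := H.δ_comp_σ_self_apply 0 g
    have e1 : H.δ 1 (H.σ 0 g) = g := H.δ_comp_σ_succ_apply 0 g
    have e2 : H.δ 2 (H.σ 0 g) = one H := by
      rw [show H.δ 2 (H.σ 0 g) = _ from map_map H (SimplexCategory.δ 2) (SimplexCategory.σ 0) g]
      exact map_to_one _ rfl g
    rw [e2, e0, hs.map_one, one_map] at p1
    rw [e1, p1.unique (isProd_one_left _)] at p2
    exact hs.eq_one_of_isProd p2
  · obtain ⟨e, p1, p2⟩ := hη (H.σ 1 g)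
    have e0 : H.δ 0 (H.σ 1 g) = one H := by
      rw [show H.δ 0 (H.σ 1 g) = _ from map_map H (SimplexCategory.δ 0) (SimplexCategory.σ 1) g]
      exact map_to_one _ rfl g
    have e1 : H.δ 1 (H.σ 1 g) = g := H.δ_comp_σ_self_apply 1 g
    have e2 : H.δ 2 (H.σ 1 g) = g := H.δ_comp_σ_succ_apply 1 g
    rw [e2, e0, hs.map_one, one_map] at p1
    rw [e1, p1.unique (isProd_one_right _)] at p2
    exact hs.eq_one_of_isProd p2

/-- For a twisting pair, `κ = 1`: the equations of a frame of `σ` on the four faces of `σ` compute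
the product `μ₀₁ μ₁₂ μ₂₃` in the group `N(M)` in two ways. -/
lemma HasTwistingPair.obstruction_eq_one (h : E.HasTwistingPair t η) (σ : H _⦋3⦌) :
    obstruction t η σ = 1 := by
  obtain ⟨s, hs, hη⟩ := hasTwistingPair_iff.1 h
  obtain ⟨φ, a, μ, hc, hμ, hμ'⟩ := hs.exists_chart σ
  have hf := IsSection.isFrame hc hη hμ hμ'
  have h0 := hf.mul_eq (SimplexCategory.δ 0)
  have h1 := hf.mul_eq (SimplexCategory.δ 1)
  have h2 := hf.mul_eq (SimplexCategory.δ 2)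
  have h3 := hf.mul_eq (SimplexCategory.δ 3)
  have e00 : (SimplexCategory.δ 0 : ⦋1⦌ ⟶ ⦋2⦌) ≫ (SimplexCategory.δ 0 : ⦋2⦌ ⟶ ⦋3⦌) =
      SimplexCategory.mkOfLe 2 3 (by decide) := by ext i; fin_cases i <;> rfl
  have e10 : (SimplexCategory.δ 1 : ⦋1⦌ ⟶ ⦋2⦌) ≫ (SimplexCategory.δ 0 : ⦋2⦌ ⟶ ⦋3⦌) =
      SimplexCategory.mkOfLe 1 3 (by decide) := by ext i; fin_cases i <;> rfl
  have e20 : (SimplexCategory.δ 2 : ⦋1⦌ ⟶ ⦋2⦌) ≫ (SimplexCategory.δ 0 : ⦋2⦌ ⟶ ⦋3⦌) =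
      SimplexCategory.mkOfLe 1 2 (by decide) := by ext i; fin_cases i <;> rfl
  have e01 : (SimplexCategory.δ 0 : ⦋1⦌ ⟶ ⦋2⦌) ≫ (SimplexCategory.δ 1 : ⦋2⦌ ⟶ ⦋3⦌) =
      SimplexCategory.mkOfLe 2 3 (by decide) := by ext i; fin_cases i <;> rfl
  have e11 : (SimplexCategory.δ 1 : ⦋1⦌ ⟶ ⦋2⦌) ≫ (SimplexCategory.δ 1 : ⦋2⦌ ⟶ ⦋3⦌) =
      SimplexCategory.mkOfLe 0 3 (by decide) := by ext i; fin_cases i <;> rfl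
  have e21 : (SimplexCategory.δ 2 : ⦋1⦌ ⟶ ⦋2⦌) ≫ (SimplexCategory.δ 1 : ⦋2⦌ ⟶ ⦋3⦌) =
      SimplexCategory.mkOfLe 0 2 (by decide) := by ext i; fin_cases i <;> rfl
  have e02 : (SimplexCategory.δ 0 : ⦋1⦌ ⟶ ⦋2⦌) ≫ (SimplexCategory.δ 2 : ⦋2⦌ ⟶ ⦋3⦌) =
      SimplexCategory.mkOfLe 1 3 (by decide) := by ext i; fin_cases i <;> rfl
  have e12 : (SimplexCategory.δ 1 : ⦋1⦌ ⟶ ⦋2⦌) ≫ (SimplexCategory.δ 2 : ⦋2⦌ ⟶ ⦋3⦌) =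
      SimplexCategory.mkOfLe 0 3 (by decide) := by ext i; fin_cases i <;> rfl
  have e22 : (SimplexCategory.δ 2 : ⦋1⦌ ⟶ ⦋2⦌) ≫ (SimplexCategory.δ 2 : ⦋2⦌ ⟶ ⦋3⦌) =
      SimplexCategory.mkOfLe 0 1 (by decide) := by ext i; fin_cases i <;> rfl
  have e03 : (SimplexCategory.δ 0 : ⦋1⦌ ⟶ ⦋2⦌) ≫ (SimplexCategory.δ 3 : ⦋2⦌ ⟶ ⦋3⦌) =
      SimplexCategory.mkOfLe 1 2 (by decide) := by ext i; fin_cases i <;> rfl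
  have e13 : (SimplexCategory.δ 1 : ⦋1⦌ ⟶ ⦋2⦌) ≫ (SimplexCategory.δ 3 : ⦋2⦌ ⟶ ⦋3⦌) =
      SimplexCategory.mkOfLe 0 2 (by decide) := by ext i; fin_cases i <;> rfl
  have e23 : (SimplexCategory.δ 2 : ⦋1⦌ ⟶ ⦋2⦌) ≫ (SimplexCategory.δ 3 : ⦋2⦌ ⟶ ⦋3⦌) =
      SimplexCategory.mkOfLe 0 1 (by decide) := by ext i; fin_cases i <;> rfl
  have es : (SimplexCategory.mkOfSucc (0 : Fin 3)) = SimplexCategory.mkOfLe 0 1 (by decide) := by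
    ext i; fin_cases i <;> rfl
  rw [e00, e10, e20] at h0
  rw [e01, e11, e21] at h1
  rw [e02, e12, e22] at h2
  rw [e03, e13, e23] at h3
  have hm := hμ' (SimplexCategory.mkOfLe 0 1 (by decide))
  generalize μ (SimplexCategory.mkOfLe 0 1 (by decide)) = m01 at *
  generalize μ (SimplexCategory.mkOfLe 0 2 (by decide)) = m02 at *
  generalize μ (SimplexCategory.mkOfLe 0 3 (by decide)) = m03 at *
  generalize μ (SimplexCategory.mkOfLe 1 2 (by decide)) = m12 at *
  generalize μ (SimplexCategory.mkOfLe 1 3 (by decide)) = m13 at *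
  generalize μ (SimplexCategory.mkOfLe 2 3 (by decide)) = m23 at *
  change m12 * m23 = (a 1)⁻¹ • η (H.δ 0 σ) * m13 at h0
  change m02 * m23 = (a 0)⁻¹ • η (H.δ 1 σ) * m03 at h1
  change m01 * m13 = (a 0)⁻¹ • η (H.δ 2 σ) * m03 at h2
  change m01 * m12 = (a 0)⁻¹ • η (H.δ 3 σ) * m02 at h3
  rw [← mul_inv_eq_iff_eq_mul] at h0 h1 h2 h3
  have hs0 : spine H σ 0 = H.map (SimplexCategory.mkOfLe (0 : Fin 4) 1 (by decide)).op σ :=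
    map_congr H es σ
  change conj m01 = (a 0)⁻¹ * t _ * a 1 at hm
  rw [← hs0] at hm
  have h4 : (a 0)⁻¹ • t (spine H σ 0) • η (H.δ 0 σ) = m01 * (m12 * m23 * m13⁻¹) * m01⁻¹ := by
    rw [← conj_smul_normalizer, hm, h0, smul_smul, smul_smul]
    congr 1
    group
  refine MulAction.injective (a 0)⁻¹ ?_
  rw [obstruction]
  simp only [smul_mul', smul_inv', smul_one]
  rw [h4, ← h1, ← h2, ← h3]
  group

end Extension

/-! ### Extensions with the same twisting pair -/

namespace Extension

variable {M H : SSet.{u}} [IsPartialGroup M] [IsPartialGroup H] {E E' : Extension M H}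
  {t : H _⦋1⦌ → Aut M} {η : H _⦋2⦌ → Normalizer M}

lemma Equivalent.hasTwistingPair (h : E.Equivalent E') (hE : E.HasTwistingPair t η) :
    E'.HasTwistingPair t η := by
  obtain ⟨f, hi, hp⟩ := h
  obtain ⟨s, h1, h2, h3, h4⟩ := hE
  have hi' (x : M _⦋1⦌) : f.hom.app _ (E.incl.app _ x) = E'.incl.app _ x := app_congr hi x
  refine ⟨fun g => f.hom.app _ (s g), fun g => ?_, ?_, fun g => ?_, fun σ => ?_⟩
  · exact (app_congr hp (s g)).trans (h1 g)
  · exact (congrArg _ h2).trans (hi' _)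
  · have := (h3 g).postcomp f.hom
    rwa [Category.assoc, hi] at this
  · obtain ⟨e, p1, p2⟩ := h4 σ
    have p3 := p2.map f.hom
    rw [hi'] at p3
    exact ⟨_, p1.map f.hom, p3⟩

/-- An extension with twisting pair `(t, η)` is isomorphic to the twisted product, through the
coordinates of the edges of its simplices. -/
lemma HasTwistingPair.exists_iso_model (h : E.HasTwistingPair t η) :
    ∃ f : E.total ≅ model t η, (∀ n (e : E.total.obj n), (f.hom.app n e).1.1 = E.proj.app n e) ∧
      ∀ n (x : M.obj (op n)) (k : ⦋1⦌ ⟶ n),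
        (f.hom.app _ (E.incl.app _ x)).1.2 k = M.map k.op x := by
  obtain ⟨s, hs, hη⟩ := hasTwistingPair_iff.1 h
  choose m hm hm' using fun z => hs.existsUnique_isProd z
  have hproj {n : SimplexCategory} (e : E.total.obj (op n)) (k : ⦋1⦌ ⟶ n) :
      E.proj.app _ (E.total.map k.op e) = H.map k.op (E.proj.app _ e) :=
    NatTrans.naturality_apply E.proj k.op e
  have hcoord {n : ℕ} {σ : H _⦋n⦌} {φ a μ} (hc : E.IsChart σ φ a) (hμ : IsCoord s σ φ μ)
      (x : M _⦋n⦌) (k : ⦋1⦌ ⟶ ⦋n⦌) :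
      m (E.total.map k.op (evalAt φ (𝟙 _) x)) = frameCoord (n := ⦋n⦌) a μ x k := by
    refine (hc.isProd_iff hμ k _ _).1 ?_
    have hz : E.total.map k.op (evalAt φ (𝟙 _) x) = evalAt φ k (M.map k.op x) := by
      rw [map_evalAt, Category.comp_id]
    have := hm (evalAt φ k (M.map k.op x))
    rw [hc.proj_evalAt] at this
    rwa [hz]
  let F : E.total ⟶ model t η :=
    { app := fun n => ↾fun e => ⟨(E.proj.app n e, fun k => m (E.total.map k.op e)), by
        obtain ⟨⟨n⟩⟩ := n
        obtain ⟨φ, a, μ, hc, hμ, hμ'⟩ := hs.exists_chart (E.proj.app _ e)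
        obtain ⟨x, hx⟩ := hc.exists_evalAt_eq (θ := 𝟙 _) (e := e) (map_id_op _ _).symm
        refine ⟨a, μ, IsSection.isFrame hc hη hμ hμ', x, fun k => ?_⟩
        refine Eq.trans ?_ (hcoord hc hμ x k)
        rw [hx]⟩
      naturality := fun n l θ => by
        refine ConcreteCategory.hom_ext _ _ fun e => Subtype.ext (Prod.ext ?_ ?_)
        · exact NatTrans.naturality_apply E.proj θ e
        · funext k
          exact congrArg m (map_map E.total k θ.unop e) }
  have hF : IsIso F := by
    rw [NatTrans.isIso_iff_isIso_app]
    rintro ⟨⟨n⟩⟩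
    rw [isIso_iff_bijective]
    constructor
    · intro e e' hee
      have hp : E.proj.app _ e = E.proj.app _ e' := congrArg (fun p : (model t η).obj _ => p.1.1) hee
      obtain ⟨φ, a, μ, hc, hμ, hμ'⟩ := hs.exists_chart (E.proj.app _ e)
      obtain ⟨x, rfl⟩ := hc.exists_evalAt_eq (θ := 𝟙 _) (e := e) (map_id_op _ _).symm
      obtain ⟨x', rfl⟩ := hc.exists_evalAt_eq (θ := 𝟙 _) (e := e')
        (hp.symm.trans (map_id_op _ _).symm)
      congr 1
      refine frameCoord_injective (a := a) (μ := μ) fun k => ?_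
      rw [← hcoord hc hμ, ← hcoord hc hμ]
      exact congrFun (congrArg (fun p : (model t η).obj _ => p.1.2) hee) k
    · rintro ⟨⟨σ, c⟩, a', μ', hf, x', hx'⟩
      obtain ⟨φ, a, μ, hc, hμ, hμ'⟩ := hs.exists_chart (n := n) σ
      obtain ⟨x, hx⟩ := IsFrame.exists_frameCoord_eq hf (IsSection.isFrame hc hη hμ hμ') x'
      refine ⟨evalAt φ (𝟙 _) x, Subtype.ext (Prod.ext ?_ (funext fun k => ?_))⟩
      · exact (hc.proj_evalAt _ _).trans (map_id_op _ _)
      · exact (hcoord hc hμ x k).trans ((hx k).trans (hx' k).symm)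
  refine ⟨asIso F, fun n e => rfl, fun n x k => ?_⟩
  refine (hs.existsUnique_isProd _).unique (hm _) ?_
  have e1 : E.total.map k.op (E.incl.app _ x) = E.incl.app _ (M.map k.op x) :=
    (NatTrans.naturality_apply E.incl k.op x).symm
  rw [hproj, E.proj_incl, map_map, map_to_one (k ≫ SimplexCategory.const n ⦋0⦌ 0) rfl, hs.map_one,
    e1]
  exact (isProd_one_right (M.map k.op x)).map E.incl

/-- Extensions with a common twisting pair are equivalent. -/
lemma HasTwistingPair.equivalent (h : E.HasTwistingPair t η) (h' : E'.HasTwistingPair t η) :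
    E.Equivalent E' := by
  obtain ⟨f, hf1, hf2⟩ := h.exists_iso_model
  obtain ⟨f', hf1', hf2'⟩ := h'.exists_iso_model
  refine ⟨f ≪≫ f'.symm, ?_, ?_⟩
  · rw [Iso.trans_hom, Iso.symm_hom, ← Category.assoc, Iso.comp_inv_eq]
    ext ⟨n⟩ x
    refine Subtype.ext (Prod.ext ?_ (funext fun k => ?_))
    · exact (hf1 _ _).trans ((E.proj_incl x).trans ((E'.proj_incl x).symm.trans (hf1' _ _).symm))
    · exact (hf2 n x k).trans (hf2' n x k).symm
  · have hp : f.hom ≫ modelProj t η = E.proj := by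
      ext n e
      exact hf1 n e
    have hp' : f'.hom ≫ modelProj t η = E'.proj := by
      ext n e
      exact hf1' n e
    rw [Iso.trans_hom, Iso.symm_hom, Category.assoc, ← hp', Iso.inv_hom_id_assoc, hp]

end Extension

/-! ### Change of the lifts -/

section Change

variable {M H : SSet.{u}} [IsPartialGroup M] [IsPartialGroup H]

/-- The second component of the twisting pair obtained from `(t, η)` by replacing the lifts `s(g)`
by `ν(g) · s(g)`. -/
noncomputable def changeLift (t : H _⦋1⦌ → Aut M) (η : H _⦋2⦌ → Normalizer M)
    (ν : H _⦋1⦌ → Normalizer M) (σ : H _⦋2⦌) : Normalizer M :=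
  ν (H.δ 2 σ) * t (H.δ 2 σ) • ν (H.δ 0 σ) * η σ * (ν (H.δ 1 σ))⁻¹

namespace Extension

variable {E : Extension M H} {t t' : H _⦋1⦌ → Aut M} {η η' : H _⦋2⦌ → Normalizer M}
  {s s' : H _⦋1⦌ → E.total _⦋1⦌}

/-- The effect of a change of lifts on the equations of a twisting pair. -/
lemma IsSection.twistingAt_changeLift_iff (hs : E.IsSection s t) (hs' : E.IsSection s' t')
    (hη : ∀ σ, E.TwistingAt s σ (η σ)) {ν : H _⦋1⦌ → Normalizer M}
    (hν : ∀ g, IsProd E.total (E.incl.app _ (ν g).1) (s g) (s' g)) (σ : H _⦋2⦌)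
    (c : Normalizer M) : E.TwistingAt s' σ c ↔ c = changeLift t η ν σ := by
  obtain ⟨φ, a, μ, hc, hμ, hμ'⟩ := hs.exists_chart σ
  obtain ⟨μ', hμ2, -⟩ := hs'.exists_isCoord hc
  have hf := (IsSection.isFrame hc hη hμ hμ').mul_eq (𝟙 _)
  have rel (f : ⦋1⦌ ⟶ ⦋2⦌) : μ' f = (a (f.toOrderHom 0))⁻¹ • ν (H.map f.op σ) * μ f := by
    rw [← hc.isProd_val_iff hμ, hμ2]
    exact hν _
  have key := hc.twistingAt_iff hμ2 (𝟙 _) c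
  simp only [map_id_op, Category.comp_id] at key hf
  rw [key, rel, rel, rel]
  have h2 := hμ' (SimplexCategory.δ 2)
  generalize μ (SimplexCategory.δ 0) = m12 at *
  generalize μ (SimplexCategory.δ 1) = m02 at *
  generalize μ (SimplexCategory.δ 2) = m01 at *
  change m01 * m12 = (a 0)⁻¹ • η σ * m02 at hf
  change conj m01 = (a 0)⁻¹ * t (H.δ 2 σ) * a 1 at h2
  change (a 0)⁻¹ • ν (H.δ 2 σ) * m01 * ((a 1)⁻¹ • ν (H.δ 0 σ) * m12) =
    (a 0)⁻¹ • c * ((a 0)⁻¹ • ν (H.δ 1 σ) * m02) ↔ _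
  have h3 : m01 * (a 1)⁻¹ • ν (H.δ 0 σ) = (a 0)⁻¹ • t (H.δ 2 σ) • ν (H.δ 0 σ) * m01 := by
    rw [← mul_inv_eq_iff_eq_mul, ← conj_smul_normalizer, h2, smul_smul, smul_smul]
    congr 1
    group
  have h4 : (a 0)⁻¹ • ν (H.δ 2 σ) * m01 * ((a 1)⁻¹ • ν (H.δ 0 σ) * m12) =
      (a 0)⁻¹ • changeLift t η ν σ * ((a 0)⁻¹ • ν (H.δ 1 σ) * m02) := by
    rw [changeLift]
    simp only [smul_mul', smul_inv']
    calc _ = (a 0)⁻¹ • ν (H.δ 2 σ) * (m01 * (a 1)⁻¹ • ν (H.δ 0 σ)) * m12 := by group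
      _ = (a 0)⁻¹ • ν (H.δ 2 σ) * (a 0)⁻¹ • t (H.δ 2 σ) • ν (H.δ 0 σ) * (m01 * m12) := by
        rw [h3]; group
      _ = _ := by rw [hf]; group
  rw [h4, mul_left_inj, smul_left_cancel_iff, eq_comm]

/-- A twisting pair may be changed along any `ν : H₁ → N(M)` with `ν(1) = 1`. -/
lemma HasTwistingPair.changeLift (h : E.HasTwistingPair t η) {ν : H _⦋1⦌ → Normalizer M}
    (hν : ν (one H) = 1) :
    E.HasTwistingPair (fun g => conj (ν g) * t g) (changeLift t η ν) := by
  obtain ⟨s, hs, hη⟩ := hasTwistingPair_iff.1 h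
  have key (g : H _⦋1⦌) : ∃ z, IsProd E.total (E.incl.app _ (ν g).1) (s g) z ∧
      E.Realizes z (conj (ν g) * t g) := by
    obtain ⟨c, p1, p2⟩ := HomotopyBy.comp (hs.realizes g) (homotopyBy_conj ((t g)⁻¹ • ν g))
    refine ⟨c, ?_, ?_⟩
    · obtain ⟨d, q1, q2⟩ := HomotopyBy.isProd (hs.realizes g) ((t g)⁻¹ • ν g).1
      rw [p1.unique q1]
      have e : (t g).hom.app _ ((t g)⁻¹ • ν g).1 = (ν g).1 :=
        congrArg Subtype.val (smul_inv_smul (t g) (ν g))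
      have e' : ((t g).hom ≫ E.incl).app _ ((t g)⁻¹ • ν g).1 = E.incl.app _ (ν g).1 :=
        congrArg (E.incl.app _) e
      rwa [e'] at q2
    · have e : (conj ((t g)⁻¹ • ν g)).hom ≫ (t g).hom = (conj (ν g) * t g).hom := by
        have e0 : t g * conj ((t g)⁻¹ • ν g) = conj (ν g) * t g := by
          rw [conj_aut_smul]
          group
        exact congrArg Iso.hom e0
      rw [← Category.assoc, e, Category.id_comp] at p2
      exact p2
  choose s' h1 h2 using key
  have hs' : E.IsSection s' (fun g => conj (ν g) * t g) := by
    refine ⟨fun g => ?_, ?_, h2⟩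
    · have := (h1 g).map E.proj
      rw [hs.proj_eq, E.proj_incl, map_to_one _ rfl] at this
      exact this.unique (isProd_one_left g)
    · have := h1 (one H)
      rw [hν, hs.map_one] at this
      exact this.unique ((isProd_one_left (one M)).map E.incl)
  exact hasTwistingPair_iff.2 ⟨s', hs', fun σ =>
    (hs.twistingAt_changeLift_iff hs' hη h1 σ _).2 rfl⟩

/-- Any two twisting pairs of an extension differ by a change of lifts. -/
lemma HasTwistingPair.exists_changeLift (h : E.HasTwistingPair t η)
    (h' : E.HasTwistingPair t' η') : ∃ ν : H _⦋1⦌ → Normalizer M, ν (one H) = 1 ∧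
      (∀ g, t' g = conj (ν g) * t g) ∧ η' = PartialGroups.changeLift t η ν := by
  obtain ⟨s, hs, hη⟩ := hasTwistingPair_iff.1 h
  obtain ⟨s', hs', hη'⟩ := hasTwistingPair_iff.1 h'
  have key (g : H _⦋1⦌) : ∃ ν : Normalizer M,
      IsProd E.total (E.incl.app _ ν.1) (s g) (s' g) ∧ t' g = conj ν * t g := by
    obtain ⟨φ, a, μ, hc, hμ, hμ2⟩ := hs.exists_chart g
    obtain ⟨μ', hμ', hμ2'⟩ := hs'.exists_isCoord hc
    refine ⟨a 0 • (μ' (𝟙 _) * (μ (𝟙 _))⁻¹), ?_, ?_⟩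
    · have h1 := hc.isProd_val_iff hμ (𝟙 _) (a 0 • (μ' (𝟙 _) * (μ (𝟙 _))⁻¹)) (μ' (𝟙 _))
      rw [hμ', map_id_op] at h1
      refine h1.2 (Eq.trans ?_ (congrArg (· * _) (inv_smul_smul (a 0) _).symm))
      group
    · have h1 := hμ2 (𝟙 _)
      have h2 := hμ2' (𝟙 _)
      rw [map_id_op] at h1 h2
      rw [conj_aut_smul, _root_.map_mul, _root_.map_inv, h1, h2]
      change _ = a 0 * (((a 0)⁻¹ * t' g * a 1) * ((a 0)⁻¹ * t g * a 1)⁻¹) * (a 0)⁻¹ * t g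
      group
  choose ν h1 h2 using key
  refine ⟨ν, ?_, h2, funext fun σ => (hs.twistingAt_changeLift_iff hs' hη h1 σ _).1 (hη' σ)⟩
  have := h1 (one H)
  rw [hs'.map_one, ← hs.map_one] at this
  exact hs.eq_one_of_isProd this

end Extension

end Change

/-! ### The twisting pair of the twisted product -/

section ModelTwisting

variable {M H : SSet.{u}} [IsPartialGroup M] [IsPartialGroup H] {α : H ⟶ bar (Out M)}
  {t : H _⦋1⦌ → Aut M} {η : H _⦋2⦌ → Normalizer M}

lemma map_one_edge (X : SSet.{u}) [IsReducedSSet X] (k : ⦋1⦌ ⟶ ⦋1⦌) :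
    X.map k.op (one X) = one X := by
  change X.map k.op (X.map (SimplexCategory.σ 0).op (vertex X)) =
    X.map (SimplexCategory.σ 0).op (vertex X)
  rw [map_map]
  exact map_congr X (map_to_vertex _ _) _

/-- All `2`-simplices of `Δ[1]` are degenerate. -/
lemma IsLift.η_map (h : IsLift α t η) (T : ⦋2⦌ ⟶ ⦋1⦌) (g : H _⦋1⦌) : η (H.map T.op g) = 1 := by
  have h01 : T.toOrderHom 0 ≤ T.toOrderHom 1 := T.toOrderHom.monotone (by decide)
  have h12 : T.toOrderHom 1 ≤ T.toOrderHom 2 := T.toOrderHom.monotone (by decide)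
  rcases eq_or_ne (T.toOrderHom 0) (T.toOrderHom 1) with h0 | h0
  · have e : T = SimplexCategory.σ 0 ≫ SimplexCategory.δ 1 ≫ T := by
      ext i
      fin_cases i
      · rfl
      · exact congrArg Fin.val h0.symm
      · rfl
    rw [e, ← map_map]
    exact h.one_left _
  · have h2 : T.toOrderHom 1 = T.toOrderHom 2 := by
      have hlt : T.toOrderHom 0 < T.toOrderHom 1 := lt_of_le_of_ne h01 h0
      have b1 : (T.toOrderHom 2).val < 2 := (T.toOrderHom 2).isLt
      have b2 : (T.toOrderHom 0).val < (T.toOrderHom 1).val := hlt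
      have b3 : (T.toOrderHom 1).val ≤ (T.toOrderHom 2).val := h12
      exact Fin.ext (by omega)
    have e : T = SimplexCategory.σ 1 ≫ SimplexCategory.δ 1 ≫ T := by
      ext i
      fin_cases i
      · rfl
      · exact congrArg Fin.val h2
      · rfl
    rw [e, ← map_map]
    exact h.one_right _

/-- The frame of an edge `g` of `H` in which the chosen lift is `1`. -/
lemma IsLift.isFrame_edge (h : IsLift α t η) (g : H _⦋1⦌) :
    IsFrame (n := ⦋1⦌) t η g ![t g, 1] (fun _ => 1) where
  conj_eq f := by
    rcases oneSimplex_cases f with rfl | rfl | rfl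
    · rw [map_to_one _ rfl, h.map_one, _root_.map_one, mul_one]
      exact (inv_mul_cancel (t g)).symm
    · rw [map_id_op, _root_.map_one]
      exact ((congrArg (· * 1) (inv_mul_cancel (t g))).trans (mul_one 1)).symm
    · rw [map_to_one _ rfl, h.map_one, _root_.map_one, mul_one]
      exact (inv_mul_cancel 1).symm
  mul_eq T := by
    rw [h.η_map]
    simp

lemma IsFrame.eq_one_of_const {n : ℕ} {σ : H _⦋n⦌} {a : Fin (n + 1) → Aut M}
    {μ : (⦋1⦌ ⟶ ⦋n⦌) → Normalizer M} (hf : IsFrame (n := ⦋n⦌) t η σ a μ) (h : IsLift α t η)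
    (i : Fin (n + 1)) : μ (SimplexCategory.const _ _ i) = 1 := by
  have h1 := hf.mul_eq (SimplexCategory.const _ _ i)
  have e : SimplexCategory.const ⦋2⦌ ⦋n⦌ i =
      (SimplexCategory.const _ ⦋1⦌ 0) ≫ (SimplexCategory.const ⦋1⦌ ⦋n⦌ i) := rfl
  rw [e, ← map_map, h.η_map, smul_one, one_mul] at h1
  exact mul_eq_right.1 h1

lemma isChart_modelChart (h : IsLift α t η) (hκ : ∀ σ : H _⦋3⦌, obstruction t η σ = 1) {n : ℕ}
    {σ : H _⦋n⦌} {a : Fin (n + 1) → Aut M} {μ : (⦋1⦌ ⟶ ⦋n⦌) → Normalizer M}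
    (hf : IsFrame (n := ⦋n⦌) t η σ a μ) :
    (modelExtension h hκ).IsChart σ (modelChart hf) a where
  isPullback := isPullback_modelChart hf
  evalAt_const k i x := by
    refine Subtype.ext (Prod.ext ?_ (funext fun f => ?_))
    · refine Eq.trans ?_ (map_map H (SimplexCategory.const k ⦋0⦌ 0)
        (SimplexCategory.const ⦋0⦌ ⦋n⦌ i) σ).symm |>.trans ?_
      · rfl
      · exact congrArg _ (vertex_eq H _ _)
    · change a i • (M.map f.op x <• (μ (SimplexCategory.const ⦋1⦌ ⦋n⦌ i))⁻¹) =
        M.map f.op (a i • x)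
      rw [hf.eq_one_of_const h, map_aut_smul, inv_one, MulOpposite.op_one, one_smul]

/-- The twisted product of `(t, η)` has twisting pair `(t, η)`. -/
lemma IsLift.hasTwistingPair_modelExtension (h : IsLift α t η)
    (hκ : ∀ σ : H _⦋3⦌, obstruction t η σ = 1) : (modelExtension h hκ).HasTwistingPair t η := by
  let s (g : H _⦋1⦌) : (modelExtension h hκ).total _⦋1⦌ :=
    evalAt (modelChart (h.isFrame_edge g)) (𝟙 _) (one M)
  have hs2 (g : H _⦋1⦌) (k : ⦋1⦌ ⟶ ⦋1⦌) : (s g).1.2 k = one M := by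
    change _ • (M.map k.op (one M) <• (1 : Normalizer M)⁻¹) = _
    rw [map_one_edge, inv_one, MulOpposite.op_one, one_smul]
    exact aut_smul_one_edge _
  have hs1 (g : H _⦋1⦌) : (s g).1.1 = g := map_id_op H g
  have hs : (modelExtension h hκ).IsSection s t := by
    refine ⟨hs1, ?_, fun g => ?_⟩
    · refine Subtype.ext (Prod.ext ?_ (funext fun k => ?_))
      · exact (hs1 _).trans (map_congr H (map_to_vertex _ _) _)
      · exact (hs2 _ k).trans (map_one_edge M k).symm
    · have := (isChart_modelChart h hκ (h.isFrame_edge g)).realizes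
      have e : (![t g, 1] : Fin 2 → Aut M) 0 * ((![t g, 1] : Fin 2 → Aut M) 1)⁻¹ = t g :=
        (congrArg (t g * ·) inv_one).trans (mul_one _)
      rwa [e] at this
  refine Extension.hasTwistingPair_iff.2 ⟨s, hs, fun σ => ?_⟩
  have hf := h.isFrame hκ σ
  have hc := isChart_modelChart h hκ hf
  have hμ : Extension.IsCoord s σ (modelChart hf) (fun f =>
      (t (H.map (lastEdge (f.toOrderHom 0)).op σ))⁻¹ • η (H.map (snocLast f).op σ)) := by
    generalize (fun i => t (H.map (lastEdge i).op σ)) = a at hf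
    generalize (fun f : ⦋1⦌ ⟶ ⦋2⦌ => (t (H.map (lastEdge (f.toOrderHom 0)).op σ))⁻¹ •
      η (H.map (snocLast f).op σ)) = μ at hf
    intro f
    refine Subtype.ext (Prod.ext ?_ (funext fun k => ?_))
    · exact (hs1 _).symm
    · refine Eq.trans ?_ (hs2 _ k).symm
      change a (f.toOrderHom (k.toOrderHom 0)) • (M.map k.op (μ f).1 <• (μ (k ≫ f))⁻¹) = _
      rcases oneSimplex_cases k with rfl | rfl | rfl
      · rw [map_to_one _ rfl, show SimplexCategory.const ⦋1⦌ ⦋1⦌ 0 ≫ f =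
          SimplexCategory.const _ _ (f.toOrderHom 0) from rfl, hf.eq_one_of_const h, inv_one,
          MulOpposite.op_one, one_smul, aut_smul_one_edge]
      · rw [map_id_op, Category.id_comp, op_smul_val, mul_inv_cancel]
        exact aut_smul_one_edge _
      · rw [map_to_one _ rfl, show SimplexCategory.const ⦋1⦌ ⦋1⦌ 1 ≫ f =
          SimplexCategory.const _ _ (f.toOrderHom 1) from rfl, hf.eq_one_of_const h, inv_one,
          MulOpposite.op_one, one_smul, aut_smul_one_edge]
  have := (hc.twistingAt_iff hμ (𝟙 _) (η σ)).2
  rw [map_id_op] at this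
  refine this ?_
  have h2 := hf.mul_eq (𝟙 _)
  rwa [map_id_op] at h2

end ModelTwisting

/-! ### The obstruction cocycle -/

section Obstruction

variable {M H : SSet.{u}} [IsPartialGroup M]

/-- The element of `N(M)` underlying an element of `Z(M)`, the latter written additively. -/
def cval (a : Additive (Center M)) : Normalizer M := a.toMul.1

lemma cval_injective : Function.Injective (cval (M := M)) := Subtype.val_injective

@[simp] lemma cval_zero : cval (0 : Additive (Center M)) = 1 := rfl

@[simp] lemma cval_add (a b : Additive (Center M)) : cval (a + b) = cval a * cval b := rfl

@[simp] lemma cval_neg (a : Additive (Center M)) : cval (-a) = (cval a)⁻¹ := rfl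

@[simp] lemma cval_sub (a b : Additive (Center M)) : cval (a - b) = cval a * (cval b)⁻¹ := by
  rw [sub_eq_add_neg, cval_add, cval_neg]

lemma cval_smul (f : Aut M) (a : Additive (Center M)) :
    cval ((QuotientGroup.mk f : Out M) • a) = f • cval a := rfl

lemma cval_comm (a : Additive (Center M)) (x : Normalizer M) : cval a * x = x * cval a :=
  center_comm a.toMul x

lemma conj_cval (a : Additive (Center M)) : conj (cval a) = 1 := mem_center_iff.1 a.toMul.2

lemma exists_cval {x : Normalizer M} (h : conj x = 1) : ∃ a, cval a = x :=
  ⟨Additive.ofMul ⟨x, mem_center_iff.2 h⟩, rfl⟩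

lemma face_face (X : SSet.{u}) {n : ℕ} {i k : Fin (n + 2)} {j l : Fin (n + 3)}
    (h : SimplexCategory.δ i ≫ SimplexCategory.δ j = SimplexCategory.δ k ≫ SimplexCategory.δ l)
    (x : X _⦋n + 2⦌) : X.δ i (X.δ j x) = X.δ k (X.δ l x) :=
  (map_map X _ _ x).trans ((map_congr X h x).trans (map_map X _ _ x).symm)

lemma δ_comm (X : SSet.{u}) {n : ℕ} {i j : Fin (n + 2)} (h : i ≤ j) (x : X _⦋n + 2⦌) :
    X.δ j (X.δ i.castSucc x) = X.δ i (X.δ j.succ x) :=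
  face_face X (SimplexCategory.δ_comp_δ h).symm x

variable {α : H ⟶ bar (Out M)} {t t' : H _⦋1⦌ → Aut M} {η η' : H _⦋2⦌ → Normalizer M}

section Coboundary

variable (ht : ∀ g, (QuotientGroup.mk (t g) : Out M) = onEdges α g)

include ht

lemma cval_coboundary_two (c : H _⦋2⦌ → Additive (Center M)) (σ : H _⦋3⦌) :
    cval (coboundary α _ 2 c σ) =
      t (spine H σ 0) • cval (c (H.δ 0 σ)) * (cval (c (H.δ 1 σ)))⁻¹ * cval (c (H.δ 2 σ)) *
        (cval (c (H.δ 3 σ)))⁻¹ := by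
  simp [coboundary, Fin.sum_univ_succ, ← ht, cval_smul, mul_assoc]

lemma cval_coboundary_three (c : H _⦋3⦌ → Additive (Center M)) (σ : H _⦋4⦌) :
    cval (coboundary α _ 3 c σ) =
      t (spine H σ 0) • cval (c (H.δ 0 σ)) * (cval (c (H.δ 1 σ)))⁻¹ * cval (c (H.δ 2 σ)) *
        (cval (c (H.δ 3 σ)))⁻¹ * cval (c (H.δ 4 σ)) := by
  simp [coboundary, Fin.sum_univ_succ, ← ht, cval_smul, mul_assoc]

end Coboundary

lemma obstruction_eq_iff {σ : H _⦋3⦌} {c : Normalizer M} : obstruction t η σ = c ↔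
    c * (t (spine H σ 0) • η (H.δ 0 σ) * η (H.δ 2 σ)) = η (H.δ 3 σ) * η (H.δ 1 σ) := by
  rw [← obstruction_mul, mul_left_inj, eq_comm]

lemma spine_three (σ : H _⦋3⦌) : spine H σ 0 = H.δ 2 (H.δ 3 σ) :=
  (map_congr H (by ext i; fin_cases i <;> rfl) σ).trans
    (map_map H (SimplexCategory.δ 2) (SimplexCategory.δ 3) σ).symm

/-- `κ` takes its values in `Z(M)`. -/
lemma conj_obstruction (hη : ∀ σ, conj (η σ) * t (H.δ 1 σ) = t (H.δ 2 σ) * t (H.δ 0 σ))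
    (σ : H _⦋3⦌) : conj (obstruction t η σ) = 1 := by
  have e20 : H.δ 2 (H.δ 0 σ) = H.δ 0 (H.δ 3 σ) := δ_comm H (i := 0) (j := 2) (by decide) σ
  have e21 : H.δ 2 (H.δ 1 σ) = H.δ 1 (H.δ 3 σ) := δ_comm H (i := 1) (j := 2) (by decide) σ
  have e00 : H.δ 0 (H.δ 0 σ) = H.δ 0 (H.δ 1 σ) := δ_comm H (i := 0) (j := 0) (by decide) σ
  have e10 : H.δ 1 (H.δ 0 σ) = H.δ 0 (H.δ 2 σ) := δ_comm H (i := 0) (j := 1) (by decide) σ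
  have e11 : H.δ 1 (H.δ 1 σ) = H.δ 1 (H.δ 2 σ) := δ_comm H (i := 1) (j := 1) (by decide) σ
  have e22 : H.δ 2 (H.δ 2 σ) = H.δ 2 (H.δ 3 σ) := δ_comm H (i := 2) (j := 2) (by decide) σ
  have h (τ) : conj (η τ) = t (H.δ 2 τ) * t (H.δ 0 τ) * (t (H.δ 1 τ))⁻¹ :=
    eq_mul_inv_of_mul_eq (hη τ)
  rw [obstruction, _root_.map_mul, _root_.map_mul, _root_.map_mul, _root_.map_inv, _root_.map_inv,
    conj_aut_smul, h, h, h, h, spine_three, e20, e21, e00, e10, e11, e22]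
  group

lemma exists_cval_obstruction
    (hη : ∀ σ, conj (η σ) * t (H.δ 1 σ) = t (H.δ 2 σ) * t (H.δ 0 σ)) :
    ∃ k : H _⦋3⦌ → Additive (Center M), ∀ σ, cval (k σ) = obstruction t η σ := by
  choose k hk using fun σ => exists_cval (conj_obstruction hη σ)
  exact ⟨k, hk⟩

/-- `κ` is a cocycle: on a simplex `[g | h | k | l]` with vertices `0, …, 4`, the product
`η₀₁₂ η₀₂₃ η₀₃₄` is computed in two ways. -/
lemma coboundary_obstruction (ht : ∀ g, (QuotientGroup.mk (t g) : Out M) = onEdges α g)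
    (hη : ∀ σ, conj (η σ) * t (H.δ 1 σ) = t (H.δ 2 σ) * t (H.δ 0 σ))
    {k : H _⦋3⦌ → Additive (Center M)} (hk : ∀ σ, cval (k σ) = obstruction t η σ) :
    coboundary α _ 3 k = 0 := by
  funext σ
  refine cval_injective ?_
  rw [cval_coboundary_three ht]
  have e00 : H.δ 0 (H.δ 0 σ) = H.δ 0 (H.δ 1 σ) := δ_comm H (i := 0) (j := 0) (by decide) σ
  have e10 : H.δ 1 (H.δ 0 σ) = H.δ 0 (H.δ 2 σ) := δ_comm H (i := 0) (j := 1) (by decide) σ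
  have e20 : H.δ 2 (H.δ 0 σ) = H.δ 0 (H.δ 3 σ) := δ_comm H (i := 0) (j := 2) (by decide) σ
  have e30 : H.δ 3 (H.δ 0 σ) = H.δ 0 (H.δ 4 σ) := δ_comm H (i := 0) (j := 3) (by decide) σ
  have e11 : H.δ 1 (H.δ 1 σ) = H.δ 1 (H.δ 2 σ) := δ_comm H (i := 1) (j := 1) (by decide) σ
  have e21 : H.δ 2 (H.δ 1 σ) = H.δ 1 (H.δ 3 σ) := δ_comm H (i := 1) (j := 2) (by decide) σ
  have e31 : H.δ 3 (H.δ 1 σ) = H.δ 1 (H.δ 4 σ) := δ_comm H (i := 1) (j := 3) (by decide) σ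
  have e22 : H.δ 2 (H.δ 2 σ) = H.δ 2 (H.δ 3 σ) := δ_comm H (i := 2) (j := 2) (by decide) σ
  have e32 : H.δ 3 (H.δ 2 σ) = H.δ 2 (H.δ 4 σ) := δ_comm H (i := 2) (j := 3) (by decide) σ
  have e33 : H.δ 3 (H.δ 3 σ) = H.δ 3 (H.δ 4 σ) := δ_comm H (i := 3) (j := 3) (by decide) σ
  have s0 : spine H (H.δ 0 σ) 0 = H.δ 0 (H.δ 3 (H.δ 4 σ)) := by
    rw [spine_three, e30]
    exact δ_comm H (i := 0) (j := 2) (by decide) (H.δ 4 σ)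
  have s1 : spine H (H.δ 1 σ) 0 = H.δ 1 (H.δ 3 (H.δ 4 σ)) := by
    rw [spine_three, e31]
    exact δ_comm H (i := 1) (j := 2) (by decide) (H.δ 4 σ)
  have s2 : spine H (H.δ 2 σ) 0 = H.δ 2 (H.δ 3 (H.δ 4 σ)) := by
    rw [spine_three, e32]
    exact δ_comm H (i := 2) (j := 2) (by decide) (H.δ 4 σ)
  have s3 : spine H (H.δ 3 σ) 0 = H.δ 2 (H.δ 3 (H.δ 4 σ)) := by
    rw [spine_three, e33]
  have s4 : spine H (H.δ 4 σ) 0 = H.δ 2 (H.δ 3 (H.δ 4 σ)) := spine_three _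
  have s : spine H σ 0 = H.δ 2 (H.δ 3 (H.δ 4 σ)) := by
    rw [← s4]
    exact (map_congr H (by ext i; fin_cases i <;> rfl) σ).trans (map_map H _ _ σ).symm
  have h0 := obstruction_mul (t := t) (η := η) (H.δ 0 σ)
  have h1 := obstruction_mul (t := t) (η := η) (H.δ 1 σ)
  have h2 := obstruction_mul (t := t) (η := η) (H.δ 2 σ)
  have h3 := obstruction_mul (t := t) (η := η) (H.δ 3 σ)
  have h4 := obstruction_mul (t := t) (η := η) (H.δ 4 σ)
  rw [← hk, s0, e00, e10, e20, e30] at h0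
  rw [← hk, s1, e11, e21, e31] at h1
  rw [← hk, s2, e22, e32] at h2
  rw [← hk, s3, e33] at h3
  rw [← hk, s4] at h4
  rw [s]
  have hC := hη (H.δ 3 (H.δ 4 σ))
  generalize t (H.δ 2 (H.δ 3 (H.δ 4 σ))) = A at *
  generalize t (H.δ 0 (H.δ 3 (H.δ 4 σ))) = B at *
  generalize t (H.δ 1 (H.δ 3 (H.δ 4 σ))) = C at *
  generalize η (H.δ 3 (H.δ 4 σ)) = n012 at *
  generalize η (H.δ 2 (H.δ 4 σ)) = n013 at *
  generalize η (H.δ 2 (H.δ 3 σ)) = n014 at *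
  generalize η (H.δ 1 (H.δ 4 σ)) = n023 at *
  generalize η (H.δ 1 (H.δ 3 σ)) = n024 at *
  generalize η (H.δ 1 (H.δ 2 σ)) = n034 at *
  generalize η (H.δ 0 (H.δ 4 σ)) = n123 at *
  generalize η (H.δ 0 (H.δ 3 σ)) = n124 at *
  generalize η (H.δ 0 (H.δ 2 σ)) = n134 at *
  generalize η (H.δ 0 (H.δ 1 σ)) = n234 at *
  generalize k (H.δ 0 σ) = k0 at *
  generalize k (H.δ 1 σ) = k1 at *
  generalize k (H.δ 2 σ) = k2 at *
  generalize k (H.δ 3 σ) = k3 at *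
  generalize k (H.δ 4 σ) = k4 at *
  have hX : n012 * C • n234 = A • B • n234 * n012 := by
    rw [← mul_inv_eq_iff_eq_mul, ← conj_smul_normalizer, smul_smul, hC, mul_smul]
  have hL : n012 * n023 * n034 =
      cval k4 * (cval k2 * A • cval k0 * (A • B • n234 * (A • n124 * n014))) := by
    calc n012 * n023 * n034 = cval k4 * (A • n123 * (n013 * n034)) := by
          rw [← h4]; simp only [mul_assoc]
      _ = cval k4 * (cval k2 * (A • (n123 * n134) * n014)) := by
          rw [← h2, ← mul_assoc (A • n123), ← cval_comm k2, smul_mul']; simp only [mul_assoc]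
      _ = _ := by rw [← h0, smul_mul', smul_mul']; simp only [mul_assoc]
  have hR : n012 * n023 * n034 =
      cval k1 * (cval k3 * (A • B • n234 * (A • n124 * n014))) := by
    calc n012 * n023 * n034 = cval k1 * (n012 * C • n234 * n024) := by
          rw [mul_assoc, ← h1, ← mul_assoc n012, ← cval_comm k1]; simp only [mul_assoc]
      _ = cval k1 * (A • B • n234 * (n012 * n024)) := by rw [hX]; simp only [mul_assoc]
      _ = _ := by rw [← h3, ← mul_assoc (A • B • n234), ← cval_comm k3, mul_assoc]
  rw [hL, ← mul_assoc, ← mul_assoc (cval k1), mul_left_inj, ← cval_smul] at hR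
  rw [← cval_smul]
  simp only [← cval_add, ← cval_neg] at hR ⊢
  have hR' := cval_injective hR
  congr 1
  rw [← sub_eq_zero] at hR'
  refine Eq.trans ?_ hR'
  abel

/-- Changing `η` by a central cochain `z` changes `κ` by the coboundary of `z`. -/
lemma obstruction_cval_mul (ht : ∀ g, (QuotientGroup.mk (t g) : Out M) = onEdges α g)
    (z : H _⦋2⦌ → Additive (Center M)) (σ : H _⦋3⦌) :
    obstruction t (fun σ => cval (z σ) * η σ) σ =
      (cval (coboundary α _ 2 z σ))⁻¹ * obstruction t η σ := by
  rw [obstruction_eq_iff, cval_coboundary_two ht, smul_mul', ← cval_smul]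
  have h := obstruction_mul (t := t) (η := η) σ
  have e1 : cval (z (H.δ 3 σ)) * η (H.δ 3 σ) * (cval (z (H.δ 1 σ)) * η (H.δ 1 σ)) =
      cval (z (H.δ 3 σ) + z (H.δ 1 σ)) * (η (H.δ 3 σ) * η (H.δ 1 σ)) := by
    rw [← mul_assoc, mul_assoc _ (η (H.δ 3 σ)), ← cval_comm, cval_add]
    simp only [mul_assoc]
  rw [e1, ← h]
  generalize (QuotientGroup.mk (t (spine H σ 0)) : Out M) • z (H.δ 0 σ) = z0
  generalize t (spine H σ 0) • η (H.δ 0 σ) = n0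
  generalize obstruction t η σ = κ
  have e2 : cval z0 * n0 * (cval (z (H.δ 2 σ)) * η (H.δ 2 σ)) =
      cval (z0 + z (H.δ 2 σ)) * (n0 * η (H.δ 2 σ)) := by
    rw [← mul_assoc, mul_assoc _ n0, ← cval_comm, cval_add]
    simp only [mul_assoc]
  rw [e2, mul_assoc, ← mul_assoc κ, ← cval_comm (z0 + z (H.δ 2 σ)) κ,
    mul_assoc _ κ, ← mul_assoc]
  congr 1
  simp only [← cval_add, ← cval_neg]
  congr 1
  abel

/-- A change of lifts does not change `κ`. -/
lemma obstruction_changeLift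
    (hη : ∀ σ, conj (η σ) * t (H.δ 1 σ) = t (H.δ 2 σ) * t (H.δ 0 σ))
    (ν : H _⦋1⦌ → Normalizer M) (σ : H _⦋3⦌) :
    obstruction (fun g => conj (ν g) * t g) (changeLift t η ν) σ = obstruction t η σ := by
  rw [obstruction_eq_iff]
  obtain ⟨k, hk⟩ := exists_cval (conj_obstruction hη σ)
  have h := obstruction_mul (t := t) (η := η) σ
  have hc := hη (H.δ 3 σ)
  rw [← hk] at h ⊢
  have e20 : H.δ 2 (H.δ 0 σ) = H.δ 0 (H.δ 3 σ) := δ_comm H (i := 0) (j := 2) (by decide) σ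
  have e21 : H.δ 2 (H.δ 1 σ) = H.δ 1 (H.δ 3 σ) := δ_comm H (i := 1) (j := 2) (by decide) σ
  have e00 : H.δ 0 (H.δ 0 σ) = H.δ 0 (H.δ 1 σ) := δ_comm H (i := 0) (j := 0) (by decide) σ
  have e10 : H.δ 1 (H.δ 0 σ) = H.δ 0 (H.δ 2 σ) := δ_comm H (i := 0) (j := 1) (by decide) σ
  have e11 : H.δ 1 (H.δ 1 σ) = H.δ 1 (H.δ 2 σ) := δ_comm H (i := 1) (j := 1) (by decide) σ
  have e22 : H.δ 2 (H.δ 2 σ) = H.δ 2 (H.δ 3 σ) := δ_comm H (i := 2) (j := 2) (by decide) σ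
  simp only [changeLift]
  rw [spine_three] at h ⊢
  rw [e20, e21, e00, e10, e11, e22]
  generalize t (H.δ 2 (H.δ 3 σ)) = A at *
  generalize t (H.δ 0 (H.δ 3 σ)) = B at *
  generalize t (H.δ 1 (H.δ 3 σ)) = C at *
  generalize ν (H.δ 2 (H.δ 3 σ)) = v01 at *
  generalize ν (H.δ 0 (H.δ 3 σ)) = v12 at *
  generalize ν (H.δ 1 (H.δ 3 σ)) = v02 at *
  generalize ν (H.δ 0 (H.δ 1 σ)) = v23 at *
  generalize ν (H.δ 1 (H.δ 2 σ)) = v03 at *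
  generalize ν (H.δ 0 (H.δ 2 σ)) = v13 at *
  generalize η (H.δ 0 σ) = n123 at *
  generalize η (H.δ 1 σ) = n023 at *
  generalize η (H.δ 2 σ) = n013 at *
  generalize η (H.δ 3 σ) = n012 at *
  have hX : n012 * C • v23 = A • B • v23 * n012 := by
    rw [← mul_inv_eq_iff_eq_mul, ← conj_smul_normalizer, smul_smul, hc, mul_smul]
  rw [mul_smul, conj_smul_normalizer]
  simp only [smul_mul', smul_inv']
  calc _ = cval k * (v01 * A • v12 * A • B • v23) * (A • n123 * n013) * v03⁻¹ := by group
    _ = v01 * A • v12 * A • B • v23 * (cval k * (A • n123 * n013)) * v03⁻¹ := by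
      rw [cval_comm]; group
    _ = v01 * A • v12 * (n012 * C • v23) * n023 * v03⁻¹ := by rw [h, hX]; group
    _ = _ := by group

lemma conj_changeLift (hη : ∀ σ, conj (η σ) * t (H.δ 1 σ) = t (H.δ 2 σ) * t (H.δ 0 σ))
    (ν : H _⦋1⦌ → Normalizer M) (σ : H _⦋2⦌) :
    conj (changeLift t η ν σ) = (conj (ν (H.δ 2 σ)) * t (H.δ 2 σ)) *
      (conj (ν (H.δ 0 σ)) * t (H.δ 0 σ)) * (conj (ν (H.δ 1 σ)) * t (H.δ 1 σ))⁻¹ := by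
  have h : conj (η σ) = t (H.δ 2 σ) * t (H.δ 0 σ) * (t (H.δ 1 σ))⁻¹ :=
    eq_mul_inv_of_mul_eq (hη σ)
  rw [changeLift, _root_.map_mul, _root_.map_mul, _root_.map_mul, _root_.map_inv, conj_aut_smul, h]
  group

end Obstruction

/-! ### Low-dimensional cochains -/

section Cochains

variable {H : SSet.{u}} {G : Type u} [Group G] {ρ : H ⟶ bar G}
  {A : Type u} [AddCommGroup A] [DistribMulAction G A]

lemma onEdges_mul (ρ : H ⟶ bar G) (σ : H _⦋2⦌) :
    onEdges ρ (H.δ 2 σ) * onEdges ρ (H.δ 0 σ) = onEdges ρ (H.δ 1 σ) := by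
  have h (i : Fin 3) : ρ.app _ (H.δ i σ) = (bar G).map (SimplexCategory.δ i).op (ρ.app _ σ) :=
    NatTrans.naturality_apply ρ (SimplexCategory.δ i).op σ
  rw [onEdges, onEdges, onEdges, h, h, h]
  exact (ρ.app _ σ).2 0 1 2

lemma onEdges_one (ρ : H ⟶ bar G) [IsReducedSSet H] : onEdges ρ (one H) = 1 := by
  have h : ρ.app _ (one H) = (bar G).map (SimplexCategory.σ 0).op (ρ.app _ (vertex H)) :=
    NatTrans.naturality_apply ρ (SimplexCategory.σ 0).op (vertex H)
  rw [onEdges, h]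
  exact mul_eq_left.1 ((ρ.app _ (vertex H)).2 0 0 0)

lemma coboundary_one_apply (u : H _⦋1⦌ → A) (σ : H _⦋2⦌) : coboundary ρ A 1 u σ =
    onEdges ρ (H.δ 2 σ) • u (H.δ 0 σ) - u (H.δ 1 σ) + u (H.δ 2 σ) := by
  have e : spine H σ 0 = H.δ 2 σ := map_congr H (by ext i; fin_cases i <;> rfl) σ
  simp [coboundary, Fin.sum_univ_succ, e]
  abel

lemma coboundary_two_apply (c : H _⦋2⦌ → A) (σ : H _⦋3⦌) : coboundary ρ A 2 c σ =
    onEdges ρ (H.δ 2 (H.δ 3 σ)) • c (H.δ 0 σ) - c (H.δ 1 σ) + c (H.δ 2 σ) - c (H.δ 3 σ) := by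
  rw [← spine_three]
  simp [coboundary, Fin.sum_univ_succ]
  abel

lemma coboundary_coboundary_one (u : H _⦋1⦌ → A) :
    coboundary ρ A 2 (coboundary ρ A 1 u) = 0 := by
  funext σ
  have e20 : H.δ 2 (H.δ 0 σ) = H.δ 0 (H.δ 3 σ) := δ_comm H (i := 0) (j := 2) (by decide) σ
  have e21 : H.δ 2 (H.δ 1 σ) = H.δ 1 (H.δ 3 σ) := δ_comm H (i := 1) (j := 2) (by decide) σ
  have e00 : H.δ 0 (H.δ 0 σ) = H.δ 0 (H.δ 1 σ) := δ_comm H (i := 0) (j := 0) (by decide) σ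
  have e10 : H.δ 1 (H.δ 0 σ) = H.δ 0 (H.δ 2 σ) := δ_comm H (i := 0) (j := 1) (by decide) σ
  have e11 : H.δ 1 (H.δ 1 σ) = H.δ 1 (H.δ 2 σ) := δ_comm H (i := 1) (j := 1) (by decide) σ
  have e22 : H.δ 2 (H.δ 2 σ) = H.δ 2 (H.δ 3 σ) := δ_comm H (i := 2) (j := 2) (by decide) σ
  have hm := onEdges_mul ρ (H.δ 3 σ)
  simp only [coboundary_two_apply, coboundary_one_apply, e20, e21, e00, e10, e11, e22, ← hm,
    smul_add, smul_sub, mul_smul, Pi.zero_apply]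
  abel

lemma mem_cocycles_iff {n : ℕ} {c : H _⦋n⦌ → A} : c ∈ cocycles ρ A n ↔ coboundary ρ A n c = 0 :=
  Iff.rfl

lemma cohomologyClass_eq_iff {n : ℕ} {a b : cocycles ρ A (n + 1)} :
    cohomologyClass ρ A a = cohomologyClass ρ A b ↔ ∃ u, coboundary ρ A n u = b.1 - a.1 := by
  rw [cohomologyClass, cohomologyClass, QuotientAddGroup.eq, AddSubgroup.mem_addSubgroupOf]
  refine exists_congr fun u => ?_
  rw [← neg_add_eq_sub]
  rfl

lemma cohomologyClass_eq_zero_iff {n : ℕ} {a : cocycles ρ A (n + 1)} :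
    cohomologyClass ρ A a = 0 ↔ ∃ u, coboundary ρ A n u = a.1 := by
  rw [eq_comm, ← show cohomologyClass ρ A 0 = 0 from rfl, cohomologyClass_eq_iff]
  simp

lemma δ_σ_zero_zero (g : H _⦋1⦌) : H.δ 0 (H.σ 0 g) = g := H.δ_comp_σ_self_apply 0 g

lemma δ_σ_one_zero (g : H _⦋1⦌) : H.δ 1 (H.σ 0 g) = g := H.δ_comp_σ_succ_apply 0 g

lemma δ_σ_one_one (g : H _⦋1⦌) : H.δ 1 (H.σ 1 g) = g := H.δ_comp_σ_self_apply 1 g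

lemma δ_σ_two_one (g : H _⦋1⦌) : H.δ 2 (H.σ 1 g) = g := H.δ_comp_σ_succ_apply 1 g

variable [IsReducedSSet H]

lemma δ_σ_two_zero (g : H _⦋1⦌) : H.δ 2 (H.σ 0 g) = one H :=
  (map_map H (SimplexCategory.δ 2) (SimplexCategory.σ 0) g).trans (map_to_one _ rfl g)

lemma δ_σ_zero_one (g : H _⦋1⦌) : H.δ 0 (H.σ 1 g) = one H :=
  (map_map H (SimplexCategory.δ 0) (SimplexCategory.σ 1) g).trans (map_to_one _ rfl g)

lemma coboundary_one_σ_zero (u : H _⦋1⦌ → A) (g : H _⦋1⦌) :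
    coboundary ρ A 1 u (H.σ 0 g) = u (one H) := by
  rw [coboundary_one_apply, δ_σ_zero_zero, δ_σ_one_zero, δ_σ_two_zero, onEdges_one, one_smul]
  abel

lemma coboundary_one_σ_one (u : H _⦋1⦌ → A) (g : H _⦋1⦌) :
    coboundary ρ A 1 u (H.σ 1 g) = onEdges ρ g • u (one H) := by
  rw [coboundary_one_apply, δ_σ_zero_one, δ_σ_one_one, δ_σ_two_one]
  abel

/-- A `2`-cochain whose coboundary vanishes on degenerate simplices becomes normalized after
subtracting the coboundary of a constant cochain. -/
lemma exists_normalized {z : H _⦋2⦌ → A}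
    (hz : ∀ (θ : ⦋3⦌ ⟶ ⦋1⦌) (g : H _⦋1⦌), coboundary ρ A 2 z (H.map θ.op g) = 0) :
    ∃ u : H _⦋1⦌ → A, ∀ g, (z - coboundary ρ A 1 u) (H.σ 0 g) = 0 ∧
      (z - coboundary ρ A 1 u) (H.σ 1 g) = 0 := by
  have hσ (f : ⦋2⦌ ⟶ ⦋1⦌) (hf : f.toOrderHom 0 = f.toOrderHom 2) (g : H _⦋1⦌) :
      H.map f.op g = H.σ 0 (one H) := by
    have e : f = SimplexCategory.σ 0 ≫ SimplexCategory.δ 1 ≫ f := by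
      have h1 : f.toOrderHom 0 ≤ f.toOrderHom 1 := f.toOrderHom.monotone (by decide)
      have h2 : f.toOrderHom 1 ≤ f.toOrderHom 2 := f.toOrderHom.monotone (by decide)
      ext i
      fin_cases i
      · rfl
      · exact congrArg Fin.val (le_antisymm (hf ▸ h2) h1)
      · rfl
    rw [e, ← map_map, map_to_one (SimplexCategory.δ 1 ≫ f) hf]
    rfl
  refine ⟨fun _ => z (H.σ 0 (one H)), fun g => ⟨?_, ?_⟩⟩
  · have h := hz (SimplexCategory.σ 0 ≫ SimplexCategory.σ 0) g
    have e0 : SimplexCategory.δ 0 ≫ SimplexCategory.σ 0 ≫ SimplexCategory.σ 0 =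
        (SimplexCategory.σ 0 : ⦋2⦌ ⟶ ⦋1⦌) := by ext i; fin_cases i <;> rfl
    have e1 : SimplexCategory.δ 1 ≫ SimplexCategory.σ 0 ≫ SimplexCategory.σ 0 =
        (SimplexCategory.σ 0 : ⦋2⦌ ⟶ ⦋1⦌) := by ext i; fin_cases i <;> rfl
    have e2 : SimplexCategory.δ 2 ≫ SimplexCategory.σ 0 ≫ SimplexCategory.σ 0 =
        (SimplexCategory.σ 0 : ⦋2⦌ ⟶ ⦋1⦌) := by ext i; fin_cases i <;> rfl
    have e3 : H.map (SimplexCategory.δ 2 ≫ SimplexCategory.δ 3 ≫ SimplexCategory.σ 0 ≫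
        SimplexCategory.σ 0).op g = one H := map_to_one _ rfl g
    rw [coboundary_two_apply, δ_map_apply, δ_map_apply, δ_map_apply, δ_map_apply, δ_map_apply,
      e0, e1, e2, e3, hσ (SimplexCategory.δ 3 ≫ SimplexCategory.σ 0 ≫ SimplexCategory.σ 0) rfl,
      onEdges_one, one_smul] at h
    rw [Pi.sub_apply, coboundary_one_σ_zero]
    rw [← h]
    change z (H.σ 0 g) - _ = z (H.σ 0 g) - z (H.σ 0 g) + z (H.σ 0 g) - _
    abel
  · have h := hz (SimplexCategory.σ 1 ≫ SimplexCategory.σ 1) g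
    have e1 : SimplexCategory.δ 1 ≫ SimplexCategory.σ 1 ≫ SimplexCategory.σ 1 =
        (SimplexCategory.σ 1 : ⦋2⦌ ⟶ ⦋1⦌) := by ext i; fin_cases i <;> rfl
    have e2 : SimplexCategory.δ 2 ≫ SimplexCategory.σ 1 ≫ SimplexCategory.σ 1 =
        (SimplexCategory.σ 1 : ⦋2⦌ ⟶ ⦋1⦌) := by ext i; fin_cases i <;> rfl
    have e3 : SimplexCategory.δ 3 ≫ SimplexCategory.σ 1 ≫ SimplexCategory.σ 1 =
        (SimplexCategory.σ 1 : ⦋2⦌ ⟶ ⦋1⦌) := by ext i; fin_cases i <;> rfl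
    have e4 : SimplexCategory.δ 2 ≫ SimplexCategory.σ 1 = 𝟙 ⦋1⦌ := by ext i; fin_cases i <;> rfl
    rw [coboundary_two_apply, δ_map_apply, δ_map_apply, δ_map_apply, δ_map_apply, δ_map_apply,
      e1, e2, e3, e4, map_id_op,
      hσ (SimplexCategory.δ 0 ≫ SimplexCategory.σ 1 ≫ SimplexCategory.σ 1) rfl] at h
    rw [Pi.sub_apply, coboundary_one_σ_one]
    rw [← neg_eq_zero, ← h]
    change -(z (H.σ 1 g) - _) = _ - z (H.σ 1 g) + z (H.σ 1 g) - z (H.σ 1 g)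
    abel

/-- Every `2`-dimensional cohomology class has a normalized representative. -/
lemma exists_normalized_cocycle (c : Cohomology ρ A 2) : ∃ v : cocycles ρ A 2,
    cohomologyClass ρ A v = c ∧ ∀ g : H _⦋1⦌, v.1 (H.σ 0 g) = 0 ∧ v.1 (H.σ 1 g) = 0 := by
  obtain ⟨w, rfl⟩ := QuotientAddGroup.mk_surjective c
  obtain ⟨u, hu⟩ := exists_normalized (ρ := ρ) (z := w.1) fun θ g => congrFun w.2 _
  refine ⟨⟨w.1 - coboundary ρ A 1 u, ?_⟩, ?_, hu⟩
  · rw [mem_cocycles_iff, _root_.map_sub, coboundary_coboundary_one, sub_zero]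
    exact w.2
  · refine cohomologyClass_eq_iff.2 ⟨u, ?_⟩
    change _ = w.1 - (w.1 - _)
    abel

end Cochains

/-! ### Existence of lifts and of extensions -/

section Existence

variable {M H : SSet.{u}} [IsPartialGroup M] [IsPartialGroup H] {α : H ⟶ bar (Out M)}
  {t t' : H _⦋1⦌ → Aut M} {η η' : H _⦋2⦌ → Normalizer M}

lemma exists_conj_mul_eq {f g : Aut M} (h : (QuotientGroup.mk f : Out M) = QuotientGroup.mk g) :
    ∃ ν : Normalizer M, conj ν * g = f := by
  obtain ⟨ν, hν⟩ := mem_inn_iff.1 ((QuotientGroup.eq_iff_div_mem).1 h)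
  exact ⟨ν, by rw [hν, div_mul_cancel]⟩

/-- Every outer action has a lift: representatives are chosen with the prescribed value on
degenerate simplices. -/
lemma exists_isLift (α : H ⟶ bar (Out M)) : ∃ t η, IsLift α t η := by
  have key (g : H _⦋1⦌) : ∃ f : Aut M, (QuotientGroup.mk f : Out M) = onEdges α g ∧
      (g = one H → f = 1) := by
    by_cases hg : g = one H
    · exact ⟨1, by rw [hg, onEdges_one]; rfl, fun _ => rfl⟩
    · obtain ⟨f, hf⟩ := QuotientGroup.mk_surjective (onEdges α g)
      exact ⟨f, hf, fun h => absurd h hg⟩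
  choose t ht ht1 using key
  have key (σ : H _⦋2⦌) : ∃ ν : Normalizer M,
      conj ν * t (H.δ 1 σ) = t (H.δ 2 σ) * t (H.δ 0 σ) ∧
      ((∃ g, σ = H.σ 0 g) ∨ (∃ g, σ = H.σ 1 g) → ν = 1) := by
    by_cases hσ : (∃ g, σ = H.σ 0 g) ∨ (∃ g, σ = H.σ 1 g)
    · refine ⟨1, ?_, fun _ => rfl⟩
      rw [_root_.map_one, one_mul]
      rcases hσ with ⟨g, rfl⟩ | ⟨g, rfl⟩
      · rw [δ_σ_zero_zero, δ_σ_one_zero, δ_σ_two_zero, ht1 _ rfl, one_mul]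
      · rw [δ_σ_zero_one, δ_σ_one_one, δ_σ_two_one, ht1 _ rfl, mul_one]
    · obtain ⟨ν, hν⟩ := exists_conj_mul_eq (f := t (H.δ 2 σ) * t (H.δ 0 σ)) (g := t (H.δ 1 σ)) (by
        rw [ht, ← onEdges_mul, ← ht, ← ht]; rfl)
      exact ⟨ν, hν, fun h => absurd h hσ⟩
  choose η hη hη1 using key
  exact ⟨t, η, ht, ht1 _ rfl, fun σ => homotopyBy_iff_conj.2 (hη σ),
    fun g => hη1 _ (Or.inl ⟨g, rfl⟩), fun g => hη1 _ (Or.inr ⟨g, rfl⟩)⟩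

lemma IsLift.obstruction_map (h : IsLift α t η) (θ : ⦋3⦌ ⟶ ⦋1⦌) (g : H _⦋1⦌) :
    obstruction t η (H.map θ.op g) = 1 := by
  rw [obstruction, δ_map_apply, δ_map_apply, δ_map_apply, δ_map_apply, h.η_map, h.η_map, h.η_map,
    h.η_map]
  simp

lemma IsLift.cval_mul (h : IsLift α t η) {z : H _⦋2⦌ → Additive (Center M)}
    (hz : ∀ g : H _⦋1⦌, z (H.σ 0 g) = 0 ∧ z (H.σ 1 g) = 0) :
    IsLift α t (fun σ => cval (z σ) * η σ) where
  mk_eq := h.mk_eq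
  map_one := h.map_one
  homotopy σ := by
    refine homotopyBy_iff_conj.2 ?_
    rw [_root_.map_mul, conj_cval, one_mul, h.conj_mul]
  one_left g := by rw [(hz g).1, h.one_left, cval_zero, one_mul]
  one_right g := by rw [(hz g).2, h.one_right, cval_zero, one_mul]

/-- The obstruction cocycle of a lift of the outer action. -/
lemma IsLift.exists_cocycle (h : IsLift α t η) : ∃ k : cocycles α (Additive (Center M)) 3,
    ∀ σ, cval (k.1 σ) = obstruction t η σ := by
  obtain ⟨k, hk⟩ := exists_cval_obstruction h.conj_mul
  exact ⟨⟨k, coboundary_obstruction h.mk_eq h.conj_mul hk⟩, hk⟩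

/-- The obstruction class does not depend on the lift: after a change of lifts, which preserves
`κ`, the two lifts differ by a central cochain, which changes `κ` by a coboundary. -/
lemma IsLift.cohomologyClass_eq (h : IsLift α t η) (h' : IsLift α t' η')
    {k k' : cocycles α (Additive (Center M)) 3} (hk : ∀ σ, cval (k.1 σ) = obstruction t η σ)
    (hk' : ∀ σ, cval (k'.1 σ) = obstruction t' η' σ) :
    cohomologyClass α _ k = cohomologyClass α _ k' := by
  choose ν hν using fun g => exists_conj_mul_eq ((h'.mk_eq g).trans (h.mk_eq g).symm)
  obtain rfl : (fun g => conj (ν g) * t g) = t' := funext hν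
  have hz (σ : H _⦋2⦌) : ∃ z, cval z = η' σ * (changeLift t η ν σ)⁻¹ := by
    refine exists_cval ?_
    rw [_root_.map_mul, _root_.map_inv, conj_changeLift h.conj_mul, mul_inv_eq_one,
      eq_mul_inv_iff_mul_eq]
    exact h'.conj_mul σ
  choose z hz using hz
  obtain rfl : (fun σ => cval (z σ) * changeLift t η ν σ) = η' :=
    funext fun σ => by rw [hz, inv_mul_cancel_right]
  refine cohomologyClass_eq_iff.2 ⟨-z, funext fun σ => cval_injective ?_⟩
  rw [_root_.map_neg, Pi.neg_apply, cval_neg, Pi.sub_apply, cval_sub, hk, hk',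
    obstruction_cval_mul h'.mk_eq, obstruction_changeLift h.conj_mul, mul_inv_cancel_right]

lemma Extension.HasTwistingPair.hasOuterAction {E : Extension M H} (h : E.HasTwistingPair t η)
    (ht : ∀ g, (QuotientGroup.mk (t g) : Out M) = onEdges α g) : E.HasOuterAction α := by
  obtain ⟨s, h1, -, h3, -⟩ := h
  exact fun g => ⟨s g, t g, h1 g, h3 g, ht g⟩

lemma IsLift.exists_extension (h : IsLift α t η) (hκ : ∀ σ, obstruction t η σ = 1) :
    ∃ E : Extension M H, E.HasOuterAction α ∧ E.HasTwistingPair t η :=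
  ⟨_, (h.hasTwistingPair_modelExtension hκ).hasOuterAction h.mk_eq,
    h.hasTwistingPair_modelExtension hκ⟩

/-- Extensions exist if and only if the obstruction class vanishes. -/
lemma IsLift.nonempty_extensionClass_iff (h : IsLift α t η)
    {k : cocycles α (Additive (Center M)) 3} (hk : ∀ σ, cval (k.1 σ) = obstruction t η σ) :
    Nonempty (ExtensionClass α) ↔ cohomologyClass α _ k = 0 := by
  constructor
  · rintro ⟨x⟩
    obtain ⟨⟨E, hE⟩, -⟩ := Quotient.exists_rep x
    obtain ⟨t', η', h'⟩ := E.exists_hasTwistingPair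
    rw [h.cohomologyClass_eq (h'.isLift hE) (k' := 0) hk fun σ => (h'.obstruction_eq_one σ).symm]
    rfl
  · intro h0
    obtain ⟨z, hz⟩ := cohomologyClass_eq_zero_iff.1 h0
    -- `κ` is normalized, hence is the coboundary of a normalized cochain.
    obtain ⟨u, hu⟩ := exists_normalized (ρ := α) (z := z) fun θ g => cval_injective (by
      rw [hz, hk, h.obstruction_map, cval_zero])
    obtain ⟨E, hE, -⟩ := (h.cval_mul hu).exists_extension fun σ => by
      rw [obstruction_cval_mul h.mk_eq, _root_.map_sub, coboundary_coboundary_one, sub_zero, hz, hk,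
        inv_mul_cancel]
    exact ⟨extensionClass E hE⟩

end Existence

/-! ### The action of the second cohomology group -/

section Action

variable {M H : SSet.{u}} [IsPartialGroup M] {α : H ⟶ bar (Out M)}
  {t t' : H _⦋1⦌ → Aut M} {η η' : H _⦋2⦌ → Normalizer M}

/-- Central factors of the lifts and of `η` pass through a change of lifts, the former by way of
their coboundary. -/
lemma changeLift_cval_mul (ht : ∀ g, (QuotientGroup.mk (t g) : Out M) = onEdges α g)
    (v : H _⦋2⦌ → Additive (Center M)) (u : H _⦋1⦌ → Additive (Center M))
    (ν : H _⦋1⦌ → Normalizer M) (σ : H _⦋2⦌) :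
    changeLift t (fun σ => cval (v σ) * η σ) (fun g => cval (u g) * ν g) σ =
      cval (v σ + coboundary α _ 1 u σ) * changeLift t η ν σ := by
  have hc (a : Additive (Center M)) (x : Normalizer M) : Commute (cval a) x := cval_comm a x
  rw [changeLift, changeLift, coboundary_one_apply, smul_mul', ← cval_smul, ht,
    (hc (onEdges α (H.δ 2 σ) • u (H.δ 0 σ)) _).symm.mul_mul_mul_comm, ← cval_add,
    (hc (v σ) _).symm.mul_mul_mul_comm, ← cval_add, (hc _ _).mul_inv, ← cval_neg,
    (hc (-u (H.δ 1 σ)) _).symm.mul_mul_mul_comm, ← cval_add]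
  congr 2
  abel

lemma changeLift_cval (ht : ∀ g, (QuotientGroup.mk (t g) : Out M) = onEdges α g)
    (u : H _⦋1⦌ → Additive (Center M)) (σ : H _⦋2⦌) :
    changeLift t η (fun g => cval (u g)) σ = cval (coboundary α _ 1 u σ) * η σ := by
  have h := changeLift_cval_mul (η := η) ht 0 u 1 σ
  simpa [changeLift] using h

variable [IsPartialGroup H]

lemma extensionClass_eq_iff {E E' : Extension M H} {hE : E.HasOuterAction α}
    {hE' : E'.HasOuterAction α} : extensionClass E hE = extensionClass E' hE' ↔ E.Equivalent E' :=
  Quotient.eq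

lemma exists_extensionClass_eq (x : ExtensionClass α) :
    ∃ (E : Extension M H) (hE : E.HasOuterAction α), extensionClass E hE = x := by
  obtain ⟨⟨E, hE⟩, rfl⟩ := Quotient.exists_rep x
  exact ⟨E, hE, rfl⟩

lemma Extension.HasTwistingPair.extensionClass_eq_iff {E E' : Extension M H}
    {hE : E.HasOuterAction α} {hE' : E'.HasOuterAction α} (h : E.HasTwistingPair t η) :
    extensionClass E hE = extensionClass E' hE' ↔ E'.HasTwistingPair t η :=
  PartialGroups.extensionClass_eq_iff.trans ⟨fun e => e.hasTwistingPair h, h.equivalent⟩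

/-- Twisting a class of extensions by a cohomology class: the effect on twisting pairs does not
depend on the representatives. -/
lemma exists_translate (c : Cohomology α (Additive (Center M)) 2) (x : ExtensionClass α) :
    ∃ y : ExtensionClass α, ∀ (E : Extension M H) (hE : E.HasOuterAction α),
      extensionClass E hE = x → ∀ (t : H _⦋1⦌ → Aut M) (η : H _⦋2⦌ → Normalizer M),
      E.HasTwistingPair t η → ∀ v : cocycles α (Additive (Center M)) 2,
      cohomologyClass α _ v = c → (∀ g : H _⦋1⦌, v.1 (H.σ 0 g) = 0 ∧ v.1 (H.σ 1 g) = 0) →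
      ∀ (E' : Extension M H) (hE' : E'.HasOuterAction α), y = extensionClass E' hE' ↔
        E'.HasTwistingPair t (fun σ => cval (v.1 σ) * η σ) := by
  obtain ⟨E₀, hE₀, rfl⟩ := exists_extensionClass_eq x
  obtain ⟨t₀, η₀, h₀⟩ := E₀.exists_hasTwistingPair
  obtain ⟨v₀, rfl, hv₀⟩ := exists_normalized_cocycle c
  have hl := h₀.isLift hE₀
  obtain ⟨E₁, hE₁, h₁⟩ := (hl.cval_mul hv₀).exists_extension fun σ => by
    rw [obstruction_cval_mul hl.mk_eq, mem_cocycles_iff.1 v₀.2, h₀.obstruction_eq_one]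
    simp
  refine ⟨extensionClass E₁ hE₁, fun E hE hx t η h v hvc hv E' hE' =>
    Extension.HasTwistingPair.extensionClass_eq_iff ?_⟩
  obtain ⟨ν, hν, ht, rfl⟩ := h₀.exists_changeLift ((extensionClass_eq_iff.1 hx).hasTwistingPair h)
  obtain rfl : t = fun g => conj (ν g) * t₀ g := funext ht
  obtain ⟨u, hu⟩ := cohomologyClass_eq_iff.1 hvc.symm
  have hu1 : u (one H) = 0 := by
    rw [← coboundary_one_σ_zero (ρ := α) u (one H), hu, Pi.sub_apply, (hv _).1, (hv₀ _).1, sub_zero]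
  have h2 := h₁.changeLift (ν := fun g => cval (u g) * ν g) (by rw [hu1, hν, cval_zero, one_mul])
  convert h2 using 1
  · funext g
    rw [_root_.map_mul, conj_cval, one_mul]
  · funext σ
    rw [changeLift_cval_mul hl.mk_eq, hu, Pi.sub_apply, add_sub_cancel]

variable (α) in
/-- The action of `H²(H; Z(M))` on the set of classes of extensions with outer action `α`: the
class of a normalized cocycle `v` takes a class with twisting pair `(t, η)` to the one with
twisting pair `(t, v η)`. -/
noncomputable abbrev translateAction :
    AddAction (Cohomology α (Additive (Center M)) 2) (ExtensionClass α) where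
  vadd c x := (exists_translate c x).choose
  zero_vadd x := by
    obtain ⟨E, hE, rfl⟩ := exists_extensionClass_eq x
    obtain ⟨t, η, h⟩ := E.exists_hasTwistingPair
    refine ((exists_translate 0 _).choose_spec E hE rfl t η h 0 rfl (fun _ => ⟨rfl, rfl⟩) E hE).2 ?_
    simpa using h
  add_vadd c c' x := by
    obtain ⟨E, hE, rfl⟩ := exists_extensionClass_eq x
    obtain ⟨t, η, h⟩ := E.exists_hasTwistingPair
    obtain ⟨v, rfl, hv⟩ := exists_normalized_cocycle c
    obtain ⟨v', rfl, hv'⟩ := exists_normalized_cocycle c'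
    obtain ⟨E₁, hE₁, e₁⟩ := exists_extensionClass_eq
      (exists_translate (cohomologyClass α _ v') (extensionClass E hE)).choose
    have h₁ := ((exists_translate _ _).choose_spec E hE rfl t η h v' rfl hv' E₁ hE₁).1 e₁.symm
    obtain ⟨E₂, hE₂, e₂⟩ := exists_extensionClass_eq
      (exists_translate (cohomologyClass α _ v) (extensionClass E₁ hE₁)).choose
    have h₂ := ((exists_translate _ _).choose_spec E₁ hE₁ rfl t _ h₁ v rfl hv E₂ hE₂).1 e₂.symm
    change (exists_translate (cohomologyClass α _ (v + v')) (extensionClass E hE)).choose =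
      (exists_translate _ (exists_translate _ _).choose).choose
    rw [← e₁, ← e₂]
    refine ((exists_translate _ _).choose_spec E hE rfl t η h (v + v') rfl (fun g => ?_)
      E₂ hE₂).2 ?_
    · change v.1 _ + v'.1 _ = 0 ∧ v.1 _ + v'.1 _ = 0
      rw [(hv g).1, (hv' g).1, (hv g).2, (hv' g).2, add_zero]
      exact ⟨rfl, rfl⟩
    · convert h₂ using 2 with σ
      exact mul_assoc (cval (v.1 σ)) (cval (v'.1 σ)) (η σ)

/-- Two twisting pairs `(t, η)` and `(t, v η)` of one extension come from lifts that differ by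
central elements, so that `v` is a coboundary. -/
lemma Extension.HasTwistingPair.cohomologyClass_eq_zero {E : Extension M H}
    (h : E.HasTwistingPair t η) (ht : ∀ g, (QuotientGroup.mk (t g) : Out M) = onEdges α g)
    {v : cocycles α (Additive (Center M)) 2}
    (hv : E.HasTwistingPair t (fun σ => cval (v.1 σ) * η σ)) : cohomologyClass α _ v = 0 := by
  obtain ⟨ν, -, hν, e⟩ := h.exists_changeLift hv
  choose u hu using fun g => exists_cval (right_eq_mul.1 (hν g))
  obtain rfl : (fun g => cval (u g)) = ν := funext hu
  refine cohomologyClass_eq_zero_iff.2 ⟨u, funext fun σ => cval_injective ?_⟩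
  have := congrFun e σ
  rw [changeLift_cval ht] at this
  exact (mul_right_cancel this).symm

/-- Suitable twisting pairs of any two extensions with the same outer action differ by a
normalized cocycle. -/
lemma exists_cocycle_of_hasOuterAction {E E' : Extension M H} (hE : E.HasOuterAction α)
    (hE' : E'.HasOuterAction α) : ∃ (t : H _⦋1⦌ → Aut M) (η : H _⦋2⦌ → Normalizer M)
      (v : cocycles α (Additive (Center M)) 2), E.HasTwistingPair t η ∧
      (∀ g : H _⦋1⦌, v.1 (H.σ 0 g) = 0 ∧ v.1 (H.σ 1 g) = 0) ∧
      E'.HasTwistingPair t (fun σ => cval (v.1 σ) * η σ) := by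
  obtain ⟨t, η, h⟩ := E.exists_hasTwistingPair
  obtain ⟨t', η', h'⟩ := E'.exists_hasTwistingPair
  have hl := h.isLift hE
  have hl' := h'.isLift hE'
  have key (g : H _⦋1⦌) : ∃ ν : Normalizer M, conj ν * t g = t' g ∧ (g = one H → ν = 1) := by
    by_cases hg : g = one H
    · exact ⟨1, by rw [hg, hl.map_one, hl'.map_one, _root_.map_one, one_mul], fun _ => rfl⟩
    · obtain ⟨ν, hν⟩ := exists_conj_mul_eq ((hl'.mk_eq g).trans (hl.mk_eq g).symm)
      exact ⟨ν, hν, fun e => absurd e hg⟩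
  choose ν hν hν1 using key
  obtain rfl : (fun g => conj (ν g) * t g) = t' := funext hν
  have h₁ := h.changeLift (hν1 _ rfl)
  have hl₁ := h₁.isLift hE
  have hw (σ : H _⦋2⦌) : ∃ z, cval z = η' σ * (changeLift t η ν σ)⁻¹ := by
    refine exists_cval ?_
    rw [_root_.map_mul, _root_.map_inv, mul_inv_eq_one]
    exact mul_right_cancel ((hl'.conj_mul σ).trans (hl₁.conj_mul σ).symm)
  choose w hw using hw
  obtain rfl : (fun σ => cval (w σ) * changeLift t η ν σ) = η' :=
    funext fun σ => by rw [hw, inv_mul_cancel_right]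
  refine ⟨_, _, ⟨w, mem_cocycles_iff.2 (funext fun σ => cval_injective ?_)⟩, h₁, fun g => ?_, h'⟩
  · have := obstruction_cval_mul (η := changeLift t η ν) hl₁.mk_eq w σ
    rw [h'.obstruction_eq_one, h₁.obstruction_eq_one, mul_one, eq_comm, inv_eq_one] at this
    exact this
  · exact ⟨cval_injective ((hw _).trans (mul_inv_eq_one.2
        ((hl'.one_left g).trans (hl₁.one_left g).symm))),
      cval_injective ((hw _).trans (mul_inv_eq_one.2
        ((hl'.one_right g).trans (hl₁.one_right g).symm)))⟩

end Action

end PartialGroups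

theorem theorem4p7 (M H : SSet.{u}) [PartialGroups.IsPartialGroup M]
    [PartialGroups.IsPartialGroup H]
    (α : H ⟶ PartialGroups.bar (PartialGroups.Out M)) :
    -- the obstruction class
    (∃ κ : PartialGroups.Cohomology α (Additive (PartialGroups.Center M)) 3,
      (∃ (t : H _⦋1⦌ → Aut M) (η : H _⦋2⦌ → PartialGroups.Normalizer M),
        PartialGroups.IsLift α t η) ∧
      (∀ (t : H _⦋1⦌ → Aut M) (η : H _⦋2⦌ → PartialGroups.Normalizer M),
        PartialGroups.IsLift α t η →
        ∃ k : PartialGroups.cocycles α (Additive (PartialGroups.Center M)) 3,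
          (∀ σ : H _⦋3⦌, (k.1 σ).toMul.1 = PartialGroups.obstruction t η σ) ∧
          PartialGroups.cohomologyClass α _ k = κ) ∧
      (Nonempty (PartialGroups.ExtensionClass α) ↔ κ = 0)) ∧
    -- the action of the second cohomology group
    (Nonempty (PartialGroups.ExtensionClass α) →
      ∃ _ : AddAction (PartialGroups.Cohomology α (Additive (PartialGroups.Center M)) 2)
          (PartialGroups.ExtensionClass α),
        (∀ (c : PartialGroups.Cohomology α (Additive (PartialGroups.Center M)) 2)
          (x : PartialGroups.ExtensionClass α), c +ᵥ x = x → c = 0) ∧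
        (∀ x y : PartialGroups.ExtensionClass α,
          ∃ c : PartialGroups.Cohomology α (Additive (PartialGroups.Center M)) 2, c +ᵥ x = y) ∧
        ∀ (E : PartialGroups.Extension M H) (hE : E.HasOuterAction α),
          (∃ (t : H _⦋1⦌ → Aut M) (η : H _⦋2⦌ → PartialGroups.Normalizer M),
            E.HasTwistingPair t η) ∧
          ∀ (t : H _⦋1⦌ → Aut M) (η : H _⦋2⦌ → PartialGroups.Normalizer M),
            E.HasTwistingPair t η →
            ∀ v : PartialGroups.cocycles α (Additive (PartialGroups.Center M)) 2,
              (∀ g : H _⦋1⦌, v.1 (H.σ 0 g) = 0 ∧ v.1 (H.σ 1 g) = 0) →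
              ∀ (E' : PartialGroups.Extension M H) (hE' : E'.HasOuterAction α),
                PartialGroups.cohomologyClass α _ v +ᵥ PartialGroups.extensionClass E hE =
                    PartialGroups.extensionClass E' hE' ↔
                  E'.HasTwistingPair t (fun σ => (v.1 σ).toMul.1 * η σ)) := by
  open PartialGroups in
  constructor
  · obtain ⟨t, η, h⟩ := exists_isLift α
    obtain ⟨k, hk⟩ := h.exists_cocycle
    refine ⟨cohomologyClass α _ k, ⟨t, η, h⟩, fun t' η' h' => ?_, h.nonempty_extensionClass_iff hk⟩
    obtain ⟨k', hk'⟩ := h'.exists_cocycle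
    exact ⟨k', hk', h'.cohomologyClass_eq h hk' hk⟩
  · refine fun _ => ⟨translateAction α, fun c x hc => ?_, fun x y => ?_, fun E hE =>
      ⟨E.exists_hasTwistingPair, fun t η h v hv E' hE' =>
        (exists_translate _ _).choose_spec E hE rfl t η h v rfl hv E' hE'⟩⟩
    · obtain ⟨E, hE, rfl⟩ := exists_extensionClass_eq x
      obtain ⟨t, η, h⟩ := E.exists_hasTwistingPair
      obtain ⟨v, rfl, hv⟩ := exists_normalized_cocycle c
      exact h.cohomologyClass_eq_zero (h.isLift hE).mk_eq
        (((exists_translate _ _).choose_spec E hE rfl t η h v rfl hv E hE).1 hc)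
    · obtain ⟨E, hE, rfl⟩ := exists_extensionClass_eq x
      obtain ⟨E', hE', rfl⟩ := exists_extensionClass_eq y
      obtain ⟨t, η, v, h, hv, h'⟩ := exists_cocycle_of_hasOuterAction hE hE'
      exact ⟨cohomologyClass α _ v,
        ((exists_translate _ _).choose_spec E hE rfl t η h v rfl hv E' hE').2 h'⟩
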